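/- **Setting.** Let $M$ be a compact smooth 3-manifold, $G$ a compact Lie group with Lie algebra $\mathfrak g$, $P\to M$ a smooth principal $G$-bundle (right action), $l>2$ an integer and $u_0\in P$. Let $\mathscr A$ be the space of framed connections of Sobolev class $L^2_{l-1}$: pairs $(A,u)$ of a connection form $A$ on $P$ of class $L^2_{l-1}$ and a point $u$ of the fibre through $u_0$. It is the smooth manifold modelled on $\Omega^1(M,\operatorname{ad}P)_{L^2_{l-1}}\times\mathfrak g$ obtained by writing $(A,u)=(A_0+a,u_0h)$, with $A_0$ a fixed connection of class $L^2_{l-1}$, $a$ a horizontal equivariant $\mathfrak g$-valued 1-form on $P$, and $h\in G$. Let $\mathscr G$ be the group of gauge transformations $\varphi(p)=p\,\mathbf g(p)$ of class $L^2_l$, with $\mathbf g:P\to G$, $\mathbf g(ph)=h^{-1}\mathbf g(p)h$. It acts on $\mathscr A$ on the right by $R_\varphi(A,u)=(\varphi^*A,\varphi^{-1}(u))$. Its Lie algebra $\mathcal Lie(\mathscr G)$ is the space of maps $\xi:P\to\mathfrak g$ of class $L^2_l$ with $\xi(ph)=\mathrm{Ad}(h^{-1})\xi(p)$. For $\xi\in\mathcal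 Lie(\mathscr G)$ let $\kappa(\xi)$ be the vector field $x\mapsto\frac{d}{ds}R_{\varphi_s}x|_{s=0}$ on $\mathscr A$, where $\varphi_s$ is a curve in $\mathscr G$ through the identity with velocity $\xi$; the values of the $\kappa(\xi)$ are the vertical vectors. Let $\eta$ be a connection form on $\mathscr A\to\mathscr A/\mathscr G$: a smooth $\mathcal Lie(\mathscr G)$-valued 1-form on $\mathscr A$ with $\eta(\kappa(\xi))=\xi$ and $\eta(dR_\varphi X)=\mathrm{Ad}(\mathbf g^{-1})\eta(X)$. On $\mathscr A\times P$ consider the $\mathfrak g$-valued 1-forms $\mathbf A^U_{(A,u,p)}(X,v)=A_p(v)$ and $\eta_{(A,u,p)}(X,v)=\eta_{(A,u)}(X)(p)$. Forms on $\mathscr A\times P$ are bigraded; $\Delta=\delta+d$ denotes the exterior derivative, with $\delta$ and $d$ the exterior derivatives in the directions of $\mathscr A$ and $P$, and $[\alpha,\beta](Z,W)=[\alpha(Z),\beta(W)]-[\alpha(W),\beta(Z)]$. Let $\mathbb A=\mathbf A^U+\eta$, let $\mathbb F=\Delta\mathbb A+\tfrac12[\mathbb A,\mathbb A]$, and put $$\phi=\delta\eta+\tfrac12[\eta,\eta],\qquad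 \psi=\delta\mathbf A^U+d\eta+[\mathbf A^U,\eta],\qquad \mathbf F^U=d\mathbf A^U+\tfrac12[\mathbf A^U,\mathbf A^U].$$ Let $\Pi_V=\kappa\circ\eta$ and $\Pi_H=1-\Pi_V$ be the vertical and horizontal projections of $T\mathscr A$ defined by $\eta$, and let $\delta_V\alpha=\delta\alpha(\Pi_V\cdot,\Pi_V\cdot)$ and $\delta_H\alpha=\delta\alpha(\Pi_H\cdot,\Pi_H\cdot)$, the projections acting on the components of the arguments along $\mathscr A$. Let $d_{\mathbf A^U}\eta$ be $d\eta$ evaluated on arguments whose $P$-components are first projected by $\pi_A:TP\to\ker A$. **Claim.** 1. The components of $\mathbb F$ of bidegree $(2,0)$, $(1,1)$, $(0,2)$ are $\phi$, $\psi$, $\mathbf F^U$, and $\mathbb F=\phi+\psi+\mathbf F^U$ at every $((A,u),p)$ if $l\ge 4$, and, if $l=3$, at every $((A,u),p)$ such that $A$ is differentiable at $p$. Derivatives are taken pointwise; for $l=3$, where $A$ is only continuous, $d\mathbf A^U$ has its usual meaning at the points where $A$ is differentiable (almost every $p$). 2. $\psi$ is horizontal for $\eta$: $\imath_{(\mathbf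 v,0)}\psi=0$ for every vertical $\mathbf v\in T\mathscr A$. 3. $d_{\mathbf A^U}\eta=d\eta+[\mathbf A^U,\eta]$, $\ \delta\mathbf A^U=\delta_V\mathbf A^U+\delta_H\mathbf A^U$, $\ \delta_V\mathbf A^U=-d_{\mathbf A^U}\eta$, $\ \delta_H\mathbf A^U=\psi$. 4. $\delta\eta=\delta_V\eta+\delta_H\eta$, $\ \delta_V\eta=-\tfrac12[\eta,\eta]$, $\ \delta_H\eta=\phi$. -/

import Mathlib

open scoped Manifold ContDiff Topology BoundedContinuousFunction
open MeasureTheory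

noncomputable section

/-- The model space of `n`-dimensional manifolds. The tangent space at any point of a manifold
modelled on `E n` is, by definition in Mathlib, the vector space `E n` (read in the preferred chart
at that point). -/
abbrev E (n : ℕ) : Type := EuclideanSpace ℝ (Fin n)

/-! ## Sobolev spaces of functions and of one-forms -/

section Sobolev

variable {n : ℕ} {V : Type*} [NormedAddCommGroup V] [NormedSpace ℝ V]

/-- `w'` is the weak derivative of `w` on the open set `U`. -/
def HasWeakDeriv {j : ℕ} (U : TopologicalSpace.Opens (E n))
    (w : E n → E n [×j]→L[ℝ] V) (w' : E n → E n [×(j + 1)]→L[ℝ] V) : Prop :=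
  ∀ φ : E n → ℝ, ContDiff ℝ ∞ φ → HasCompactSupport φ → tsupport φ ⊆ U → ∀ v : E n,
    ∫ x in (U : Set (E n)), (fderiv ℝ φ x v) • w x =
      - ∫ x in (U : Set (E n)), φ x • (w' x).curryLeft v

/-- The normed space in which the derivatives of a local representative live: bounded continuous
functions for the derivatives of order `≤ k - 2`, square integrable functions for those of
order `≤ k`. -/
def JetSpace {ι : Type} (k : ℕ) (O : ι → TopologicalSpace.Opens (E n)) (V : Type*)
    [NormedAddCommGroup V] [NormedSpace ℝ V] : Type _ :=
  (i : ι) → ((j : Fin (k - 2 + 1)) → ((O i : Set (E n)) →ᵇ (E n [×(j : ℕ)]→L[ℝ] V))) ×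
    ((j : Fin (k + 1)) → Lp (E n [×(j : ℕ)]→L[ℝ] V) 2 (volume.restrict (O i : Set (E n))))

instance {ι : Type} [Fintype ι] (k : ℕ) (O : ι → TopologicalSpace.Opens (E n)) :
    NormedAddCommGroup (JetSpace k O V) :=
  inferInstanceAs (NormedAddCommGroup ((i : ι) →
    ((j : Fin (k - 2 + 1)) → ((O i : Set (E n)) →ᵇ (E n [×(j : ℕ)]→L[ℝ] V))) ×
    ((j : Fin (k + 1)) → Lp (E n [×(j : ℕ)]→L[ℝ] V) 2 (volume.restrict (O i : Set (E n))))))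

set_option synthInstance.maxHeartbeats 400000 in
instance {ι : Type} [Fintype ι] (k : ℕ) (O : ι → TopologicalSpace.Opens (E n)) :
    NormedSpace ℝ (JetSpace k O V) :=
  inferInstanceAs (NormedSpace ℝ ((i : ι) →
    ((j : Fin (k - 2 + 1)) → ((O i : Set (E n)) →ᵇ (E n [×(j : ℕ)]→L[ℝ] V))) ×
    ((j : Fin (k + 1)) → Lp (E n [×(j : ℕ)]→L[ℝ] V) 2 (volume.restrict (O i : Set (E n))))))

/-- `D` consists of the derivatives of the local representatives `L i f : O i → V` of the field `f`:
classical and bounded ones up to order `k - 2`, and weak, square integrable ones up to order `k`. -/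
structure IsSobolevJet {ι : Type} [Fintype ι] (k : ℕ) (O : ι → TopologicalSpace.Opens (E n)) {Φ : Type*}
    [AddCommGroup Φ] [Module ℝ Φ] (L : ι → Φ →ₗ[ℝ] (E n → V)) (f : Φ) (D : JetSpace k O V) :
    Prop where
  contDiffOn : ∀ i, ContDiffOn ℝ ((k - 2 : ℕ) : ℕ∞) (L i f) (O i)
  classical : ∀ i (j : Fin (k - 2 + 1)) (y : (O i : Set (E n))),
    (D i).1 j y = iteratedFDeriv ℝ j (L i f) y
  zero : ∀ i, ⇑((D i).2 ⟨0, by omega⟩) =ᵐ[volume.restrict (O i : Set (E n))]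
    fun y => iteratedFDeriv ℝ 0 (L i f) y
  weak : ∀ i (j : ℕ) (hj : j < k),
    HasWeakDeriv (O i) ((D i).2 ⟨j, by omega⟩) ((D i).2 ⟨j + 1, by omega⟩)

theorem integrable_bdd_smul {F : Type*} [NormedAddCommGroup F] [NormedSpace ℝ F]
    (U : TopologicalSpace.Opens (E n)) (w : Lp F 2 (volume.restrict (U : Set (E n))))
    {φ : E n → ℝ} (hφ : Continuous φ) (hc : HasCompactSupport φ) :
    Integrable (fun x => φ x • w x) (volume.restrict (U : Set (E n))) := by
  have h1 : MemLp φ 2 (volume.restrict (U : Set (E n))) := hφ.memLp_of_hasCompactSupport hc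
  have h2 : MemLp (φ • ⇑w) 1 (volume.restrict (U : Set (E n))) := (Lp.memLp w).smul h1
  exact memLp_one_iff_integrable.1 h2

theorem integrable_bdd_smul_curryLeft {j : ℕ}
    (U : TopologicalSpace.Opens (E n))
    (w : Lp (E n [×(j + 1)]→L[ℝ] V) 2 (volume.restrict (U : Set (E n))))
    {φ : E n → ℝ} (hφ : Continuous φ) (hc : HasCompactSupport φ) (v : E n) :
    Integrable (fun x => φ x • (w x).curryLeft v) (volume.restrict (U : Set (E n))) := by
  have h := integrable_bdd_smul U w hφ hc
  let T : (E n [×(j + 1)]→L[ℝ] V) →L[ℝ] (E n [×j]→L[ℝ] V) :=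
    (ContinuousLinearMap.apply ℝ (E n [×j]→L[ℝ] V) v).comp
      (continuousMultilinearCurryLeftEquiv ℝ (fun _ : Fin (j + 1) => E n)
        V).toContinuousLinearEquiv.toContinuousLinearMap
  have h2 := T.integrable_comp h
  refine h2.congr (Filter.Eventually.of_forall fun x => ?_)
  simp only [map_smul]
  rfl

theorem HasWeakDeriv.add_lp {j : ℕ} {U : TopologicalSpace.Opens (E n)}
    {w z : Lp (E n [×j]→L[ℝ] V) 2 (volume.restrict (U : Set (E n)))}
    {w' z' : Lp (E n [×(j + 1)]→L[ℝ] V) 2 (volume.restrict (U : Set (E n)))}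
    (h : HasWeakDeriv U w w') (h' : HasWeakDeriv U z z') :
    HasWeakDeriv U (w + z : Lp _ _ _) (w' + z' : Lp _ _ _) := by
  intro φ hφ hc hs v
  have cφ : Continuous φ := hφ.continuous
  have cφ' : Continuous fun x => fderiv ℝ φ x v :=
    (hφ.continuous_fderiv (by simp)).clm_apply continuous_const
  have cc : HasCompactSupport fun x => fderiv ℝ φ x v := hc.fderiv_apply ℝ v
  have e1 : ∫ x in (U : Set (E n)), (fderiv ℝ φ x v) • (w + z : Lp _ _ _) x =
      ∫ x in (U : Set (E n)), ((fderiv ℝ φ x v) • w x + (fderiv ℝ φ x v) • z x) := by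
    refine integral_congr_ae ?_
    filter_upwards [Lp.coeFn_add w z] with x hx
    rw [hx, Pi.add_apply, smul_add]
  have e2 : ∫ x in (U : Set (E n)), φ x • ((w' + z' : Lp _ _ _) x).curryLeft v =
      ∫ x in (U : Set (E n)), (φ x • (w' x).curryLeft v + φ x • (z' x).curryLeft v) := by
    refine integral_congr_ae ?_
    filter_upwards [Lp.coeFn_add w' z'] with x hx
    rw [hx, Pi.add_apply, ← smul_add]
    rfl
  rw [e1, e2, integral_add (integrable_bdd_smul U w cφ' cc) (integrable_bdd_smul U z cφ' cc),
    integral_add (integrable_bdd_smul_curryLeft U w' cφ hc v)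
      (integrable_bdd_smul_curryLeft U z' cφ hc v), h φ hφ hc hs v, h' φ hφ hc hs v, neg_add]

theorem HasWeakDeriv.smul_lp {j : ℕ} {U : TopologicalSpace.Opens (E n)} (c : ℝ)
    {w : Lp (E n [×j]→L[ℝ] V) 2 (volume.restrict (U : Set (E n)))}
    {w' : Lp (E n [×(j + 1)]→L[ℝ] V) 2 (volume.restrict (U : Set (E n)))}
    (h : HasWeakDeriv U w w') :
    HasWeakDeriv U (c • w : Lp _ _ _) (c • w' : Lp _ _ _) := by
  intro φ hφ hc hs v
  have e1 : ∫ x in (U : Set (E n)), (fderiv ℝ φ x v) • (c • w : Lp _ _ _) x =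
      ∫ x in (U : Set (E n)), c • ((fderiv ℝ φ x v) • w x) := by
    refine integral_congr_ae ?_
    filter_upwards [Lp.coeFn_smul c w] with x hx
    rw [hx, Pi.smul_apply, smul_comm]
  have e2 : ∫ x in (U : Set (E n)), φ x • ((c • w' : Lp _ _ _) x).curryLeft v =
      ∫ x in (U : Set (E n)), c • (φ x • (w' x).curryLeft v) := by
    refine integral_congr_ae ?_
    filter_upwards [Lp.coeFn_smul c w'] with x hx
    rw [hx, Pi.smul_apply, smul_comm c]
    rfl
  rw [e1, e2, integral_smul, integral_smul, h φ hφ hc hs v, smul_neg]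

theorem IsSobolevJet.add {ι : Type} [Fintype ι] {k : ℕ} {O : ι → TopologicalSpace.Opens (E n)} {Φ : Type*}
    [AddCommGroup Φ] [Module ℝ Φ] {L : ι → Φ →ₗ[ℝ] (E n → V)} {f g : Φ} {D D' : JetSpace k O V}
    (h : IsSobolevJet k O L f D) (h' : IsSobolevJet k O L g D') :
    IsSobolevJet k O L (f + g) (D + D') where
  contDiffOn i := by
    rw [map_add]
    exact (h.contDiffOn i).add (h'.contDiffOn i)
  classical i j y := by
    have hy : (O i : Set (E n)) ∈ 𝓝 (y : E n) := (O i).isOpen.mem_nhds y.2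
    have hj : (((j : ℕ) : ℕ∞) : WithTop ℕ∞) ≤ (((k - 2 : ℕ) : ℕ∞) : WithTop ℕ∞) := by
      have := j.2
      exact_mod_cast (by omega : (j : ℕ) ≤ k - 2)
    rw [map_add, iteratedFDeriv_add_apply (((h.contDiffOn i).contDiffAt hy).of_le hj)
      (((h'.contDiffOn i).contDiffAt hy).of_le hj), ← h.classical, ← h'.classical]
    rfl
  zero i := by
    refine (Lp.coeFn_add ((D i).2 ⟨0, by omega⟩) ((D' i).2 ⟨0, by omega⟩)).trans ?_
    filter_upwards [h.zero i, h'.zero i] with x h1 h2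
    rw [Pi.add_apply, h1, h2]
    ext m
    simp
  weak i j hj := (h.weak i j hj).add_lp (h'.weak i j hj)

theorem IsSobolevJet.smul {ι : Type} [Fintype ι] {k : ℕ} {O : ι → TopologicalSpace.Opens (E n)} {Φ : Type*}
    [AddCommGroup Φ] [Module ℝ Φ] {L : ι → Φ →ₗ[ℝ] (E n → V)} {f : Φ} {D : JetSpace k O V} (c : ℝ)
    (h : IsSobolevJet k O L f D) : IsSobolevJet k O L (c • f) (c • D) where
  contDiffOn i := by
    rw [map_smul]
    exact (h.contDiffOn i).const_smul c
  classical i j y := by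
    have hy : (O i : Set (E n)) ∈ 𝓝 (y : E n) := (O i).isOpen.mem_nhds y.2
    have hj : (((j : ℕ) : ℕ∞) : WithTop ℕ∞) ≤ (((k - 2 : ℕ) : ℕ∞) : WithTop ℕ∞) := by
      have := j.2
      exact_mod_cast (by omega : (j : ℕ) ≤ k - 2)
    rw [map_smul, iteratedFDeriv_const_smul_apply (((h.contDiffOn i).contDiffAt hy).of_le hj),
      ← h.classical]
    rfl
  zero i := by
    refine (Lp.coeFn_smul c ((D i).2 ⟨0, by omega⟩)).trans ?_
    filter_upwards [h.zero i] with x h1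
    rw [Pi.smul_apply, h1]
    ext m
    simp
  weak i j hj := (h.weak i j hj).smul_lp c

theorem IsSobolevJet.zero_zero {ι : Type} [Fintype ι] (k : ℕ) (O : ι → TopologicalSpace.Opens (E n))
    {Φ : Type*} [AddCommGroup Φ] [Module ℝ Φ] (L : ι → Φ →ₗ[ℝ] (E n → V)) :
    IsSobolevJet k O L 0 0 where
  contDiffOn i := by
    rw [map_zero]
    exact contDiffOn_const
  classical i j y := by
    rw [map_zero]
    have : (0 : E n → V) = fun _ => 0 := rfl
    rw [this, iteratedFDeriv_fun_zero]
    rfl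
  zero i := by
    refine (Lp.coeFn_zero _ 2 _).trans (Filter.Eventually.of_forall fun x => ?_)
    ext m
    simp
  weak i j hj := by
    intro φ _ _ _ v
    have e1 : ∫ x in (O i : Set (E n)), (fderiv ℝ φ x v) •
        (0 : Lp (E n [×j]→L[ℝ] V) 2 (volume.restrict (O i : Set (E n)))) x = 0 := by
      refine integral_eq_zero_of_ae ?_
      filter_upwards [Lp.coeFn_zero (E n [×j]→L[ℝ] V) 2 (volume.restrict (O i : Set (E n)))]
        with x hx
      rw [hx]
      simp
    have e2 : ∫ x in (O i : Set (E n)), φ x •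
        ((0 : Lp (E n [×(j + 1)]→L[ℝ] V) 2
          (volume.restrict (O i : Set (E n)))) x).curryLeft v = 0 := by
      refine integral_eq_zero_of_ae ?_
      filter_upwards [Lp.coeFn_zero (E n [×(j + 1)]→L[ℝ] V) 2
        (volume.restrict (O i : Set (E n)))] with x hx
      rw [hx]
      ext m
      simp
    exact e1.trans (by rw [← neg_zero, ← e2]; rfl)

/-- The fields of Sobolev class `L²_k`, each paired with its (uniquely determined) derivatives. -/
def sobolevSubmodule {ι : Type} [Fintype ι] (k : ℕ) (O : ι → TopologicalSpace.Opens (E n)) {Φ : Type*}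
    [AddCommGroup Φ] [Module ℝ Φ] (L : ι → Φ →ₗ[ℝ] (E n → V)) :
    Submodule ℝ (Φ × JetSpace k O V) where
  carrier := {p | IsSobolevJet k O L p.1 p.2}
  zero_mem' := IsSobolevJet.zero_zero k O L
  add_mem' := fun h h' => IsSobolevJet.add h h'
  smul_mem' := fun c _ h => IsSobolevJet.smul c h

/-- The derivatives of a field of class `L²_k`, as a linear map. -/
def sobolevJet {ι : Type} [Fintype ι] (k : ℕ) (O : ι → TopologicalSpace.Opens (E n)) {Φ : Type*}
    [AddCommGroup Φ] [Module ℝ Φ] (L : ι → Φ →ₗ[ℝ] (E n → V)) :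
    sobolevSubmodule k O L →ₗ[ℝ] JetSpace k O V :=
  (LinearMap.snd ℝ Φ (JetSpace k O V)).comp (sobolevSubmodule k O L).subtype

theorem sobolevJet_injective {ι : Type} [Fintype ι] (k : ℕ) (O : ι → TopologicalSpace.Opens (E n)) {Φ : Type*}
    [AddCommGroup Φ] [Module ℝ Φ] (L : ι → Φ →ₗ[ℝ] (E n → V))
    (hL : ∀ f, (∀ i, ∀ y ∈ O i, L i f y = 0) → f = 0) :
    Function.Injective (sobolevJet k O L) := by
  refine (injective_iff_map_eq_zero (sobolevJet k O L)).2 ?_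
  rintro ⟨⟨f, D⟩, hf : IsSobolevJet k O L f D⟩ (hD : D = 0)
  subst hD
  have : f = 0 := hL f fun i y hy => by
    have h := hf.classical i ⟨0, by omega⟩ ⟨y, hy⟩
    have h2 : iteratedFDeriv ℝ 0 (L i f) y = 0 := h.symm
    have h3 := congrArg (fun m : E n [×0]→L[ℝ] V => m 0) h2
    simpa using h3
  subst this
  rfl

end Sobolev

/-! ## Forms in charts -/

section Forms

variable {B H X V : Type*} [NormedAddCommGroup B] [NormedSpace ℝ B] [TopologicalSpace H]
  [TopologicalSpace X] [ChartedSpace H X] [NormedAddCommGroup V] [NormedSpace ℝ V]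

/-- The value at `y`, on the constant vector field `v`, of the one-form `α` read in the chart
centred at `x₀`. A one-form assigns to `x` a function on `TangentSpace I x`, which is `B`. -/
def localRep (I : ModelWithCorners ℝ B H) (α : X → B → V) (x₀ : X) (y v : B) : V :=
  α ((extChartAt I x₀).symm y) (mfderiv 𝓘(ℝ, B) I (extChartAt I x₀).symm y v)

/-- The derivative at `x`, in the direction `u`, of the value of `α` on the vector field `v` that
is constant in the chart centred at `x`. -/
def chartDeriv (I : ModelWithCorners ℝ B H) (α : X → B → V) (x : X) (u v : B) : V :=
  lineDeriv ℝ (fun y => localRep I α x y v) (extChartAt I x x) u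

/-- The exterior derivative of a one-form, `dα(u, v) = ∂_u α(v) - ∂_v α(u)` for vector fields `u`, `v`
that are constant in a chart. For a connection on a bundle over a manifold of dimension `3` whose
class is only `L²_2`, this is defined at almost every point and is the weak exterior derivative. -/
def extDerivOne (I : ModelWithCorners ℝ B H) (α : X → B → V) (x : X) (u v : B) : V :=
  chartDeriv I α x u v - chartDeriv I α x v u

end Forms

/-! ## Sobolev spaces on a manifold -/

section Cover

/-- A finite cover of a (necessarily compact) manifold by open sets, each relatively compact in the
domain of a chart. It is used to define Sobolev norms; different covers give equivalent norms. -/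
structure ChartCover (n : ℕ) (P : Type*) [TopologicalSpace P] [ChartedSpace (E n) P] where
  ι : Type
  [fintype : Fintype ι]
  center : ι → P
  dom : ι → Set P
  isOpen_dom : ∀ i, IsOpen (dom i)
  relCompact : ∀ i, ∃ K, IsCompact K ∧ dom i ⊆ K ∧ K ⊆ (extChartAt (𝓡 n) (center i)).source
  cover : ∀ p, ∃ i, p ∈ dom i

attribute [instance] ChartCover.fintype

variable {n : ℕ} {P : Type*} [TopologicalSpace P] [ChartedSpace (E n) P]

/-- The image of the `i`-th set of the cover in the `i`-th chart. -/
def ChartCover.chartDom (C : ChartCover n P) (i : C.ι) : TopologicalSpace.Opens (E n) :=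
  ⟨(extChartAt (𝓡 n) (C.center i)).target ∩ (extChartAt (𝓡 n) (C.center i)).symm ⁻¹' C.dom i,
    (continuousOn_extChartAt_symm (C.center i)).isOpen_inter_preimage
      (isOpen_extChartAt_target (C.center i)) (C.isOpen_dom i)⟩

variable (V : Type*) [NormedAddCommGroup V] [NormedSpace ℝ V]

/-- A function on `P` read in the `i`-th chart. -/
def ChartCover.funRep (C : ChartCover n P) (i : C.ι) : (P → V) →ₗ[ℝ] (E n → V) where
  toFun f := fun y => f ((extChartAt (𝓡 n) (C.center i)).symm y)
  map_add' _ _ := rfl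
  map_smul' _ _ := rfl

/-- A one-form on `P` read in the `i`-th chart. -/
def ChartCover.formRep (C : ChartCover n P) (i : C.ι) :
    (P → E n →L[ℝ] V) →ₗ[ℝ] (E n → E n →L[ℝ] V) where
  toFun a := fun y => (a ((extChartAt (𝓡 n) (C.center i)).symm y)).comp
    (mfderiv 𝓘(ℝ, E n) (𝓡 n) (extChartAt (𝓡 n) (C.center i)).symm y : E n →L[ℝ] E n)
  map_add' _ _ := rfl
  map_smul' _ _ := rfl

variable {V}

theorem ChartCover.exists_chart (C : ChartCover n P) (p : P) :
    ∃ i, p ∈ (extChartAt (𝓡 n) (C.center i)).source ∧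
      extChartAt (𝓡 n) (C.center i) p ∈ C.chartDom i := by
  obtain ⟨i, hi⟩ := C.cover p
  obtain ⟨K, -, hK, hK'⟩ := C.relCompact i
  have hp : p ∈ (extChartAt (𝓡 n) (C.center i)).source := hK' (hK hi)
  refine ⟨i, hp, Set.mem_inter ((extChartAt (𝓡 n) (C.center i)).map_source hp) ?_⟩
  show (extChartAt (𝓡 n) (C.center i)).symm (extChartAt (𝓡 n) (C.center i) p) ∈ C.dom i
  rwa [(extChartAt (𝓡 n) (C.center i)).left_inv hp]

theorem ChartCover.funRep_injective (C : ChartCover n P) (f : P → V)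
    (hf : ∀ i, ∀ y ∈ C.chartDom i, C.funRep V i f y = 0) : f = 0 := by
  funext p
  obtain ⟨i, hp, hi⟩ := C.exists_chart p
  have h : f ((extChartAt (𝓡 n) (C.center i)).symm (extChartAt (𝓡 n) (C.center i) p)) = 0 :=
    hf i _ hi
  rwa [(extChartAt (𝓡 n) (C.center i)).left_inv hp] at h

theorem ChartCover.formRep_injective [IsManifold (𝓡 n) ∞ P] (C : ChartCover n P)
    (a : P → E n →L[ℝ] V)
    (ha : ∀ i, ∀ y ∈ C.chartDom i, C.formRep V i a y = 0) : a = 0 := by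
  have : IsManifold (𝓡 n) 1 P := IsManifold.of_le (n := ∞) (by simp)
  funext p
  obtain ⟨i, hp, hi⟩ := C.exists_chart p
  set y := extChartAt (𝓡 n) (C.center i) p with hy
  have hyt : y ∈ (extChartAt (𝓡 n) (C.center i)).target :=
    (extChartAt (𝓡 n) (C.center i)).map_source hp
  have h : (a ((extChartAt (𝓡 n) (C.center i)).symm y)).comp
    (mfderiv 𝓘(ℝ, E n) (𝓡 n) (extChartAt (𝓡 n) (C.center i)).symm y : E n →L[ℝ] E n) = 0 :=
    ha i _ hi
  have key := mfderivWithin_extChartAt_symm_comp_mfderiv_extChartAt (I := 𝓡 n) hyt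
  rw [ModelWithCorners.Boundaryless.range_eq_univ, mfderivWithin_univ] at key
  have hap : a ((extChartAt (𝓡 n) (C.center i)).symm y) = 0 := by
    ext1 v
    have h2 := congrArg (fun T : E n →L[ℝ] V => T (mfderiv (𝓡 n) 𝓘(ℝ, E n)
      (extChartAt (𝓡 n) (C.center i)) ((extChartAt (𝓡 n) (C.center i)).symm y) v : E n)) h
    have h3 : (mfderiv 𝓘(ℝ, E n) (𝓡 n) (extChartAt (𝓡 n) (C.center i)).symm y
      (mfderiv (𝓡 n) 𝓘(ℝ, E n) (extChartAt (𝓡 n) (C.center i))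
        ((extChartAt (𝓡 n) (C.center i)).symm y) v) : E n) = v :=
      congrArg (fun T : E n →L[ℝ] E n => T v) key
    exact (congrArg (a ((extChartAt (𝓡 n) (C.center i)).symm y)) h3).symm.trans h2
  rwa [hy, (extChartAt (𝓡 n) (C.center i)).left_inv hp] at hap

/-- The functions `P → V` of Sobolev class `L²_k`. The manifold `P` will be a principal bundle over
a manifold of dimension `3`: for equivariant functions, continuity of the derivatives of order
`≤ k - 2` follows by the Sobolev embedding theorem from square integrability of the weak
derivatives of order `≤ k`, and including the former in the norm gives an equivalent norm. -/
def SobolevFun (C : ChartCover n P) (k : ℕ) (V : Type*) [NormedAddCommGroup V]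
    [NormedSpace ℝ V] : Type _ :=
  sobolevSubmodule k C.chartDom (C.funRep V)

/-- The `V`-valued one-forms on `P` of Sobolev class `L²_k`; see `SobolevFun`. -/
def SobolevForm (C : ChartCover n P) (k : ℕ) (V : Type*) [NormedAddCommGroup V]
    [NormedSpace ℝ V] : Type _ :=
  sobolevSubmodule k C.chartDom (C.formRep V)

instance (C : ChartCover n P) (k : ℕ) : AddCommGroup (SobolevFun C k V) :=
  inferInstanceAs (AddCommGroup (sobolevSubmodule k C.chartDom (C.funRep V)))

instance (C : ChartCover n P) (k : ℕ) : Module ℝ (SobolevFun C k V) :=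
  inferInstanceAs (Module ℝ (sobolevSubmodule k C.chartDom (C.funRep V)))

instance (C : ChartCover n P) (k : ℕ) : AddCommGroup (SobolevForm C k V) :=
  inferInstanceAs (AddCommGroup (sobolevSubmodule k C.chartDom (C.formRep V)))

instance (C : ChartCover n P) (k : ℕ) : Module ℝ (SobolevForm C k V) :=
  inferInstanceAs (Module ℝ (sobolevSubmodule k C.chartDom (C.formRep V)))

/-- The underlying function. -/
def SobolevFun.val {C : ChartCover n P} {k : ℕ} (f : SobolevFun C k V) : P → V :=
  (show sobolevSubmodule k C.chartDom (C.funRep V) from f).1.1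

/-- The underlying one-form. -/
def SobolevForm.val {C : ChartCover n P} {k : ℕ} (a : SobolevForm C k V) : P → E n →L[ℝ] V :=
  (show sobolevSubmodule k C.chartDom (C.formRep V) from a).1.1

/-- The derivatives in the charts of the cover. -/
def SobolevFun.jet {C : ChartCover n P} {k : ℕ} :
    SobolevFun C k V →ₗ[ℝ] JetSpace k C.chartDom V :=
  sobolevJet k C.chartDom (C.funRep V)

/-- The derivatives in the charts of the cover. -/
def SobolevForm.jet {C : ChartCover n P} {k : ℕ} :
    SobolevForm C k V →ₗ[ℝ] JetSpace k C.chartDom (E n →L[ℝ] V) :=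
  sobolevJet k C.chartDom (C.formRep V)

/-- The Sobolev norm. -/
instance (C : ChartCover n P) (k : ℕ) : NormedAddCommGroup (SobolevFun C k V) :=
  NormedAddCommGroup.induced _ _ SobolevFun.jet
    (sobolevJet_injective k C.chartDom (C.funRep V) C.funRep_injective)

instance (C : ChartCover n P) (k : ℕ) : NormedSpace ℝ (SobolevFun C k V) :=
  NormedSpace.induced ℝ (SobolevFun C k V) _ SobolevFun.jet

/-- The Sobolev norm. -/
instance [IsManifold (𝓡 n) ∞ P] (C : ChartCover n P) (k : ℕ) :
    NormedAddCommGroup (SobolevForm C k V) :=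
  NormedAddCommGroup.induced _ _ SobolevForm.jet
    (sobolevJet_injective k C.chartDom (C.formRep V) C.formRep_injective)

instance [IsManifold (𝓡 n) ∞ P] (C : ChartCover n P) (k : ℕ) :
    NormedSpace ℝ (SobolevForm C k V) :=
  NormedSpace.induced ℝ (SobolevForm C k V) _ SobolevForm.jet

end Cover

/-! ## Lie groups and principal bundles -/

section LieGroup

variable {d : ℕ} {G : Type*} [TopologicalSpace G] [ChartedSpace (E d) G] [Group G]

variable (G) in
/-- The Lie bracket of the Lie algebra of `G`, i.e. of the tangent space at `1`, which is `E d`. -/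
def lieBr (X Y : E d) : E d :=
  @Bracket.bracket (GroupLieAlgebra (𝓡 d) G) (GroupLieAlgebra (𝓡 d) G) _ X Y

/-- The adjoint representation. -/
def Ad (g : G) : E d →L[ℝ] E d :=
  (mfderiv (𝓡 d) (𝓡 d) (fun k : G => g * k * g⁻¹) 1 : E d →L[ℝ] E d)

end LieGroup

/-- A smooth principal bundle `P → M` with structure group `G`, acting on the right. -/
structure PrincipalBundle (m n d : ℕ) (M P G : Type*)
    [TopologicalSpace M] [ChartedSpace (E m) M] [TopologicalSpace P] [ChartedSpace (E n) P]
    [TopologicalSpace G] [ChartedSpace (E d) G] [Group G] where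
  proj : P → M
  act : P → G → P
  contMDiff_proj : ContMDiff (𝓡 n) (𝓡 m) ∞ proj
  contMDiff_act : ContMDiff ((𝓡 n).prod (𝓡 d)) (𝓡 n) ∞ (fun q : P × G => act q.1 q.2)
  act_one : ∀ p, act p 1 = p
  act_mul : ∀ p g h, act p (g * h) = act (act p g) h
  locally_trivial : ∀ x : M, ∃ (U : Set M) (e : OpenPartialHomeomorph P (M × G)),
    IsOpen U ∧ x ∈ U ∧ e.source = proj ⁻¹' U ∧ e.target = U ×ˢ Set.univ ∧
    ContMDiffOn (𝓡 n) ((𝓡 m).prod (𝓡 d)) ∞ e e.source ∧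
    ContMDiffOn ((𝓡 m).prod (𝓡 d)) (𝓡 n) ∞ e.symm e.target ∧
    (∀ p ∈ e.source, (e p).1 = proj p) ∧
    ∀ p ∈ e.source, ∀ g, act p g ∈ e.source ∧ e (act p g) = ((e p).1, (e p).2 * g)

section Bundle

variable {m n d : ℕ} {M P G : Type*}
  [TopologicalSpace M] [ChartedSpace (E m) M] [TopologicalSpace P] [ChartedSpace (E n) P]
  [TopologicalSpace G] [ChartedSpace (E d) G] [Group G]

/-- The derivative of `h ↦ p h` at `1`: the map `ι` from the Lie algebra to the vertical vectors
at `p`. -/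
def PrincipalBundle.vert (Q : PrincipalBundle m n d M P G) (p : P) : E d →L[ℝ] E n :=
  (mfderiv (𝓡 d) (𝓡 n) (fun h : G => Q.act p h) 1 : E d →L[ℝ] E n)

/-- The derivative at `p` of the right translation by `h`. -/
def PrincipalBundle.dAct (Q : PrincipalBundle m n d M P G) (p : P) (h : G) : E n →L[ℝ] E n :=
  (mfderiv (𝓡 n) (𝓡 n) (fun q : P => Q.act q h) p : E n →L[ℝ] E n)

/-- The one-form `a` is equivariant: `R_h^* a = Ad(h⁻¹) a`. -/
def PrincipalBundle.EquivariantForm (Q : PrincipalBundle m n d M P G)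
    (a : P → E n →L[ℝ] E d) : Prop :=
  ∀ p (h : G) (v : E n), a (Q.act p h) (Q.dAct p h v) = Ad h⁻¹ (a p v)

/-- `A` is a connection form on `P`. -/
def PrincipalBundle.IsConnectionForm (Q : PrincipalBundle m n d M P G)
    (A : P → E n →L[ℝ] E d) : Prop :=
  Q.EquivariantForm A ∧ ∀ p (ζ : E d), A p (Q.vert p ζ) = ζ

end Bundle

/-- The data of the theory: a principal bundle `P → M` over a manifold of dimension `3`, the
Sobolev index `l`, a cover of `P` used to define the Sobolev norms, and the point `u₀ ∈ P` and the
connection `A₀` of class `L²_{l-1}` used as origins in the spaces of framings and of connections. -/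
structure YangMills (n d : ℕ) (M P G : Type*)
    [TopologicalSpace M] [ChartedSpace (E 3) M]
    [TopologicalSpace P] [ChartedSpace (E n) P] [IsManifold (𝓡 n) ∞ P]
    [TopologicalSpace G] [ChartedSpace (E d) G] [Group G] where
  Q : PrincipalBundle 3 n d M P G
  l : ℕ
  two_lt_l : 2 < l
  C : ChartCover n P
  u₀ : P
  A₀ : SobolevForm C (l - 1) (E d)
  isConnectionForm : Q.IsConnectionForm A₀.val

namespace YangMills

variable {n d : ℕ} {M P G : Type*}
  [TopologicalSpace M] [ChartedSpace (E 3) M]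
  [TopologicalSpace P] [ChartedSpace (E n) P] [IsManifold (𝓡 n) ∞ P]
  [TopologicalSpace G] [ChartedSpace (E d) G] [Group G]

/-! ## The space of framed connections and the gauge group -/

/-- The space `Ω¹(M, ad P)` of class `L²_{l-1}`: horizontal equivariant one-forms on `P`. It is the
space of differences of connections. -/
def BasicForms (S : YangMills n d M P G) : Submodule ℝ (SobolevForm S.C (S.l - 1) (E d)) where
  carrier := {a | S.Q.EquivariantForm a.val ∧ ∀ p (ζ : E d), a.val p (S.Q.vert p ζ) = 0}
  zero_mem' := by
    refine ⟨fun p h v => ?_, fun p ζ => rfl⟩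
    exact (map_zero (Ad h⁻¹)).symm
  add_mem' := by
    rintro a b ⟨ha, ha'⟩ ⟨hb, hb'⟩
    refine ⟨fun p h v => ?_, fun p ζ => ?_⟩
    · show a.val _ _ + b.val _ _ = Ad h⁻¹ (a.val p v + b.val p v)
      rw [map_add, ha, hb]
    · show a.val _ _ + b.val _ _ = 0
      rw [ha', hb', add_zero]
  smul_mem' := by
    rintro c a ⟨ha, ha'⟩
    refine ⟨fun p h v => ?_, fun p ζ => ?_⟩
    · show c • a.val _ _ = Ad h⁻¹ (c • a.val p v)
      rw [map_smul, ha]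
    · show c • a.val _ _ = 0
      rw [ha', smul_zero]

/-- The Lie algebra of the gauge group: equivariant functions on `P` of class `L²_l` with values in
the Lie algebra of `G`. -/
def GaugeAlg (S : YangMills n d M P G) : Submodule ℝ (SobolevFun S.C S.l (E d)) where
  carrier := {ξ | ∀ p (h : G), ξ.val (S.Q.act p h) = Ad h⁻¹ (ξ.val p)}
  zero_mem' := fun p h => (map_zero (Ad h⁻¹)).symm
  add_mem' := by
    intro ξ ζ hξ hζ p h
    show ξ.val _ + ζ.val _ = Ad h⁻¹ (ξ.val p + ζ.val p)
    rw [map_add, hξ, hζ]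
  smul_mem' := by
    intro c ξ hξ p h
    show c • ξ.val _ = Ad h⁻¹ (c • ξ.val p)
    rw [map_smul, hξ]

/-- The space `𝒜` of framed connections: the pair `(a, h)` stands for the connection `A₀ + a`
together with the framing `u₀ h` of the fibre of `u₀`. -/
abbrev Conf (S : YangMills n d M P G) : Type _ := S.BasicForms × G

/-- The tangent spaces of `𝒜`. -/
abbrev TConf (S : YangMills n d M P G) : Type _ := S.BasicForms × E d

/-- The manifold structure of `𝒜`. -/
abbrev IConf (S : YangMills n d M P G) :
    ModelWithCorners ℝ S.TConf (ModelProd S.BasicForms (E d)) :=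
  𝓘(ℝ, S.BasicForms).prod (𝓡 d)

/-- The manifold structure of `𝒜 × P`. -/
abbrev ITot (S : YangMills n d M P G) :
    ModelWithCorners ℝ (S.TConf × E n) (ModelProd (ModelProd S.BasicForms (E d)) (E n)) :=
  S.IConf.prod (𝓡 n)

/-- The connection form of a framed connection. -/
def conn (S : YangMills n d M P G) (x : S.Conf) (p : P) : E n →L[ℝ] E d :=
  S.A₀.val p + x.1.1.val p

/-- The map `g : P → G` describes a gauge transformation `p ↦ p g(p)` of class `L²_l`. -/
structure IsGauge (S : YangMills n d M P G) (g : P → G) : Prop where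
  equivariant : ∀ p (h : G), g (S.Q.act p h) = h⁻¹ * g p * h
  contMDiff : ContMDiff (𝓡 n) (𝓡 d) ((S.l - 2 : ℕ) : ℕ∞) g
  sobolev : ∀ f : G → ℝ, ContMDiff (𝓡 d) 𝓘(ℝ, ℝ) ∞ f →
    ∃ u : SobolevFun S.C S.l ℝ, u.val = f ∘ g

/-- The automorphism `φ` of `P` described by `g`. -/
def gaugeMap (S : YangMills n d M P G) (g : P → G) (p : P) : P := S.Q.act p (g p)

/-- The framed connection `x'` is the image `R_φ x` of `x` under the right action of the gauge
transformation `φ` described by `g`: the connection is pulled back by `φ`, and `φ⁻¹` is applied to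
the framing (note that `φ⁻¹ (u₀ h) = u₀ g(u₀)⁻¹ h`). -/
def IsGaugeImage (S : YangMills n d M P G) (g : P → G) (x x' : S.Conf) : Prop :=
  (∀ p (v : E n), S.conn x' p v =
    S.conn x (S.gaugeMap g p) (mfderiv (𝓡 n) (𝓡 n) (S.gaugeMap g) p v : E n)) ∧
  x'.2 = (g S.u₀)⁻¹ * x.2

/-- The curve `g` in the gauge group starts at the identity with velocity `ξ`, in the topology
of `L²_l`. -/
def HasVelocityAtOne (S : YangMills n d M P G) (g : ℝ → P → G) (ξ : S.GaugeAlg) : Prop :=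
  (∀ p, g 0 p = 1) ∧ ∃ u : ℝ → SobolevFun S.C S.l (E d),
    (∀ᶠ s in 𝓝 0, ∀ p, g s p ∈ (extChartAt (𝓡 d) (1 : G)).source ∧
      (u s).val p = extChartAt (𝓡 d) (1 : G) (g s p) - extChartAt (𝓡 d) (1 : G) 1) ∧
    HasDerivAt u (ξ : SobolevFun S.C S.l (E d)) 0

/-- The curve `c` in `𝒜` has velocity `X` at time `0`. -/
def HasVelocity (S : YangMills n d M P G) (c : ℝ → S.Conf) (X : S.TConf) : Prop :=
  HasMFDerivAt 𝓘(ℝ, ℝ) S.IConf c 0 (ContinuousLinearMap.toSpanSingleton ℝ X : ℝ →L[ℝ] S.TConf)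

/-- `K` is the vector field on `𝒜` given by the infinitesimal action of `ξ`: at each `x` it is the
velocity of `s ↦ R_{φ_s} x`, for a curve `φ_s` of gauge transformations with velocity `ξ` at the
identity. -/
def IsFundamental (S : YangMills n d M P G) (ξ : S.GaugeAlg) (K : S.Conf → S.TConf) : Prop :=
  ∃ g : ℝ → P → G, (∀ s, S.IsGauge (g s)) ∧ S.HasVelocityAtOne g ξ ∧
    ∀ x, ∃ c : ℝ → S.Conf, (∀ s, S.IsGaugeImage (g s) x (c s)) ∧ S.HasVelocity c (K x)

open Classical in
/-- The infinitesimal action `κ` of the Lie algebra of the gauge group on `𝒜`. -/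
def kappa (S : YangMills n d M P G) (ξ : S.GaugeAlg) : S.Conf → S.TConf :=
  if h : ∃ K, S.IsFundamental ξ K then h.choose else 0

/-- `η` is the connection form of a connection on the principal bundle `𝒜 → 𝒜/𝒢`: a smooth
equivariant one-form with values in the Lie algebra of the gauge group which reproduces the
generators of the infinitesimal action. -/
structure IsGaugeFixingConnection (S : YangMills n d M P G)
    (η : S.Conf → S.TConf →L[ℝ] S.GaugeAlg) : Prop where
  smooth : ∀ x₀ : S.Conf, ContDiffOn ℝ ∞
    (fun y => (η ((extChartAt S.IConf x₀).symm y)).comp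
      (mfderiv 𝓘(ℝ, S.TConf) S.IConf (extChartAt S.IConf x₀).symm y : S.TConf →L[ℝ] S.TConf))
    (extChartAt S.IConf x₀).target
  kappa : ∀ (ξ : S.GaugeAlg) (x : S.Conf), η x (S.kappa ξ x) = ξ
  equivariant : ∀ g : P → G, S.IsGauge g → ∀ c c' : ℝ → S.Conf,
    (∀ s, S.IsGaugeImage g (c s) (c' s)) → ∀ X X' : S.TConf,
    S.HasVelocity c X → S.HasVelocity c' X' → ∀ p,
    (η (c' 0) X').1.val p = Ad (g p)⁻¹ ((η (c 0) X).1.val p)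

/-! ## Forms on `𝒜 × P` -/

/-- One-forms on `𝒜 × P` with values in the Lie algebra of `G`. -/
abbrev OneForm (S : YangMills n d M P G) : Type _ := S.Conf × P → S.TConf × E n → E d

/-- Two-forms on `𝒜 × P` with values in the Lie algebra of `G`. -/
abbrev TwoForm (S : YangMills n d M P G) : Type _ :=
  S.Conf × P → S.TConf × E n → S.TConf × E n → E d

/-- The exterior derivative `Δ` of `𝒜 × P`. -/
def bigD (S : YangMills n d M P G) (α : S.OneForm) : S.TwoForm := extDerivOne S.ITot α

/-- The exterior derivative `δ` in the direction of `𝒜`. -/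
def delta (S : YangMills n d M P G) (α : S.OneForm) : S.TwoForm := fun z Z W =>
  chartDeriv S.ITot α z (Z.1, 0) W - chartDeriv S.ITot α z (W.1, 0) Z

/-- The exterior derivative `d` in the direction of `P`. -/
def dP (S : YangMills n d M P G) (α : S.OneForm) : S.TwoForm := fun z Z W =>
  chartDeriv S.ITot α z (0, Z.2) W - chartDeriv S.ITot α z (0, W.2) Z

/-- The bracket `[α, β]` of one-forms. -/
def brk (S : YangMills n d M P G) (α β : S.OneForm) : S.TwoForm := fun z Z W =>
  lieBr G (α z Z) (β z W) - lieBr G (α z W) (β z Z)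

/-- The component of bidegree `(2, 0)` of a two-form. -/
def part20 (S : YangMills n d M P G) (β : S.TwoForm) : S.TwoForm := fun z Z W =>
  β z (Z.1, 0) (W.1, 0)

/-- The component of bidegree `(1, 1)` of a two-form. -/
def part11 (S : YangMills n d M P G) (β : S.TwoForm) : S.TwoForm := fun z Z W =>
  β z (Z.1, 0) (0, W.2) + β z (0, Z.2) (W.1, 0)

/-- The component of bidegree `(0, 2)` of a two-form. -/
def part02 (S : YangMills n d M P G) (β : S.TwoForm) : S.TwoForm := fun z Z W =>
  β z (0, Z.2) (0, W.2)

/-- The universal family of connections `A^U`. -/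
def AU (S : YangMills n d M P G) : S.OneForm := fun z Z => S.conn z.1 z.2 Z.2

/-- The Lie algebra valued form `η` on `𝒜`, as a form of bidegree `(1, 0)` on `𝒜 × P`. -/
def etaForm (S : YangMills n d M P G) (η : S.Conf → S.TConf →L[ℝ] S.GaugeAlg) : S.OneForm :=
  fun z Z => (η z.1 Z.1).1.val z.2

/-- The extended connection `A^U + η`. -/
def extConn (S : YangMills n d M P G) (η : S.Conf → S.TConf →L[ℝ] S.GaugeAlg) : S.OneForm :=
  S.AU + S.etaForm η

/-- The curvature of the extended connection. -/
def curv (S : YangMills n d M P G) (η : S.Conf → S.TConf →L[ℝ] S.GaugeAlg) : S.TwoForm :=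
  S.bigD (S.extConn η) + (1 / 2 : ℝ) • S.brk (S.extConn η) (S.extConn η)

/-- `φ = δη + ½[η, η]`. -/
def phi (S : YangMills n d M P G) (η : S.Conf → S.TConf →L[ℝ] S.GaugeAlg) : S.TwoForm :=
  S.delta (S.etaForm η) + (1 / 2 : ℝ) • S.brk (S.etaForm η) (S.etaForm η)

/-- `ψ = δA^U + dη + [A^U, η]`. -/
def psi (S : YangMills n d M P G) (η : S.Conf → S.TConf →L[ℝ] S.GaugeAlg) : S.TwoForm :=
  S.delta S.AU + S.dP (S.etaForm η) + S.brk S.AU (S.etaForm η)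

/-- `F^U = dA^U + ½[A^U, A^U]`. -/
def FU (S : YangMills n d M P G) : S.TwoForm :=
  S.dP S.AU + (1 / 2 : ℝ) • S.brk S.AU S.AU

/-! ## Vertical and horizontal parts -/

/-- The projection of `T𝒜` onto the vertical vectors along the kernel of `η`. -/
def vertProj (S : YangMills n d M P G) (η : S.Conf → S.TConf →L[ℝ] S.GaugeAlg) (x : S.Conf)
    (X : S.TConf) : S.TConf := S.kappa (η x X) x

/-- The projection of `T𝒜` onto the kernel of `η` along the vertical vectors. -/
def horProj (S : YangMills n d M P G) (η : S.Conf → S.TConf →L[ℝ] S.GaugeAlg) (x : S.Conf)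
    (X : S.TConf) : S.TConf := X - S.vertProj η x X

/-- The vertical differential `δ_V α = δα (Π_V ·, Π_V ·)`. -/
def deltaV (S : YangMills n d M P G) (η : S.Conf → S.TConf →L[ℝ] S.GaugeAlg) (α : S.OneForm) :
    S.TwoForm := fun z Z W =>
  S.delta α z (S.vertProj η z.1 Z.1, Z.2) (S.vertProj η z.1 W.1, W.2)

/-- The horizontal differential `δ_H α = δα (Π_H ·, Π_H ·)`. -/
def deltaH (S : YangMills n d M P G) (η : S.Conf → S.TConf →L[ℝ] S.GaugeAlg) (α : S.OneForm) :
    S.TwoForm := fun z Z W =>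
  S.delta α z (S.horProj η z.1 Z.1, Z.2) (S.horProj η z.1 W.1, W.2)

/-- The projection `π_A` of `TP` onto the kernel of the connection form. -/
def piA (S : YangMills n d M P G) (z : S.Conf × P) (v : E n) : E n :=
  v - S.Q.vert z.2 (S.conn z.1 z.2 v)

/-- The covariant derivative `d_{A^U} η`: the form `dη` evaluated on vectors whose component
along `P` is projected by `π_A`. -/
def covEta (S : YangMills n d M P G) (η : S.Conf → S.TConf →L[ℝ] S.GaugeAlg) : S.TwoForm :=
  fun z Z W => S.dP (S.etaForm η) z (Z.1, S.piA z Z.2) (W.1, S.piA z W.2)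

/-- The connection form of `x` has differentiable coefficients at `p`. -/
def ConnDifferentiableAt (S : YangMills n d M P G) (x : S.Conf) (p : P) : Prop :=
  ∀ v : E n, DifferentiableAt ℝ (fun y => localRep (𝓡 n) (fun q w => S.conn x q w) p y v)
    (extChartAt (𝓡 n) p p)

end YangMills

end

/-!
The statements about `A^U` and about the components of the curvature are formal once the partial
derivatives of the two one-forms are known: in the directions of `𝒜` one has `δA^U(X) = X`, because
the space of connections is affine (`chartDeriv_AU_conf`), and the derivatives of `η(Y)(p)` in the
directions of `𝒜` and of `P` are `(δ_X η)(Y)(p)` and `d(η(Y))_p` (`chartDeriv_etaForm`). The only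
analytic point is that the curve `t ↦ η_t(Y)(p_t)` may be differentiated in both places at once;
this holds since the norm of `L²_l` dominates the supremum norm (`SobolevFun.norm_val_le`).
Directional derivatives are not additive in the direction in general, which is why the full formula
for the curvature needs the differentiability of `A` at `p`.

The geometric content lies in three infinitesimal identities.

* The infinitesimal action on connections is `κ(ξ) = d_A ξ = dξ + [A, ξ]` (`kappa_val_fst`). It is
  the derivative of `φ^* A = Ad(g⁻¹) A + g⁻¹ dg` (`IsGaugeImage.conn_eq`) along a curve of gauge
  transformations. The derivative of `Ad(h⁻¹) w` at `h = 1` is `-[·, w]`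
  (`hasFDerivAt_Ad_inv_chart`); in a chart, where the bracket is the antisymmetrized second
  derivative of the multiplication (`lieBr_eq`), it comes from differentiating `z h = h (h⁻¹ z h)`
  twice. The derivative of `g⁻¹ dg` comes in the same way from an implicit equation
  (`hasFDerivAt_of_clm_apply_eq`).
* An equivariant function satisfies `dξ(ζ) = -[ζ, ξ]` in a vertical direction `ζ` of `P`
  (`funDeriv_vert`). This identifies `d_{A^U} η` with `dη + [A^U, η]`.
* The equivariance of `η` gives `δη(κ(ξ), Y) = -[ξ, η(Y)]` (`etaDeriv_kappa`). This is Cartan's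
  formula `i_K δη = L_K η - δ(η(K))` for `K = κ(ξ)`, where `η(K) = ξ` is constant and
  `L_K η = -[ξ, η]`. In a chart, the derivatives of `η` along an orbit (`etaDeriv_orbit`) and of
  `η(K)` along a line (`etaDeriv_coordLine`) produce the same correction term, by the symmetry of
  the second derivative of the multiplication of `G`. Both computations rest on the fact that a
  gauge transformation acts on the connections by an affine map and on the framing by a left
  translation, so that the image of a line is again a line up to a translation in `G`.

With these, `Π_V = κ ∘ η` turns `δA^U(Π_V ·, Π_V ·)` into `-d_{A^U} η` and `δη(Π_V ·, Π_V ·)` into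
`-½[η, η]`, and the horizontal parts follow by linearity.

To compare one-forms by their values, one uses that an element of a Sobolev space is determined by
its values, i.e. that weak derivatives are unique (`IsSobolevJet.eq_zero`).
-/

noncomputable section

/-! ### Charts of a manifold -/

theorem two_le_infty : (2 : WithTop ℕ∞) ≤ ∞ := by
  exact WithTop.coe_le_coe.2 (le_top : (2 : ℕ∞) ≤ ⊤)

section Charts

variable {k : ℕ} {X : Type*} [TopologicalSpace X] [ChartedSpace (E k) X]

theorem extChartAt_symm_eventually_mem (x : X) {s : Set X} (hs : s ∈ 𝓝 x) :
    ∀ᶠ y in 𝓝 (extChartAt (𝓡 k) x x), (extChartAt (𝓡 k) x).symm y ∈ s := by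
  have h := (continuousAt_extChartAt_symm (I := 𝓡 k) x).preimage_mem_nhds
    (by rw [(extChartAt (𝓡 k) x).left_inv (mem_extChartAt_source x)]; exact hs)
  exact h

/-- The derivative at `y` of the inverse of the chart centred at `x`, as an endomorphism of the
model space, with which the tangent spaces are identified. -/
def symmDeriv (x : X) (y : E k) : E k →L[ℝ] E k :=
  (mfderiv 𝓘(ℝ, E k) (𝓡 k) (extChartAt (𝓡 k) x).symm y : E k →L[ℝ] E k)

variable [IsManifold (𝓡 k) ∞ X]

instance isManifold_one_of_infty : IsManifold (𝓡 k) 1 X := IsManifold.of_le (n := ∞) (by simp)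

theorem mfderiv_extChartAt_symm_self (x : X) :
    (mfderiv 𝓘(ℝ, E k) (𝓡 k) (extChartAt (𝓡 k) x).symm (extChartAt (𝓡 k) x x) :
      E k →L[ℝ] E k) = ContinuousLinearMap.id ℝ (E k) := by
  have h := mfderivWithin_range_extChartAt_symm (I := 𝓡 k) (x := x)
  rwa [ModelWithCorners.Boundaryless.range_eq_univ, mfderivWithin_univ] at h

theorem symmDeriv_self (x : X) :
    symmDeriv x (extChartAt (𝓡 k) x x) = ContinuousLinearMap.id ℝ (E k) :=
  mfderiv_extChartAt_symm_self x

theorem mdifferentiableAt_extChartAt_symm (x : X) {y : E k}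
    (hy : y ∈ (extChartAt (𝓡 k) x).target) :
    MDifferentiableAt 𝓘(ℝ, E k) (𝓡 k) (extChartAt (𝓡 k) x).symm y := by
  have h := mdifferentiableWithinAt_extChartAt_symm (I := 𝓡 k) hy
  rwa [ModelWithCorners.Boundaryless.range_eq_univ, mdifferentiableWithinAt_univ] at h

theorem contMDiffAt_extChartAt_symm (x : X) {y : E k}
    (hy : y ∈ (extChartAt (𝓡 k) x).target) :
    ContMDiffAt 𝓘(ℝ, E k) (𝓡 k) ∞ (extChartAt (𝓡 k) x).symm y :=
  (contMDiffOn_extChartAt_symm x).contMDiffAt ((isOpen_extChartAt_target x).mem_nhds hy)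

end Charts

/-! ### The Lie bracket and the adjoint action in a chart of the group -/

section LieGroupCalculus

variable {d : ℕ} {G : Type*} [TopologicalSpace G] [ChartedSpace (E d) G] [Group G]

/-- Multiplication of `G`, with the left factor read in the chart at `1`, the right factor and the
product in the chart at `h`. -/
def chartMul (h : G) (q : E d × E d) : E d :=
  extChartAt (𝓡 d) h ((extChartAt (𝓡 d) (1 : G)).symm q.1 * (extChartAt (𝓡 d) h).symm q.2)

variable (G) in
/-- The second derivative at the identity of the multiplication read in the chart at `1`. -/
def mulHess : E d × E d →L[ℝ] E d × E d →L[ℝ] E d :=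
  fderiv ℝ (fderiv ℝ (chartMul (1 : G)))
    (extChartAt (𝓡 d) (1 : G) 1, extChartAt (𝓡 d) (1 : G) 1)

variable [LieGroup (𝓡 d) ∞ G]

theorem contDiffAt_chartMul (h : G) :
    ContDiffAt ℝ ∞ (chartMul h) (extChartAt (𝓡 d) (1 : G) 1, extChartAt (𝓡 d) h h) := by
  have h1 : ContMDiffAt 𝓘(ℝ, E d × E d) (𝓡 d) ∞
      (fun q : E d × E d => (extChartAt (𝓡 d) (1 : G)).symm q.1)
      (extChartAt (𝓡 d) (1 : G) 1, extChartAt (𝓡 d) h h) :=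
    (contMDiffAt_extChartAt_symm (1 : G) (mem_extChartAt_target (1 : G))).comp
      (extChartAt (𝓡 d) (1 : G) 1, extChartAt (𝓡 d) h h) contDiff_fst.contMDiff.contMDiffAt
  have h2 : ContMDiffAt 𝓘(ℝ, E d × E d) (𝓡 d) ∞
      (fun q : E d × E d => (extChartAt (𝓡 d) h).symm q.2)
      (extChartAt (𝓡 d) (1 : G) 1, extChartAt (𝓡 d) h h) :=
    (contMDiffAt_extChartAt_symm h (mem_extChartAt_target h)).comp
      (extChartAt (𝓡 d) (1 : G) 1, extChartAt (𝓡 d) h h) contDiff_snd.contMDiff.contMDiffAt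
  have h3 := h1.mul h2
  have e : (extChartAt (𝓡 d) (1 : G)).symm (extChartAt (𝓡 d) (1 : G) 1) *
      (extChartAt (𝓡 d) h).symm (extChartAt (𝓡 d) h h) = h := by
    rw [extChartAt_to_inv, extChartAt_to_inv, one_mul]
  have h4 : ContMDiffAt (𝓡 d) 𝓘(ℝ, E d) ∞ (extChartAt (𝓡 d) h)
      ((extChartAt (𝓡 d) (1 : G)).symm (extChartAt (𝓡 d) (1 : G) 1) *
      (extChartAt (𝓡 d) h).symm (extChartAt (𝓡 d) h h)) := by
    rw [e]
    exact contMDiffAt_extChartAt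
  exact (h4.comp (extChartAt (𝓡 d) (1 : G) 1, extChartAt (𝓡 d) h h) h3).contDiffAt

omit [LieGroup (𝓡 d) ∞ G] in
theorem chartMul_base_left (h : G) {y : E d} (hy : y ∈ (extChartAt (𝓡 d) h).target) :
    chartMul h (extChartAt (𝓡 d) (1 : G) 1, y) = y := by
  rw [chartMul, extChartAt_to_inv, one_mul]
  exact (extChartAt (𝓡 d) h).right_inv hy

theorem eventually_differentiableAt_chartMul (h : G) :
    ∀ᶠ q in 𝓝 (extChartAt (𝓡 d) (1 : G) 1, extChartAt (𝓡 d) h h),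
      DifferentiableAt ℝ (chartMul h) q := by
  have h1 := ((contDiffAt_chartMul (d := d) h).of_le (m := 1) (by simp)).eventually (by simp)
  exact h1.mono fun q hq => hq.differentiableAt one_ne_zero

theorem differentiableAt_fderiv_chartMul (h : G) :
    DifferentiableAt ℝ (fderiv ℝ (chartMul h))
      (extChartAt (𝓡 d) (1 : G) 1, extChartAt (𝓡 d) h h) :=
  (((contDiffAt_chartMul (d := d) h).of_le (m := 2) two_le_infty).fderiv_right (m := 1)
    (by norm_num)).differentiableAt one_ne_zero

theorem fderiv_fderiv_chartMul_symm (h : G) (v w : E d × E d) :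
    fderiv ℝ (fderiv ℝ (chartMul h)) (extChartAt (𝓡 d) (1 : G) 1, extChartAt (𝓡 d) h h) v w =
    fderiv ℝ (fderiv ℝ (chartMul h)) (extChartAt (𝓡 d) (1 : G) 1, extChartAt (𝓡 d) h h) w v := by
  have h1 := (contDiffAt_chartMul (d := d) h).isSymmSndFDerivAt (by simpa using two_le_infty)
  exact h1 v w

theorem mulHess_symm (v w : E d × E d) : mulHess G v w = mulHess G w v :=
  fderiv_fderiv_chartMul_symm (1 : G) v w

theorem hasFDerivAt_fderiv_chartMul_right (w : E d) :
    HasFDerivAt (fun y : E d => fderiv ℝ (chartMul (1 : G)) (y, extChartAt (𝓡 d) (1 : G) 1) (0, w))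
      (((mulHess G).flip (0, w)).comp (ContinuousLinearMap.inl ℝ (E d) (E d)))
      (extChartAt (𝓡 d) (1 : G) 1) := by
  have h1 := (differentiableAt_fderiv_chartMul (d := d) (1 : G)).hasFDerivAt
  have h2 : HasFDerivAt (fun y : E d => (y, extChartAt (𝓡 d) (1 : G) 1))
      (ContinuousLinearMap.inl ℝ (E d) (E d)) (extChartAt (𝓡 d) (1 : G) 1) :=
    hasFDerivAt_prodMk_left _ _
  have h3 := (HasFDerivAt.comp (f := fun y : E d => (y, extChartAt (𝓡 d) (1 : G) 1)) _ h1
    h2).clm_apply (hasFDerivAt_const ((0 : E d), w) _)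
  refine h3.congr_fderiv ?_
  ext v
  simp [mulHess]

theorem hasFDerivAt_fderiv_chartMul_left (w : E d) :
    HasFDerivAt (fun y : E d => fderiv ℝ (chartMul (1 : G)) (extChartAt (𝓡 d) (1 : G) 1, y) (w, 0))
      (((mulHess G).flip (w, 0)).comp (ContinuousLinearMap.inr ℝ (E d) (E d)))
      (extChartAt (𝓡 d) (1 : G) 1) := by
  have h1 := (differentiableAt_fderiv_chartMul (d := d) (1 : G)).hasFDerivAt
  have h2 : HasFDerivAt (fun y : E d => (extChartAt (𝓡 d) (1 : G) 1, y))
      (ContinuousLinearMap.inr ℝ (E d) (E d)) (extChartAt (𝓡 d) (1 : G) 1) :=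
    hasFDerivAt_prodMk_right _ _
  have h3 := (HasFDerivAt.comp (f := fun y : E d => (extChartAt (𝓡 d) (1 : G) 1, y)) _ h1
    h2).clm_apply (hasFDerivAt_const (w, (0 : E d)) _)
  refine h3.congr_fderiv ?_
  ext v
  simp [mulHess]

theorem fderiv_chartMul_base_right (h : G) (u : E d) : fderiv ℝ (chartMul h)
    (extChartAt (𝓡 d) (1 : G) 1, extChartAt (𝓡 d) h h) (0, u) = u := by
  have f1 : HasFDerivAt (fun z : E d => chartMul h (extChartAt (𝓡 d) (1 : G) 1, z))
    ((fderiv ℝ (chartMul h) (extChartAt (𝓡 d) (1 : G) 1, extChartAt (𝓡 d) h h)).comp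
      (ContinuousLinearMap.inr ℝ (E d) (E d))) (extChartAt (𝓡 d) h h) :=
    (eventually_differentiableAt_chartMul h).self_of_nhds.hasFDerivAt.comp _
      (hasFDerivAt_prodMk_right _ _)
  have f2 := (hasFDerivAt_id (𝕜 := ℝ) (extChartAt (𝓡 d) h h)).congr_of_eventuallyEq
    (f₁ := fun z : E d => chartMul h (extChartAt (𝓡 d) (1 : G) 1, z)) (by
      filter_upwards [(isOpen_extChartAt_target h).mem_nhds
        (mem_extChartAt_target (I := 𝓡 d) h)] with y hy
      exact chartMul_base_left h hy)
  simpa using congrArg (fun T : E d →L[ℝ] E d => T u) (f1.unique f2)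

/-- In the chart at `1`, the left invariant vector field of `w` is the derivative of the
multiplication in its second variable, at the identity. -/
theorem mulInvariantVectorField_chart (w : E d) : ∀ᶠ y in 𝓝 (extChartAt (𝓡 d) (1 : G) 1),
    VectorField.mpullbackWithin 𝓘(ℝ, E d) (𝓡 d) (extChartAt (𝓡 d) (1 : G)).symm
      (mulInvariantVectorField (I := 𝓡 d) (G := G) w) (Set.range (𝓡 d)) y =
    fderiv ℝ (chartMul (1 : G)) (y, extChartAt (𝓡 d) (1 : G) 1) (0, w) := by
  have hc : Filter.Tendsto (fun y : E d => (y, extChartAt (𝓡 d) (1 : G) 1))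
      (𝓝 (extChartAt (𝓡 d) (1 : G) 1))
      (𝓝 (extChartAt (𝓡 d) (1 : G) 1, extChartAt (𝓡 d) (1 : G) 1)) :=
    (Continuous.prodMk_left _).tendsto _
  filter_upwards [hc.eventually (eventually_differentiableAt_chartMul (1 : G)),
    (isOpen_extChartAt_target (1 : G)).mem_nhds (mem_extChartAt_target (I := 𝓡 d) (1 : G))]
    with y hy hyt
  set c := extChartAt (𝓡 d) (1 : G) 1
  set e := extChartAt (𝓡 d) (1 : G)
  have hys : e.symm y ∈ e.source := e.map_target hyt
  have hinv : (mfderivWithin 𝓘(ℝ, E d) (𝓡 d) e.symm (Set.range (𝓡 d)) y).inverse =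
      mfderiv (𝓡 d) 𝓘(ℝ, E d) e (e.symm y) :=
    ContinuousLinearMap.inverse_eq (mfderivWithin_extChartAt_symm_comp_mfderiv_extChartAt hyt)
      (mfderiv_extChartAt_comp_mfderivWithin_extChartAt_symm hyt)
  have m1 : MDifferentiableAt (𝓡 d) (𝓡 d) (fun z : G => e.symm y * z) 1 :=
    (contMDiff_mul_left (I := 𝓡 d) (n := ∞)).contMDiffAt.mdifferentiableAt (by simp)
  have m2 : MDifferentiableAt (𝓡 d) 𝓘(ℝ, E d) e (e.symm y * 1) := by
    rw [mul_one]
    exact mdifferentiableAt_extChartAt (by rwa [← extChartAt_source (𝓡 d)])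
  have m3 : MDifferentiableAt 𝓘(ℝ, E d) (𝓡 d) e.symm c :=
    mdifferentiableAt_extChartAt_symm _ (mem_extChartAt_target _)
  have e1 : e.symm c = 1 := extChartAt_to_inv _
  have f1 : HasFDerivAt (fun z : E d => chartMul (1 : G) (y, z))
      ((fderiv ℝ (chartMul (1 : G)) (y, c)).comp (ContinuousLinearMap.inr ℝ (E d) (E d))) c :=
    hy.hasFDerivAt.comp c (hasFDerivAt_prodMk_right _ _)
  have f2 : HasMFDerivAt 𝓘(ℝ, E d) 𝓘(ℝ, E d) (fun z : E d => chartMul (1 : G) (y, z)) c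
      ((mfderiv (𝓡 d) 𝓘(ℝ, E d) e (e.symm y * e.symm c)).comp
        ((mfderiv (𝓡 d) (𝓡 d) (fun z : G => e.symm y * z) (e.symm c)).comp
          (mfderiv 𝓘(ℝ, E d) (𝓡 d) e.symm c))) := by
    have m1' : MDifferentiableAt (𝓡 d) (𝓡 d) (fun z : G => e.symm y * z) (e.symm c) := by
      rw [e1]; exact m1
    have m2' : MDifferentiableAt (𝓡 d) 𝓘(ℝ, E d) e (e.symm y * e.symm c) := by
      rw [e1]; exact m2
    exact HasMFDerivAt.comp c m2'.hasMFDerivAt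
      (HasMFDerivAt.comp c m1'.hasMFDerivAt m3.hasMFDerivAt)
  have f3 := f1.unique f2.hasFDerivAt
  have f4 := congrArg (fun T : E d →L[ℝ] E d => T w) f3
  have f5 : fderiv ℝ (chartMul (1 : G)) (y, c) (0, w) =
      mfderiv (𝓡 d) 𝓘(ℝ, E d) e (e.symm y * e.symm c)
        (mfderiv (𝓡 d) (𝓡 d) (fun z : G => e.symm y * z) (e.symm c)
          (mfderiv 𝓘(ℝ, E d) (𝓡 d) e.symm c w)) := by
    exact f4
  have f6 : (mfderiv 𝓘(ℝ, E d) (𝓡 d) e.symm c w : E d) = w :=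
    congrArg (fun T : E d →L[ℝ] E d => T w) (mfderiv_extChartAt_symm_self (1 : G))
  rw [VectorField.mpullbackWithin_apply, hinv, f5]
  unfold mulInvariantVectorField
  have f7 : ∀ g : G, g = 1 → (mfderiv (𝓡 d) 𝓘(ℝ, E d) e (e.symm y)
      (mfderiv (𝓡 d) (𝓡 d) (fun z : G => e.symm y * z) 1 w : E d) : E d) =
      mfderiv (𝓡 d) 𝓘(ℝ, E d) e (e.symm y * g)
        (mfderiv (𝓡 d) (𝓡 d) (fun z : G => e.symm y * z) g w : E d) := by
    rintro g rfl
    rw [mul_one]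
  refine (f7 _ e1).trans ?_
  exact congrArg (fun u : E d => (mfderiv (𝓡 d) 𝓘(ℝ, E d) e (e.symm y * e.symm c)
    (mfderiv (𝓡 d) (𝓡 d) (fun z : G => e.symm y * z) (e.symm c) u : E d) : E d)) f6.symm

/-- In the chart at `1`, the Lie bracket is the antisymmetrization of the second derivative of the
multiplication. -/
theorem lieBr_eq (v w : E d) :
    lieBr G v w = mulHess G (v, 0) (0, w) - mulHess G (w, 0) (0, v) := by
  have hV := mulInvariantVectorField_chart (G := G) v
  have hW := mulInvariantVectorField_chart (G := G) w
  have dV := (hasFDerivAt_fderiv_chartMul_right (G := G) v).congr_of_eventuallyEq hV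
  have dW := (hasFDerivAt_fderiv_chartMul_right (G := G) w).congr_of_eventuallyEq hW
  show VectorField.mlieBracketWithin (𝓡 d) _ _ Set.univ (1 : G) = _
  have key : ∀ T : E d →L[ℝ] E d, T = ContinuousLinearMap.id ℝ (E d) → ∀ u, T.inverse u = u := by
    rintro T rfl u
    rw [ContinuousLinearMap.inverse_id]
    rfl
  rw [VectorField.mlieBracketWithin_apply]
  refine (key _ (mfderiv_extChartAt_self (I := 𝓡 d) (x := (1 : G))) _).trans ?_
  have hu : ((extChartAt (𝓡 d) (1 : G)).symm ⁻¹' Set.univ ∩ Set.range (𝓡 d) : Set (E d)) =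
      Set.univ := by
    rw [ModelWithCorners.Boundaryless.range_eq_univ, Set.preimage_univ, Set.inter_univ]
  have lb : ∀ (V W : E d → E d) (V' W' : E d →L[ℝ] E d) (x : E d), HasFDerivAt V V' x →
      HasFDerivAt W W' x →
      VectorField.lieBracketWithin ℝ V W Set.univ x = W' (V x) - V' (W x) := by
    intro V W V' W' x hV hW
    rw [VectorField.lieBracketWithin_univ, VectorField.lieBracket, hV.fderiv, hW.fderiv]
  rw [hu]
  refine (lb _ _ _ _ _ dV dW).trans ?_
  have eV := hV.self_of_nhds.trans (fderiv_chartMul_base_right (1 : G) v)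
  have eW := hW.self_of_nhds.trans (fderiv_chartMul_base_right (1 : G) w)
  rw [eV, eW]
  rfl

theorem lieBr_add_left (u v w : E d) : lieBr G (u + v) w = lieBr G u w + lieBr G v w := by
  have h1 : ((u + v, 0) : E d × E d) = (u, 0) + (v, 0) := by simp
  have h2 : ((0, u + v) : E d × E d) = (0, u) + (0, v) := by simp
  simp only [lieBr_eq, h1, h2, map_add, _root_.add_apply]
  abel

theorem lieBr_skew (v w : E d) : lieBr G v w = - lieBr G w v := by
  simp only [lieBr_eq]
  abel

theorem lieBr_add_right (u v w : E d) : lieBr G w (u + v) = lieBr G w u + lieBr G w v := by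
  rw [lieBr_skew, lieBr_add_left, lieBr_skew u, lieBr_skew v, neg_add, neg_neg, neg_neg]

theorem lieBr_zero_left (w : E d) : lieBr G 0 w = 0 := by
  have h : ((0, 0) : E d × E d) = 0 := rfl
  simp only [lieBr_eq, h, map_zero, _root_.zero_apply, sub_self]

theorem lieBr_zero_right (w : E d) : lieBr G w 0 = 0 := by
  rw [lieBr_skew, lieBr_zero_left, neg_zero]

/-- Differentiation of a solution of a linear equation `T y (F y) = R y` with `T c = 1`. -/
theorem hasFDerivAt_of_clm_apply_eq {B V : Type*} [NormedAddCommGroup B] [NormedSpace ℝ B]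
    [NormedAddCommGroup V] [NormedSpace ℝ V] [CompleteSpace V] {T : B → V →L[ℝ] V} {R F : B → V}
    {T' : B →L[ℝ] V →L[ℝ] V} {R' : B →L[ℝ] V} {c : B} (hT : HasFDerivAt T T' c)
    (hR : HasFDerivAt R R' c) (hTc : T c = ContinuousLinearMap.id ℝ V)
    (h : ∀ᶠ y in 𝓝 c, T y (F y) = R y) :
    HasFDerivAt F (R' - T'.flip (F c)) c := by
  -- near `c` the operator `T y` is invertible, so that `F y = (T y)⁻¹ (R y)`
  have hT1 : T c = ((1 : (V →L[ℝ] V)ˣ) : V →L[ℝ] V) := hTc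
  have h1 : HasFDerivAt (fun y => Ring.inverse (T y))
      ((-ContinuousLinearMap.mulLeftRight ℝ (V →L[ℝ] V) 1 1).comp T') c := by
    have h2 := hasFDerivAt_ringInverse (𝕜 := ℝ) (1 : (V →L[ℝ] V)ˣ)
    rw [← hT1] at h2
    rw [inv_one, Units.val_one] at h2
    exact HasFDerivAt.comp c h2 hT
  have hRc : R c = F c := by
    rw [← h.self_of_nhds, hTc]; rfl
  have h3 : (fun y => Ring.inverse (T y) (R y)) =ᶠ[𝓝 c] F := by
    have hu : ∀ᶠ y in 𝓝 c, IsUnit (T y) := by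
      have := hT.continuousAt.eventually (Units.isOpen.mem_nhds (x := T c) (by
        show IsUnit (T c)
        rw [hT1]; exact Units.isUnit _))
      exact this
    filter_upwards [h, hu] with y hy hy'
    rw [← hy]
    show (Ring.inverse (T y) * T y) (F y) = F y
    rw [Ring.inverse_mul_cancel _ hy']
    rfl
  refine ((h1.clm_apply hR).congr_of_eventuallyEq h3.symm).congr_fderiv ?_
  ext v
  have hi : Ring.inverse (ContinuousLinearMap.id ℝ V) = ContinuousLinearMap.id ℝ V :=
    Ring.inverse_one (V →L[ℝ] V)
  simp [hTc, hRc, hi, sub_eq_add_neg]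

variable (G) in
/-- The bracket `ζ ↦ [ζ, w]` as a continuous linear map. -/
def lieBrCLM (w : E d) : E d →L[ℝ] E d :=
  ((mulHess G).flip (0, w)).comp (ContinuousLinearMap.inl ℝ (E d) (E d)) -
    (mulHess G (w, 0)).comp (ContinuousLinearMap.inr ℝ (E d) (E d))

theorem lieBrCLM_apply (v w : E d) : lieBrCLM G w v = lieBr G v w := by
  rw [lieBr_eq]
  simp [lieBrCLM]

theorem contMDiff_conj (k : G) : ContMDiff (𝓡 d) (𝓡 d) ∞ (fun z : G => k * z * k⁻¹) :=
  (contMDiff_mul_right (I := 𝓡 d) (n := ∞) (a := k⁻¹)).comp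
    (contMDiff_mul_left (I := 𝓡 d) (n := ∞) (a := k))

theorem hasFDerivAt_conj_chart (k : G) :
    HasFDerivAt
      (fun y : E d => extChartAt (𝓡 d) (1 : G) (k * (extChartAt (𝓡 d) (1 : G)).symm y * k⁻¹)) (Ad k)
      (extChartAt (𝓡 d) (1 : G) 1) := by
  have h1 : HasMFDerivAt (𝓡 d) (𝓡 d) (fun z : G => k * z * k⁻¹) 1 (Ad k) :=
    ((contMDiff_conj k).mdifferentiableAt (by simp)).hasMFDerivAt
  have h2 : HasFDerivWithinAt (𝕜 := ℝ) (E := E d) (F := E d)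
    (writtenInExtChartAt (𝓡 d) (𝓡 d) 1 (fun z : G => k * z * k⁻¹)) (Ad k)
    (Set.range (𝓡 d)) (extChartAt (𝓡 d) (1 : G) 1) := h1.2
  rw [ModelWithCorners.Boundaryless.range_eq_univ, hasFDerivWithinAt_univ] at h2
  have e1 : k * 1 * k⁻¹ = 1 := by group
  have e2 : writtenInExtChartAt (𝓡 d) (𝓡 d) 1 (fun z : G => k * z * k⁻¹) =
      fun y : E d => extChartAt (𝓡 d) (1 : G) (k * (extChartAt (𝓡 d) (1 : G)).symm y * k⁻¹) := by
    unfold writtenInExtChartAt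
    beta_reduce
    rw [e1]
    rfl
  rwa [e2] at h2

/-- The identity `z h = h (h⁻¹ z h)`, differentiated in `z` at `1`, in the chart at `1`. -/
theorem fderiv_chartMul_Ad_inv (w : E d) : ∀ᶠ y in 𝓝 (extChartAt (𝓡 d) (1 : G) 1),
    fderiv ℝ (chartMul (1 : G)) (y, extChartAt (𝓡 d) (1 : G) 1)
      (0, Ad ((extChartAt (𝓡 d) (1 : G)).symm y)⁻¹ w) =
    fderiv ℝ (chartMul (1 : G)) (extChartAt (𝓡 d) (1 : G) 1, y) (w, 0) := by
  have hc : Filter.Tendsto (fun y : E d => (y, extChartAt (𝓡 d) (1 : G) 1))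
      (𝓝 (extChartAt (𝓡 d) (1 : G) 1))
      (𝓝 (extChartAt (𝓡 d) (1 : G) 1, extChartAt (𝓡 d) (1 : G) 1)) :=
    (Continuous.prodMk_left _).tendsto _
  have hc' : Filter.Tendsto (fun y : E d => (extChartAt (𝓡 d) (1 : G) 1, y))
      (𝓝 (extChartAt (𝓡 d) (1 : G) 1))
      (𝓝 (extChartAt (𝓡 d) (1 : G) 1, extChartAt (𝓡 d) (1 : G) 1)) :=
    (Continuous.prodMk_right _).tendsto _
  filter_upwards [hc.eventually (eventually_differentiableAt_chartMul (1 : G)),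
    hc'.eventually (eventually_differentiableAt_chartMul (1 : G))] with y hy hy'
  set c := extChartAt (𝓡 d) (1 : G) 1 with hcdef
  set e := extChartAt (𝓡 d) (1 : G)
  set h : G := e.symm y with hh
  have f1 : HasFDerivAt (fun z : E d => chartMul (1 : G) (z, y))
      ((fderiv ℝ (chartMul (1 : G)) (c, y)).comp (ContinuousLinearMap.inl ℝ (E d) (E d))) c :=
    HasFDerivAt.comp (f := fun z : E d => (z, y)) c hy'.hasFDerivAt (hasFDerivAt_prodMk_left _ _)
  have f2 := hasFDerivAt_conj_chart (d := d) h⁻¹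
  have e0 : e (h⁻¹ * e.symm c * h⁻¹⁻¹) = c := by
    rw [hcdef, extChartAt_to_inv]; simp [e]
  have f3 : HasFDerivAt (fun z : E d => chartMul (1 : G) (y, e (h⁻¹ * e.symm z * h⁻¹⁻¹)))
      ((fderiv ℝ (chartMul (1 : G)) (y, c)).comp
        ((ContinuousLinearMap.inr ℝ (E d) (E d)).comp (Ad h⁻¹))) c := by
    have f4 : HasFDerivAt (fun z : E d => (y, e (h⁻¹ * e.symm z * h⁻¹⁻¹)))
        ((ContinuousLinearMap.inr ℝ (E d) (E d)).comp (Ad h⁻¹)) c := by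
      have f4 := (hasFDerivAt_const (𝕜 := ℝ) (E := E d) (F := E d) y c).prodMk f2
      refine f4.congr_fderiv ?_
      ext v <;> simp
    have f6 : HasFDerivAt (chartMul (1 : G)) (fderiv ℝ (chartMul (1 : G)) (y, c))
        (y, e (h⁻¹ * e.symm c * h⁻¹⁻¹)) := by
      rw [e0]
      exact hy.hasFDerivAt
    exact HasFDerivAt.comp (f := fun z : E d => (y, e (h⁻¹ * e.symm z * h⁻¹⁻¹))) c f6 f4
  have f5 : (fun z : E d => chartMul (1 : G) (y, e (h⁻¹ * e.symm z * h⁻¹⁻¹))) =ᶠ[𝓝 c]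
      fun z : E d => chartMul (1 : G) (z, y) := by
    have g1 : ContinuousAt (fun z : G => h⁻¹ * z * h⁻¹⁻¹) 1 :=
      (contMDiff_conj (d := d) h⁻¹).continuous.continuousAt
    have g2 : (fun z : G => h⁻¹ * z * h⁻¹⁻¹) ⁻¹' e.source ∈ 𝓝 (1 : G) := by
      refine g1.preimage_mem_nhds ?_
      have : h⁻¹ * 1 * h⁻¹⁻¹ = 1 := by group
      rw [this]
      exact extChartAt_source_mem_nhds (I := 𝓡 d) (1 : G)
    filter_upwards [extChartAt_symm_eventually_mem (1 : G) g2] with z hz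
    have hz' : h⁻¹ * e.symm z * h⁻¹⁻¹ ∈ e.source := hz
    show e (e.symm y * e.symm (e (h⁻¹ * e.symm z * h⁻¹⁻¹))) = e (e.symm z * e.symm y)
    rw [e.left_inv hz', ← hh]
    congr 1
    group
  have f6 := congrArg (fun T : E d →L[ℝ] E d => T w)
    ((f3.congr_of_eventuallyEq f5.symm).unique f1)
  simpa using f6

/-- A function whose chart representative is differentiable is differentiable. -/
theorem hasMFDerivAt_of_hasFDerivAt_chart {k : ℕ} {X V : Type*} [TopologicalSpace X]
    [ChartedSpace (E k) X] [IsManifold (𝓡 k) ∞ X] [NormedAddCommGroup V] [NormedSpace ℝ V]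
    {f : X → V} {x : X} {f' : E k →L[ℝ] V}
    (h : HasFDerivAt (fun y => f ((extChartAt (𝓡 k) x).symm y)) f' (extChartAt (𝓡 k) x x)) :
    HasMFDerivAt (𝓡 k) 𝓘(ℝ, V) f x f' := by
  have h1 : (fun q => f ((extChartAt (𝓡 k) x).symm (extChartAt (𝓡 k) x q))) =ᶠ[𝓝 x] f := by
    filter_upwards [extChartAt_source_mem_nhds (I := 𝓡 k) x] with q hq
    rw [(extChartAt (𝓡 k) x).left_inv hq]
  refine ⟨?_, ?_⟩
  · have h2 : ContinuousAt (fun q => f ((extChartAt (𝓡 k) x).symm (extChartAt (𝓡 k) x q))) x :=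
      ContinuousAt.comp (g := fun y => f ((extChartAt (𝓡 k) x).symm y)) h.continuousAt
        (continuousAt_extChartAt x)
    exact h2.congr h1
  · have h2 : HasFDerivWithinAt (𝕜 := ℝ) (E := E k) (F := V)
        (fun y => f ((extChartAt (𝓡 k) x).symm y)) f' (Set.range (𝓡 k)) (extChartAt (𝓡 k) x x) :=
      h.hasFDerivWithinAt
    exact h2

omit [LieGroup (𝓡 d) ∞ G] in
theorem Ad_one : Ad (1 : G) = ContinuousLinearMap.id ℝ (E d) := by
  have h : (fun k : G => 1 * k * 1⁻¹) = id := by ext; simp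
  unfold Ad
  rw [h]
  exact mfderiv_id

/-- The derivative of `h ↦ Ad(h⁻¹) w` at `1` is `-[·, w]`. It is obtained by differentiating the
identity `z h = h (h⁻¹ z h)`, first in `z` and then in `h`. -/
theorem hasFDerivAt_Ad_inv_chart (w : E d) :
    HasFDerivAt (fun y => Ad ((extChartAt (𝓡 d) (1 : G)).symm y)⁻¹ w) (-lieBrCLM G w)
      (extChartAt (𝓡 d) (1 : G) 1) := by
  set c := extChartAt (𝓡 d) (1 : G) 1 with hcdef
  have h1 : HasFDerivAt (fun y : E d => (y, c)) (ContinuousLinearMap.inl ℝ (E d) (E d)) c :=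
    hasFDerivAt_prodMk_left _ _
  have h2 : HasFDerivAt (fun y : E d => fderiv ℝ (chartMul (1 : G)) (y, c))
      ((mulHess G).comp (ContinuousLinearMap.inl ℝ (E d) (E d))) c :=
    HasFDerivAt.comp (f := fun y : E d => (y, c)) c
      (differentiableAt_fderiv_chartMul (d := d) (1 : G)).hasFDerivAt h1
  have h3 := h2.clm_comp (hasFDerivAt_const (ContinuousLinearMap.inr ℝ (E d) (E d)) c)
  have h4 := hasFDerivAt_of_clm_apply_eq h3 (hasFDerivAt_fderiv_chartMul_left (G := G) w)
    (by
      ext1 u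
      exact fderiv_chartMul_base_right (1 : G) u)
    (F := fun y => Ad ((extChartAt (𝓡 d) (1 : G)).symm y)⁻¹ w) (by
      filter_upwards [fderiv_chartMul_Ad_inv (G := G) w] with y hy
      exact hy)
  refine h4.congr_fderiv ?_
  ext1 v
  have e1 : Ad ((extChartAt (𝓡 d) (1 : G)).symm c)⁻¹ w = w := by
    rw [hcdef, extChartAt_to_inv, inv_one, Ad_one]; rfl
  rw [e1, neg_apply, lieBrCLM_apply, lieBr_eq, mulHess_symm (w, 0) (0, v)]
  simp

theorem hasMFDerivAt_Ad_inv (w : E d) :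
    HasMFDerivAt (𝓡 d) 𝓘(ℝ, E d) (fun h : G => Ad h⁻¹ w) 1 (-lieBrCLM G w : E d →L[ℝ] E d) :=
  hasMFDerivAt_of_hasFDerivAt_chart (hasFDerivAt_Ad_inv_chart w)

end LieGroupCalculus

/-! ### Values and derivatives of Sobolev fields -/

section SobolevEval

/-- The derivative at `p` of a vector valued function on a manifold, as a linear map on the model
space, with which the tangent space is identified. -/
def funDeriv {n : ℕ} {P V : Type*} [TopologicalSpace P] [ChartedSpace (E n) P]
    [NormedAddCommGroup V] [NormedSpace ℝ V] (f : P → V) (p : P) : E n →L[ℝ] V :=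
  (mfderiv (𝓡 n) 𝓘(ℝ, V) f p : E n →L[ℝ] V)

variable {n : ℕ} {V : Type*} [NormedAddCommGroup V] [NormedSpace ℝ V]

theorem JetSpace.norm_classical_le {ι : Type} [Fintype ι] {k : ℕ}
    {O : ι → TopologicalSpace.Opens (E n)} (D : JetSpace k O V) (i : ι) (j : Fin (k - 2 + 1))
    (y : (O i : Set (E n))) : ‖(D i).1 j y‖ ≤ ‖D‖ :=
  ((BoundedContinuousFunction.norm_coe_le_norm _ y).trans (norm_le_pi_norm (D i).1 j)).trans
    ((norm_fst_le (D i)).trans (norm_le_pi_norm (f := D) i))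

theorem IsSobolevJet.norm_iteratedFDeriv_le {ι : Type} [Fintype ι] {k : ℕ}
    {O : ι → TopologicalSpace.Opens (E n)} {Φ : Type*} [AddCommGroup Φ] [Module ℝ Φ]
    {L : ι → Φ →ₗ[ℝ] (E n → V)} {f : Φ} {D : JetSpace k O V} (h : IsSobolevJet k O L f D) (i : ι)
    {j : ℕ} (hj : j ≤ k - 2) {y : E n} (hy : y ∈ O i) :
    ‖iteratedFDeriv ℝ j (L i f) y‖ ≤ ‖D‖ := by
  have h1 := h.classical i ⟨j, by omega⟩ ⟨y, hy⟩
  have h2 := D.norm_classical_le i ⟨j, by omega⟩ ⟨y, hy⟩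
  rw [h1] at h2
  exact h2

theorem IsSobolevJet.norm_le {ι : Type} [Fintype ι] {k : ℕ}
    {O : ι → TopologicalSpace.Opens (E n)} {Φ : Type*} [AddCommGroup Φ] [Module ℝ Φ]
    {L : ι → Φ →ₗ[ℝ] (E n → V)} {f : Φ} {D : JetSpace k O V} (h : IsSobolevJet k O L f D) (i : ι)
    {y : E n} (hy : y ∈ O i) : ‖L i f y‖ ≤ ‖D‖ := by
  have := h.norm_iteratedFDeriv_le i (Nat.zero_le _) hy
  rwa [norm_iteratedFDeriv_zero] at this

theorem IsSobolevJet.norm_fderiv_le {ι : Type} [Fintype ι] {k : ℕ} (hk : 3 ≤ k)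
    {O : ι → TopologicalSpace.Opens (E n)} {Φ : Type*} [AddCommGroup Φ] [Module ℝ Φ]
    {L : ι → Φ →ₗ[ℝ] (E n → V)} {f : Φ} {D : JetSpace k O V} (h : IsSobolevJet k O L f D) (i : ι)
    {y : E n} (hy : y ∈ O i) : ‖fderiv ℝ (L i f) y‖ ≤ ‖D‖ := by
  have := h.norm_iteratedFDeriv_le i (j := 1) (by omega) hy
  rwa [norm_iteratedFDeriv_one] at this

/-- A field is determined by its values: its weak derivatives are unique by the fundamental lemma
of the calculus of variations. -/
theorem IsSobolevJet.eq_zero [CompleteSpace V] {ι : Type} [Fintype ι] {k : ℕ}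
    {O : ι → TopologicalSpace.Opens (E n)} {Φ : Type*} [AddCommGroup Φ] [Module ℝ Φ]
    {L : ι → Φ →ₗ[ℝ] (E n → V)} {D : JetSpace k O V} (h : IsSobolevJet k O L 0 D) : D = 0 := by
  have hL2 : ∀ i (j : ℕ) (hj : j < k + 1), (D i).2 ⟨j, hj⟩ = 0 := by
    intro i j
    induction j with
    | zero =>
      intro hj
      refine Lp.ext ?_
      filter_upwards [h.zero i, Lp.coeFn_zero (E n [×0]→L[ℝ] V) 2
        (volume.restrict (O i : Set (E n)))] with y hy hy0
      refine (hy.trans ?_).trans hy0.symm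
      ext m
      simp
    | succ j ih =>
      intro hj
      have hw := h.weak i j (by omega)
      have hz := ih (by omega)
      have hcurry : ∀ v : E n, ∀ᵐ y ∂volume, y ∈ (O i : Set (E n)) →
          ((D i).2 ⟨j + 1, hj⟩ y).curryLeft v = 0 := by
        intro v
        let T : (E n [×(j + 1)]→L[ℝ] V) →L[ℝ] (E n [×j]→L[ℝ] V) :=
          (ContinuousLinearMap.apply ℝ (E n [×j]→L[ℝ] V) v).comp
            (continuousMultilinearCurryLeftEquiv ℝ (fun _ : Fin (j + 1) => E n)
              V).toContinuousLinearEquiv.toContinuousLinearMap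
        have hloc : LocallyIntegrableOn (fun y => ((D i).2 ⟨j + 1, hj⟩ y).curryLeft v)
            (O i : Set (E n)) volume := by
          have h1 : LocallyIntegrable (fun y => T ((D i).2 ⟨j + 1, hj⟩ y))
              (volume.restrict (O i : Set (E n))) :=
            (T.comp_memLp' (Lp.memLp ((D i).2 ⟨j + 1, hj⟩))).locallyIntegrable (by norm_num)
          exact locallyIntegrableOn_of_locallyIntegrable_restrict h1
        refine IsOpen.ae_eq_zero_of_integral_contDiff_smul_eq_zero (O i).isOpen hloc ?_
        intro φ hφ hc hs
        -- up to sign, the weak derivative of order `j + 1` pairs with `φ` as that of order `j`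
        -- does with `∂_v φ`
        have h1 := hw φ hφ hc hs v
        let w : Lp (E n [×j]→L[ℝ] V) 2 (volume.restrict (O i : Set (E n))) := (D i).2 ⟨j, by omega⟩
        have hz' : w = 0 := hz
        have h2 : ∫ x in (O i : Set (E n)), (fderiv ℝ φ x v) • w x = 0 := by
          rw [hz']
          refine integral_eq_zero_of_ae ?_
          filter_upwards [Lp.coeFn_zero (E n [×j]→L[ℝ] V) 2 (volume.restrict (O i : Set (E n)))]
            with x hx
          rw [hx]
          simp
        have h3 := neg_eq_zero.1 (h2.symm.trans h1).symm
        rw [← h3, setIntegral_eq_integral_of_forall_compl_eq_zero]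
        intro x hx
        have : φ x = 0 := image_eq_zero_of_notMem_tsupport fun hx' => hx (hs hx')
        rw [this, zero_smul]
      refine Lp.ext ?_
      have hall : ∀ᵐ y ∂(volume.restrict (O i : Set (E n))), ∀ b : Fin n,
          ((D i).2 ⟨j + 1, hj⟩ y).curryLeft (EuclideanSpace.basisFun (Fin n) ℝ b) = 0 := by
        rw [ae_all_iff]
        intro b
        exact (ae_restrict_iff' (O i).isOpen.measurableSet).2 (hcurry _)
      filter_upwards [hall, Lp.coeFn_zero (E n [×(j + 1)]→L[ℝ] V) 2
        (volume.restrict (O i : Set (E n)))] with y hy hy0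
      rw [hy0]
      have h4 : ((D i).2 ⟨j + 1, hj⟩ y).curryLeft = 0 := by
        have := (EuclideanSpace.basisFun (Fin n) ℝ).toBasis.ext
          (f₁ := (((D i).2 ⟨j + 1, hj⟩ y).curryLeft : E n →ₗ[ℝ] (E n [×j]→L[ℝ] V))) (f₂ := 0)
          (fun b => by simpa using hy b)
        ext1 v
        exact congrArg (fun T : E n →ₗ[ℝ] (E n [×j]→L[ℝ] V) => T v) this
      ext m
      have h5 := congrArg (fun T : E n →L[ℝ] (E n [×j]→L[ℝ] V) => T (m 0) (Fin.tail m)) h4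
      simpa using h5
  funext i
  refine Prod.ext (funext fun j => ?_) (funext fun j => hL2 i j j.2)
  ext1 y
  rw [h.classical, map_zero]
  have : (0 : E n → V) = fun _ => 0 := rfl
  rw [this, iteratedFDeriv_fun_zero]
  rfl

variable {P : Type*} [TopologicalSpace P] [ChartedSpace (E n) P] {C : ChartCover n P} {k : ℕ}

theorem SobolevFun.isSobolevJet (f : SobolevFun C k V) :
    IsSobolevJet k C.chartDom (C.funRep V) f.val f.jet :=
  (show sobolevSubmodule k C.chartDom (C.funRep V) from f).2

theorem SobolevForm.isSobolevJet (a : SobolevForm C k V) :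
    IsSobolevJet k C.chartDom (C.formRep V) a.val a.jet :=
  (show sobolevSubmodule k C.chartDom (C.formRep V) from a).2

/-- The supremum norm is dominated by the norm of `L²_k`. -/
theorem SobolevFun.norm_val_le (f : SobolevFun C k V) (p : P) : ‖f.val p‖ ≤ ‖f‖ := by
  obtain ⟨i, hp, hi⟩ := C.exists_chart p
  have h := f.isSobolevJet.norm_le i hi
  have e : C.funRep V i f.val (extChartAt (𝓡 n) (C.center i) p) = f.val p := by
    show f.val _ = _
    rw [(extChartAt (𝓡 n) (C.center i)).left_inv hp]
  rwa [e] at h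

/-- Evaluation at a point. -/
def SobolevFun.evalCLM (C : ChartCover n P) (k : ℕ) (p : P) : SobolevFun C k V →L[ℝ] V :=
  LinearMap.mkContinuous
    { toFun := fun f => f.val p, map_add' := fun _ _ => rfl, map_smul' := fun _ _ => rfl } 1
    fun f => by rw [one_mul]; exact f.norm_val_le p

variable [IsManifold (𝓡 n) ∞ P]

theorem SobolevFun.contMDiff (f : SobolevFun C k V) :
    ContMDiff (𝓡 n) 𝓘(ℝ, V) ((k - 2 : ℕ) : ℕ∞) f.val := by
  intro p
  obtain ⟨i, hp, hi⟩ := C.exists_chart p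
  have h1 : ContMDiffAt 𝓘(ℝ, E n) 𝓘(ℝ, V) ((k - 2 : ℕ) : ℕ∞) (C.funRep V i f.val)
      (extChartAt (𝓡 n) (C.center i) p) :=
    ((f.isSobolevJet.contDiffOn i).contDiffAt ((C.chartDom i).isOpen.mem_nhds hi)).contMDiffAt
  have h2 : ContMDiffAt (𝓡 n) 𝓘(ℝ, E n) ((k - 2 : ℕ) : ℕ∞) (extChartAt (𝓡 n) (C.center i)) p :=
    (contMDiffAt_extChartAt' (n := ∞) (by rwa [← extChartAt_source (𝓡 n)])).of_le
      (WithTop.coe_le_coe.2 le_top)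
  refine (h1.comp p h2).congr_of_eventuallyEq ?_
  filter_upwards [extChartAt_source_mem_nhds' hp] with q hq
  show f.val q = f.val _
  rw [(extChartAt (𝓡 n) (C.center i)).left_inv hq]

theorem SobolevFun.mdifferentiableAt (hk : 3 ≤ k) (f : SobolevFun C k V) (p : P) :
    MDifferentiableAt (𝓡 n) 𝓘(ℝ, V) f.val p :=
  f.contMDiff.mdifferentiableAt (by
    have : k - 2 ≠ 0 := by omega
    exact_mod_cast this)

/-- From `k = 3` on, the norm of `L²_k` dominates the first derivatives. -/
theorem SobolevFun.exists_norm_funDeriv_le (C : ChartCover n P) (hk : 3 ≤ k) (p : P) (v : E n) :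
    ∃ c : ℝ, ∀ f : SobolevFun C k V,
      ‖funDeriv f.val p v‖ ≤ c * ‖f‖ := by
  obtain ⟨i, hp, hi⟩ := C.exists_chart p
  refine ⟨‖funDeriv (extChartAt (𝓡 n) (C.center i)) p v‖, fun f => ?_⟩
  have h1 : DifferentiableAt ℝ (C.funRep V i f.val) (extChartAt (𝓡 n) (C.center i) p) :=
    ((f.isSobolevJet.contDiffOn i).contDiffAt
      ((C.chartDom i).isOpen.mem_nhds hi)).differentiableAt (by
        have : k - 2 ≠ 0 := by omega
        exact_mod_cast this)
  have h2 : MDifferentiableAt (𝓡 n) 𝓘(ℝ, E n) (extChartAt (𝓡 n) (C.center i)) p :=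
    mdifferentiableAt_extChartAt (by rwa [← extChartAt_source (𝓡 n)])
  have h3 := HasMFDerivAt.comp p h1.hasFDerivAt.hasMFDerivAt h2.hasMFDerivAt
  have h4 : f.val =ᶠ[𝓝 p] C.funRep V i f.val ∘ extChartAt (𝓡 n) (C.center i) := by
    filter_upwards [extChartAt_source_mem_nhds' hp] with q hq
    show f.val q = f.val _
    rw [(extChartAt (𝓡 n) (C.center i)).left_inv hq]
  have h5 := (h3.congr_of_eventuallyEq h4).mfderiv
  have h6 : funDeriv f.val p v =
      fderiv ℝ (C.funRep V i f.val) (extChartAt (𝓡 n) (C.center i) p)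
        (funDeriv (extChartAt (𝓡 n) (C.center i)) p v) :=
    congrArg (fun T : E n →L[ℝ] V => T v) h5
  rw [h6, mul_comm]
  refine (ContinuousLinearMap.le_opNorm _ _).trans ?_
  gcongr
  exact f.isSobolevJet.norm_fderiv_le hk i hi

theorem SobolevFun.funDeriv_add (hk : 3 ≤ k) (f g : SobolevFun C k V) (p : P) (v : E n) :
    funDeriv (f + g).val p v =
      funDeriv f.val p v + funDeriv g.val p v := by
  have h := ((f.mdifferentiableAt hk p).hasMFDerivAt.add
    (g.mdifferentiableAt hk p).hasMFDerivAt).mfderiv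
  exact congrArg (fun T : E n →L[ℝ] V => T v) h

theorem SobolevFun.funDeriv_smul (hk : 3 ≤ k) (c : ℝ) (f : SobolevFun C k V) (p : P) (v : E n) :
    funDeriv (c • f).val p v =
      c • funDeriv f.val p v := by
  have h := ((f.mdifferentiableAt hk p).hasMFDerivAt.const_smul c).mfderiv
  exact congrArg (fun T : E n →L[ℝ] V => T v) h

/-- The derivative at the point `p` in the direction `v`. -/
def SobolevFun.funDerivCLM (C : ChartCover n P) (hk : 3 ≤ k) (p : P) (v : E n) :
    SobolevFun C k V →L[ℝ] V :=
  LinearMap.mkContinuous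
    { toFun := fun f => funDeriv f.val p v
      map_add' := fun f g => f.funDeriv_add hk g p v
      map_smul' := fun c f => f.funDeriv_smul hk c p v }
    (SobolevFun.exists_norm_funDeriv_le C hk p v).choose
    (SobolevFun.exists_norm_funDeriv_le C hk p v).choose_spec

/-- The values of a one-form, recovered from its representative in a chart of the cover. -/
theorem SobolevForm.val_eq_formRep (a : P → E n →L[ℝ] V) {i : C.ι} {p : P}
    (hp : p ∈ (extChartAt (𝓡 n) (C.center i)).source) (v : E n) :
    a p v = C.formRep V i a (extChartAt (𝓡 n) (C.center i) p)
      (funDeriv (extChartAt (𝓡 n) (C.center i)) p v) := by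
  have key := mfderivWithin_extChartAt_symm_comp_mfderiv_extChartAt' (I := 𝓡 n) hp
  rw [ModelWithCorners.Boundaryless.range_eq_univ, mfderivWithin_univ] at key
  have h3 : (mfderiv 𝓘(ℝ, E n) (𝓡 n) (extChartAt (𝓡 n) (C.center i)).symm
      (extChartAt (𝓡 n) (C.center i) p)
      (funDeriv (extChartAt (𝓡 n) (C.center i)) p v) : E n) = v :=
    congrArg (fun T : E n →L[ℝ] E n => T v) key
  show _ = a ((extChartAt (𝓡 n) (C.center i)).symm (extChartAt (𝓡 n) (C.center i) p)) _
  rw [(extChartAt (𝓡 n) (C.center i)).left_inv hp]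
  exact congrArg (a p) h3.symm

theorem SobolevForm.exists_norm_val_le (C : ChartCover n P) (k : ℕ) (p : P) (v : E n) :
    ∃ c : ℝ, ∀ a : SobolevForm C k V, ‖a.val p v‖ ≤ c * ‖a‖ := by
  obtain ⟨i, hp, hi⟩ := C.exists_chart p
  refine ⟨‖funDeriv (extChartAt (𝓡 n) (C.center i)) p v‖, fun a => ?_⟩
  rw [SobolevForm.val_eq_formRep a.val hp, mul_comm]
  refine (ContinuousLinearMap.le_opNorm _ _).trans ?_
  gcongr
  exact a.isSobolevJet.norm_le i hi

/-- Evaluation of a one-form on a tangent vector. -/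
def SobolevForm.evalCLM (C : ChartCover n P) (k : ℕ) (p : P) (v : E n) :
    SobolevForm C k V →L[ℝ] V :=
  LinearMap.mkContinuous
    { toFun := fun a => a.val p v, map_add' := fun _ _ => rfl, map_smul' := fun _ _ => rfl }
    (SobolevForm.exists_norm_val_le C k p v).choose
    (SobolevForm.exists_norm_val_le C k p v).choose_spec

/-- A one-form of class `L²_k` is determined by its values. -/
theorem SobolevForm.ext_val [CompleteSpace V] {a b : SobolevForm C k V}
    (h : ∀ p v, a.val p v = b.val p v) : a = b := by
  have h0 : (a - b).val = 0 := by
    funext p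
    ext1 v
    show a.val p v - b.val p v = 0
    rw [h, sub_self]
  have h1 := (a - b).isSobolevJet
  rw [h0] at h1
  have h2 := h1.eq_zero
  exact sobolevJet_injective k C.chartDom (C.formRep V) C.formRep_injective
    (sub_eq_zero.1 ((map_sub (SobolevForm.jet (C := C) (k := k) (V := V)) a b).symm.trans h2))

/-- The coefficients of a one-form of class `L²_k` in a chart centred at an arbitrary point, which
need not be one of the charts of the cover, are of class `C^{k-2}`. -/
theorem SobolevForm.contDiffAt_localRep (a : SobolevForm C k V) (p : P) (v : E n) :
    ContDiffAt ℝ ((k - 2 : ℕ) : ℕ∞) (fun y => localRep (𝓡 n) (fun q w => a.val q w) p y v)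
      (extChartAt (𝓡 n) p p) := by
  obtain ⟨i, hp, hi⟩ := C.exists_chart p
  set e := extChartAt (𝓡 n) p with he
  set e' := extChartAt (𝓡 n) (C.center i) with he'
  set m : WithTop ℕ∞ := (((k - 2 : ℕ) : ℕ∞) : WithTop ℕ∞) with hm
  let τ : E n → E n := fun y => e' (e.symm y)
  have hep : e.symm (e p) = p := extChartAt_to_inv p
  have hτ0 : τ (e p) = e' p := congrArg e' hep
  have hτ : ContDiffAt ℝ ∞ τ (e p) := by
    have h1 : ContMDiffAt (𝓡 n) 𝓘(ℝ, E n) ∞ e' (e.symm (e p)) := by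
      rw [hep]
      exact contMDiffAt_extChartAt' (by rwa [← extChartAt_source (𝓡 n)])
    exact (h1.comp _ (contMDiffAt_extChartAt_symm p (mem_extChartAt_target p))).contDiffAt
  have hmle : m ≤ ∞ := WithTop.coe_le_coe.2 le_top
  have h2 : ContDiffAt ℝ m (C.formRep V i a.val) (τ (e p)) := by
    rw [hτ0]
    exact (a.isSobolevJet.contDiffOn i).contDiffAt ((C.chartDom i).isOpen.mem_nhds hi)
  have h3 : ContDiffAt ℝ m (fun y => C.formRep V i a.val (τ y) (fderiv ℝ τ y v)) (e p) := by
    refine (h2.comp _ (hτ.of_le hmle)).clm_apply (ContDiffAt.clm_apply ?_ contDiffAt_const)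
    exact hτ.fderiv_right (m := m) (by
      rw [hm]
      exact WithTop.coe_le_coe.2 (le_top : ((k - 2 : ℕ) : ℕ∞) + 1 ≤ ⊤))
  refine h3.congr_of_eventuallyEq ?_
  have hs : e'.source ∈ 𝓝 p := extChartAt_source_mem_nhds' hp
  filter_upwards [extChartAt_symm_eventually_mem p hs,
    (isOpen_extChartAt_target p).mem_nhds (mem_extChartAt_target (I := 𝓡 n) p)] with y hy hyt
  refine (SobolevForm.val_eq_formRep a.val hy _).trans ?_
  refine congrArg (C.formRep V i a.val (τ y)) ?_
  have h4 : MDifferentiableAt (𝓡 n) 𝓘(ℝ, E n) e' (e.symm y) :=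
    mdifferentiableAt_extChartAt (by rwa [← extChartAt_source (𝓡 n)])
  have h5 := HasMFDerivAt.comp y h4.hasMFDerivAt
    (mdifferentiableAt_extChartAt_symm p hyt).hasMFDerivAt
  have h6 : HasFDerivAt τ ((funDeriv e' (e.symm y)).comp (symmDeriv p y)) y := h5.hasFDerivAt
  rw [h6.fderiv]
  rfl

end SobolevEval

/-! ### Derivatives of maps into groups and bundles -/

section ManDeriv

variable {k m : ℕ} {X Y : Type*} [TopologicalSpace X] [ChartedSpace (E k) X]
  [TopologicalSpace Y] [ChartedSpace (E m) Y]

/-- The derivative at `x` of a map between manifolds, as a linear map between the model spaces. -/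
def manDeriv (f : X → Y) (x : X) : E k →L[ℝ] E m :=
  (mfderiv (𝓡 k) (𝓡 m) f x : E k →L[ℝ] E m)

/-- At a point mapped to `y`, the derivative can be computed in the chart centred at `y`. -/
theorem funDeriv_chart_comp [IsManifold (𝓡 m) ∞ Y] {f : X → Y} {x : X} {y : Y}
    (hf : MDifferentiableAt (𝓡 k) (𝓡 m) f x) (hy : f x = y) :
    (funDeriv (fun q => extChartAt (𝓡 m) y (f q)) x : E k →L[ℝ] E m) = manDeriv f x := by
  subst hy
  have h1 : HasMFDerivAt (𝓡 m) 𝓘(ℝ, E m) (extChartAt (𝓡 m) (f x)) (f x)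
      (ContinuousLinearMap.id ℝ (E m)) := by
    have h := (mdifferentiableAt_extChartAt (I := 𝓡 m) (mem_chart_source (E m) (f x))).hasMFDerivAt
    rwa [mfderiv_extChartAt_self] at h
  exact (HasMFDerivAt.comp x h1 hf.hasMFDerivAt).mfderiv

end ManDeriv

section LieGroupCurves

variable {d : ℕ} {G : Type*} [TopologicalSpace G] [ChartedSpace (E d) G] [Group G]
  [LieGroup (𝓡 d) ∞ G]

/-- The derivative of `h ↦ Ad(h⁻¹) w` along a curve through `1`. -/
theorem hasDerivAt_Ad_inv {k : ℝ → G} {y : ℝ → E d} {ζ : E d}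
    (hk : ∀ᶠ s in 𝓝 0, k s = (extChartAt (𝓡 d) (1 : G)).symm (y s))
    (hy : HasDerivAt y ζ 0) (hy0 : y 0 = extChartAt (𝓡 d) (1 : G) 1) (w : E d) :
    HasDerivAt (fun s => Ad (k s)⁻¹ w) (-lieBr G ζ w) 0 := by
  have h1 := hasFDerivAt_Ad_inv_chart (G := G) w
  rw [← hy0] at h1
  have h2 := h1.comp_hasDerivAt 0 hy
  rw [neg_apply, lieBrCLM_apply] at h2
  refine h2.congr_of_eventuallyEq ?_
  filter_upwards [hk] with s hs
  rw [hs]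
  rfl

/-- For a map `g` which in the chart at `1` reads `u + const`, the differential of
`q ↦ g(p)⁻¹ g(q)` at `p` solves a linear equation with right-hand side `du`: the identity
`g(q) = g(p) (g(p)⁻¹ g(q))` is differentiated at `q = p`. -/
theorem fderiv_chartMul_logDeriv {n : ℕ} {P : Type*} [TopologicalSpace P] [ChartedSpace (E n) P]
    [IsManifold (𝓡 n) ∞ P] {g : P → G} {u : P → E d} {p : P}
    (hg : MDifferentiableAt (𝓡 n) (𝓡 d) g p)
    (hgu : ∀ q, g q ∈ (extChartAt (𝓡 d) (1 : G)).source ∧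
      u q = extChartAt (𝓡 d) (1 : G) (g q) - extChartAt (𝓡 d) (1 : G) 1)
    (hd : DifferentiableAt ℝ (chartMul (1 : G))
      (extChartAt (𝓡 d) (1 : G) 1 + u p, extChartAt (𝓡 d) (1 : G) 1)) (v : E n) :
    fderiv ℝ (chartMul (1 : G)) (extChartAt (𝓡 d) (1 : G) 1 + u p, extChartAt (𝓡 d) (1 : G) 1)
      (0, manDeriv (fun q => (g p)⁻¹ * g q) p v) = funDeriv u p v := by
  set c := extChartAt (𝓡 d) (1 : G) 1 with hc
  set e := extChartAt (𝓡 d) (1 : G) with he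
  have hk : MDifferentiableAt (𝓡 n) (𝓡 d) (fun q => (g p)⁻¹ * g q) p :=
    MDifferentiableAt.comp (I' := 𝓡 d) p
      ((contMDiff_mul_left (I := 𝓡 d) (n := ∞) (a := (g p)⁻¹)).mdifferentiableAt (by simp)) hg
  have hk1 : (g p)⁻¹ * g p = 1 := inv_mul_cancel _
  rw [← funDeriv_chart_comp hk hk1]
  have hkc : MDifferentiableAt (𝓡 n) 𝓘(ℝ, E d) (fun q => e ((g p)⁻¹ * g q)) p := by
    refine MDifferentiableAt.comp (I' := 𝓡 d) p (g := e) ?_ hk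
    rw [hk1]
    exact mdifferentiableAt_extChartAt (mem_chart_source (E d) (1 : G))
  have h1 : HasMFDerivAt (𝓡 n) 𝓘(ℝ, E d) (fun q => e ((g p)⁻¹ * g q)) p
      (funDeriv (fun q => e ((g p)⁻¹ * g q)) p) := hkc.hasMFDerivAt
  have h2 : HasFDerivAt (fun z => chartMul (1 : G) (c + u p, z))
      ((fderiv ℝ (chartMul (1 : G)) (c + u p, c)).comp (ContinuousLinearMap.inr ℝ (E d) (E d)))
      (e ((g p)⁻¹ * g p)) := by
    rw [hk1]
    exact hd.hasFDerivAt.comp c (hasFDerivAt_prodMk_right _ _)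
  have h3 := HasMFDerivAt.comp p h2.hasMFDerivAt h1
  have h4 : (fun q => c + u q) =ᶠ[𝓝 p]
      (fun z => chartMul (1 : G) (c + u p, z)) ∘ (fun q => e ((g p)⁻¹ * g q)) := by
    have g1 : (fun q => (g p)⁻¹ * g q) ⁻¹' e.source ∈ 𝓝 p := by
      refine hk.continuousAt.preimage_mem_nhds ?_
      rw [hk1]
      exact extChartAt_source_mem_nhds (I := 𝓡 d) (1 : G)
    filter_upwards [g1] with q hq
    have hq' : (g p)⁻¹ * g q ∈ e.source := hq
    show c + u q = e (e.symm (c + u p) * e.symm (e ((g p)⁻¹ * g q)))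
    rw [e.left_inv hq', (hgu q).2, (hgu p).2, add_sub_cancel, add_sub_cancel,
      e.left_inv (hgu p).1, mul_inv_cancel_left]
  have h5 := h3.congr_of_eventuallyEq h4
  have h6 : HasMFDerivAt (𝓡 n) 𝓘(ℝ, E d) u p
      (((fderiv ℝ (chartMul (1 : G)) (c + u p, c)).comp
        (ContinuousLinearMap.inr ℝ (E d) (E d))).comp
        (funDeriv (fun q => e ((g p)⁻¹ * g q)) p)) := by
    have h7 := h5.sub (hasMFDerivAt_const (I := 𝓡 n) (I' := 𝓘(ℝ, E d)) c p)
    have h8 : (fun q => c + u q) - (fun _ => c) = u := by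
      funext q; simp
    rw [h8] at h7
    exact h7.congr_mfderiv (sub_zero (((fderiv ℝ (chartMul (1 : G)) (c + u p, c)).comp
      (ContinuousLinearMap.inr ℝ (E d) (E d))).comp
      (funDeriv (fun q => e ((g p)⁻¹ * g q)) p)))
  have h7 : funDeriv u p = _ := h6.mfderiv
  rw [h7]
  rfl

end LieGroupCurves

section BundleDeriv

variable {m n d : ℕ} {M P G : Type*}
  [TopologicalSpace M] [ChartedSpace (E m) M] [TopologicalSpace P] [ChartedSpace (E n) P]
  [IsManifold (𝓡 n) ∞ P]
  [TopologicalSpace G] [ChartedSpace (E d) G] [Group G] [LieGroup (𝓡 d) ∞ G]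

omit [IsManifold (𝓡 n) ∞ P] in
/-- The derivative of `q ↦ q g(q)`: near `p` the map is `q ↦ (q g(p)) (g(p)⁻¹ g(q))`. -/
theorem PrincipalBundle.manDeriv_act (Q : PrincipalBundle m n d M P G) {g : P → G} {p : P}
    (hg : MDifferentiableAt (𝓡 n) (𝓡 d) g p) (v : E n) :
    manDeriv (fun q => Q.act q (g q)) p v = Q.dAct p (g p) v +
      Q.vert (Q.act p (g p)) (manDeriv (fun q => (g p)⁻¹ * g q) p v) := by
  have hk : MDifferentiableAt (𝓡 n) (𝓡 d) (fun q => (g p)⁻¹ * g q) p :=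
    MDifferentiableAt.comp (I' := 𝓡 d) p
      ((contMDiff_mul_left (I := 𝓡 d) (n := ∞) (a := (g p)⁻¹)).mdifferentiableAt (by simp)) hg
  have hk1 : (g p)⁻¹ * g p = 1 := inv_mul_cancel _
  have hR : MDifferentiableAt (𝓡 n) (𝓡 n) (fun q => Q.act q (g p)) p :=
    (Q.contMDiff_act.comp (contMDiff_id.prodMk contMDiff_const)).mdifferentiableAt (by simp)
  have hF : MDifferentiableAt ((𝓡 n).prod (𝓡 d)) (𝓡 n) (fun q : P × G => Q.act q.1 q.2)
      (Q.act p (g p), (g p)⁻¹ * g p) := Q.contMDiff_act.mdifferentiableAt (by simp)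
  have h1 : (fun q => Q.act q (g q)) = (fun q : P × G => Q.act q.1 q.2) ∘
      (fun q => (Q.act q (g p), (g p)⁻¹ * g q)) := by
    funext q
    show _ = Q.act (Q.act q (g p)) _
    rw [← Q.act_mul, mul_inv_cancel_left]
  have h2 := HasMFDerivAt.comp p hF.hasMFDerivAt (hR.hasMFDerivAt.prodMk hk.hasMFDerivAt)
  rw [← h1] at h2
  have h3 := congrArg (fun T : E n →L[ℝ] E n => T v) h2.mfderiv
  refine h3.trans ?_
  have h4 := mfderiv_prod_eq_add_apply hF
    (v := ((Q.dAct p (g p) v, manDeriv (fun q => (g p)⁻¹ * g q) p v) : E n × E d))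
  refine h4.trans ?_
  have h5 : manDeriv (fun z : P => Q.act z ((g p)⁻¹ * g p)) (Q.act p (g p)) =
      ContinuousLinearMap.id ℝ (E n) := by
    have : (fun z : P => Q.act z ((g p)⁻¹ * g p)) = id := by
      funext z; rw [hk1, Q.act_one]; rfl
    rw [this]
    exact mfderiv_id
  have h6 : manDeriv (fun z : G => Q.act (Q.act p (g p)) z) ((g p)⁻¹ * g p) =
      Q.vert (Q.act p (g p)) := by
    rw [hk1]; rfl
  exact congrArg₂ (fun (T : E n →L[ℝ] E n) (T' : E d →L[ℝ] E n) =>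
    T (Q.dAct p (g p) v) + T' (manDeriv (fun q => (g p)⁻¹ * g q) p v)) h5 h6

end BundleDeriv

/-! ### The infinitesimal action of the gauge group on connections -/

namespace YangMills

variable {n d : ℕ} {M P G : Type*}
  [TopologicalSpace M] [ChartedSpace (E 3) M]
  [TopologicalSpace P] [ChartedSpace (E n) P] [IsManifold (𝓡 n) ∞ P]
  [TopologicalSpace G] [ChartedSpace (E d) G] [Group G]

theorem conn_equivariant (S : YangMills n d M P G) (x : S.Conf) (p : P) (h : G) (v : E n) :
    S.conn x (S.Q.act p h) (S.Q.dAct p h v) = Ad h⁻¹ (S.conn x p v) := by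
  show S.A₀.val _ _ + x.1.1.val _ _ = Ad h⁻¹ (S.A₀.val p v + x.1.1.val p v)
  rw [S.isConnectionForm.1, x.1.2.1, map_add]

theorem conn_vert (S : YangMills n d M P G) (x : S.Conf) (p : P) (ζ : E d) :
    S.conn x p (S.Q.vert p ζ) = ζ := by
  show S.A₀.val _ _ + x.1.1.val _ _ = ζ
  rw [S.isConnectionForm.2, x.1.2.2, add_zero]

omit [IsManifold (𝓡 n) ∞ P] in
theorem funDeriv_zero (p : P) (v : E n) : funDeriv (fun _ : P => (0 : E d)) p v = 0 := by
  have h : funDeriv (fun _ : P => (0 : E d)) p = (0 : E n →L[ℝ] E d) := mfderiv_const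
  rw [h]; rfl

theorem three_le_l (S : YangMills n d M P G) : 3 ≤ S.l := S.two_lt_l

theorem basicForms_ext (S : YangMills n d M P G) {a b : S.BasicForms}
    (h : ∀ p v, a.1.val p v = b.1.val p v) : a = b :=
  Subtype.ext (SobolevForm.ext_val h)

theorem extChartAt_conf (S : YangMills n d M P G) (x y : S.Conf) :
    extChartAt S.IConf x y = (y.1, extChartAt (𝓡 d) x.2 y.2) := by
  rw [extChartAt_prod]
  rfl

theorem extChartAt_conf_symm (S : YangMills n d M P G) (x : S.Conf) (y : S.TConf) :
    (extChartAt S.IConf x).symm y = (y.1, (extChartAt (𝓡 d) x.2).symm y.2) := by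
  rw [extChartAt_prod]
  rfl

/-- The velocity of a curve in `𝒜`, read in the chart centred at its initial point. -/
theorem hasVelocity_iff (S : YangMills n d M P G) (c : ℝ → S.Conf) (X : S.TConf) :
    S.HasVelocity c X ↔ ContinuousAt c 0 ∧
      HasDerivAt (fun s => ((c s).1, extChartAt (𝓡 d) (c 0).2 (c s).2)) X 0 := by
  have e : writtenInExtChartAt 𝓘(ℝ, ℝ) S.IConf 0 c =
      fun s => ((c s).1, extChartAt (𝓡 d) (c 0).2 (c s).2) := by
    funext s
    exact S.extChartAt_conf (c 0) (c s)
  rw [hasDerivAt_iff_hasFDerivAt, ← hasFDerivWithinAt_univ]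
  show _ ∧ HasFDerivWithinAt (E := ℝ) (F := S.TConf) (writtenInExtChartAt 𝓘(ℝ, ℝ) S.IConf 0 c)
    (ContinuousLinearMap.toSpanSingleton ℝ X : ℝ →L[ℝ] S.TConf) (Set.range 𝓘(ℝ, ℝ)) _ ↔ _
  rw [e, ModelWithCorners.Boundaryless.range_eq_univ]
  rfl

theorem HasVelocity.hasDerivAt_fst {S : YangMills n d M P G} {c : ℝ → S.Conf} {X : S.TConf}
    (h : S.HasVelocity c X) : HasDerivAt (fun s => (c s).1) X.1 0 :=
  ((S.hasVelocity_iff c X).1 h).2.fst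

theorem HasVelocity.hasDerivAt_snd {S : YangMills n d M P G} {c : ℝ → S.Conf} {X : S.TConf}
    (h : S.HasVelocity c X) : HasDerivAt (fun s => extChartAt (𝓡 d) (c 0).2 (c s).2) X.2 0 :=
  ((S.hasVelocity_iff c X).1 h).2.snd

/-- Evaluation of the forms in `BasicForms` on a tangent vector. -/
def basicEval (S : YangMills n d M P G) (p : P) (v : E n) : S.BasicForms →L[ℝ] E d :=
  (SobolevForm.evalCLM S.C (S.l - 1) p v).comp S.BasicForms.subtypeL

theorem HasVelocity.hasDerivAt_conn {S : YangMills n d M P G} {c : ℝ → S.Conf} {X : S.TConf}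
    (h : S.HasVelocity c X) (p : P) (v : E n) :
    HasDerivAt (fun s => S.conn (c s) p v) (X.1.1.val p v) 0 :=
  ((S.basicEval p v).hasFDerivAt.comp_hasDerivAt 0 h.hasDerivAt_fst).const_add (S.A₀.val p v)

section Gauge

variable [LieGroup (𝓡 d) ∞ G]

omit [LieGroup (𝓡 d) ∞ G] in
theorem IsGauge.mdifferentiableAt {S : YangMills n d M P G} {g : P → G} (hg : S.IsGauge g) (p : P) :
    MDifferentiableAt (𝓡 n) (𝓡 d) g p :=
  hg.contMDiff.mdifferentiableAt (by
    have : S.l - 2 ≠ 0 := by have := S.two_lt_l; omega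
    exact_mod_cast this)

/-- The gauge transformation formula `φ^*A = Ad(g⁻¹) A + g⁻¹ dg`. -/
theorem IsGaugeImage.conn_eq {S : YangMills n d M P G} {g : P → G} {x x' : S.Conf}
    (h : S.IsGaugeImage g x x') (hg : S.IsGauge g) (p : P) (v : E n) :
    S.conn x' p v = Ad (g p)⁻¹ (S.conn x p v) + manDeriv (fun q => (g p)⁻¹ * g q) p v := by
  have h1 : S.conn x' p v = S.conn x (S.Q.act p (g p)) (manDeriv (fun q => S.Q.act q (g q)) p v) :=
    h.1 p v
  rw [h1, S.Q.manDeriv_act (hg.mdifferentiableAt p), map_add, S.conn_equivariant, S.conn_vert]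

omit [LieGroup (𝓡 d) ∞ G] in
theorem HasVelocityAtOne.exists_chart {S : YangMills n d M P G} {g : ℝ → P → G} {ξ : S.GaugeAlg}
    (h : S.HasVelocityAtOne g ξ) : ∃ u : ℝ → SobolevFun S.C S.l (E d),
      (∀ᶠ s in 𝓝 0, ∀ q, g s q ∈ (extChartAt (𝓡 d) (1 : G)).source ∧
        (u s).val q = extChartAt (𝓡 d) (1 : G) (g s q) - extChartAt (𝓡 d) (1 : G) 1) ∧
      (∀ q, (u 0).val q = 0) ∧ HasDerivAt u ξ.1 0 := by
  obtain ⟨h0, u, hu, hd⟩ := h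
  refine ⟨u, hu, fun q => ?_, hd⟩
  rw [(hu.self_of_nhds q).2, h0, sub_self]

/-- The derivative of `Ad(g_s(p)⁻¹) w` along a curve of gauge transformations with velocity `ξ`. -/
theorem HasVelocityAtOne.hasDerivAt_Ad_inv {S : YangMills n d M P G} {g : ℝ → P → G}
    {ξ : S.GaugeAlg} (h : S.HasVelocityAtOne g ξ) (p : P) (w : E d) :
    HasDerivAt (fun s => Ad (g s p)⁻¹ w) (-lieBr G (ξ.1.val p) w) 0 := by
  obtain ⟨u, hu, hu0, hd⟩ := h.exists_chart
  have h1 : HasDerivAt (fun s => extChartAt (𝓡 d) (1 : G) 1 + (u s).val p) (ξ.1.val p) 0 :=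
    ((SobolevFun.evalCLM S.C S.l p).hasFDerivAt.comp_hasDerivAt 0 hd).const_add _
  refine _root_.hasDerivAt_Ad_inv (y := fun s => extChartAt (𝓡 d) (1 : G) 1 + (u s).val p)
    ?_ h1 (by simp [hu0]) w
  filter_upwards [hu] with s hs
  rw [(hs p).2, add_sub_cancel, (extChartAt (𝓡 d) (1 : G)).left_inv (hs p).1]

/-- The derivative of `g_s⁻¹ dg_s` along a curve of gauge transformations with velocity `ξ` is
`dξ`. -/
theorem HasVelocityAtOne.hasDerivAt_logDeriv {S : YangMills n d M P G} {g : ℝ → P → G}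
    {ξ : S.GaugeAlg} (h : S.HasVelocityAtOne g ξ) (hg : ∀ s, S.IsGauge (g s)) (p : P) (v : E n) :
    HasDerivAt (fun s => manDeriv (fun q => (g s p)⁻¹ * g s q) p v) (funDeriv ξ.1.val p v) 0 := by
  obtain ⟨u, hu, hu0, hd⟩ := h.exists_chart
  set c := extChartAt (𝓡 d) (1 : G) 1 with hc
  have h1 : HasDerivAt (fun s => (c + (u s).val p, c)) (ξ.1.val p, (0 : E d)) 0 :=
    (((SobolevFun.evalCLM S.C S.l p).hasFDerivAt.comp_hasDerivAt 0 hd).const_add _).prodMk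
      (hasDerivAt_const 0 c)
  have h10 : (c + (u 0).val p, c) = (c, c) := by rw [hu0, add_zero]
  have hev : ∀ᶠ s in 𝓝 (0 : ℝ), DifferentiableAt ℝ (chartMul (1 : G)) (c + (u s).val p, c) := by
    have := eventually_differentiableAt_chartMul (d := d) (1 : G)
    rw [← hc, ← h10] at this
    exact h1.continuousAt.eventually this
  have h2 := (differentiableAt_fderiv_chartMul (d := d) (1 : G)).hasFDerivAt
  rw [← hc, ← h10] at h2
  have h3 := (h2.comp_hasDerivAt 0 h1).hasFDerivAt.clm_comp
    (hasFDerivAt_const (ContinuousLinearMap.inr ℝ (E d) (E d)) 0)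
  have h4 : HasDerivAt (fun s => funDeriv (u s).val p v) (funDeriv ξ.1.val p v) 0 :=
    (SobolevFun.funDerivCLM S.C S.three_le_l p v).hasFDerivAt.comp_hasDerivAt 0 hd
  have h5 := hasFDerivAt_of_clm_apply_eq h3 h4.hasFDerivAt
    (F := fun s => manDeriv (fun q => (g s p)⁻¹ * g s q) p v) (by
      ext1 w
      show fderiv ℝ (chartMul (1 : G)) (c + (u 0).val p, c) (0, w) = w
      rw [h10]
      exact fderiv_chartMul_base_right (1 : G) w) (by
      filter_upwards [hu, hev] with s hs hs'
      exact fderiv_chartMul_logDeriv ((hg s).mdifferentiableAt p) hs hs' v)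
  have h6 : (manDeriv (fun q => (g 0 p)⁻¹ * g 0 q) p : E n →L[ℝ] E d) v = 0 := by
    have : (fun q => (g 0 p)⁻¹ * g 0 q) = fun _ => 1 := by
      funext q; rw [h.1, h.1]; simp
    rw [this]
    have h7 : (manDeriv (fun _ : P => (1 : G)) p : E n →L[ℝ] E d) = 0 := mfderiv_const
    rw [h7]; rfl
  have h7 := h5.hasDerivAt
  rw [h6] at h7
  simpa using h7

/-- The formula `d_A ξ = dξ + [A, ξ]` for fundamental vector fields, obtained by differentiating the
gauge transformation formula at the identity. -/
theorem IsFundamental.val_fst {S : YangMills n d M P G} {ξ : S.GaugeAlg} {K : S.Conf → S.TConf}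
    (h : S.IsFundamental ξ K) (x : S.Conf) (p : P) (v : E n) :
    (K x).1.1.val p v = funDeriv ξ.1.val p v + lieBr G (S.conn x p v) (ξ.1.val p) := by
  obtain ⟨g, hg, hv, hK⟩ := h
  obtain ⟨c, hc, hcv⟩ := hK x
  have h1 := hcv.hasDerivAt_conn p v
  have h2 := (hv.hasDerivAt_Ad_inv p (S.conn x p v)).add (hv.hasDerivAt_logDeriv hg p v)
  have h3 := h2.congr_of_eventuallyEq (f₁ := fun s => S.conn (c s) p v)
    (Filter.Eventually.of_forall fun s => (hc s).conn_eq (hg s) p v)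
  rw [h1.unique h3, lieBr_skew, neg_neg, add_comm]

omit [LieGroup (𝓡 d) ∞ G] in
/-- By definition `κ(ξ)` is zero if `ξ` has no fundamental vector field. Since `η(κ(ξ)) = ξ`, this
can happen only for `ξ = 0`, where the formulas for `κ(ξ)` hold all the same. -/
theorem isFundamental_kappa_or {S : YangMills n d M P G} {η : S.Conf → S.TConf →L[ℝ] S.GaugeAlg}
    (hη : S.IsGaugeFixingConnection η) (ξ : S.GaugeAlg) :
    S.IsFundamental ξ (S.kappa ξ) ∨ (ξ = 0 ∧ S.kappa ξ = 0) := by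
  by_cases h : ∃ K, S.IsFundamental ξ K
  · left
    unfold kappa
    rw [dif_pos h]
    exact h.choose_spec
  · right
    have h0 : S.kappa ξ = 0 := dif_neg h
    refine ⟨?_, h0⟩
    have h1 := hη.kappa ξ (0, 1)
    rw [h0] at h1
    rw [← h1]
    exact map_zero _

/-- The formula for the infinitesimal action on connections, `d_A ξ = dξ + [A, ξ]`. -/
theorem kappa_val_fst {S : YangMills n d M P G} {η : S.Conf → S.TConf →L[ℝ] S.GaugeAlg}
    (hη : S.IsGaugeFixingConnection η) (ξ : S.GaugeAlg) (x : S.Conf) (p : P) (v : E n) :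
    (S.kappa ξ x).1.1.val p v = funDeriv ξ.1.val p v + lieBr G (S.conn x p v) (ξ.1.val p) := by
  rcases isFundamental_kappa_or hη ξ with h | ⟨rfl, h⟩
  · exact h.val_fst x p v
  · rw [h]
    show (0 : E d) = funDeriv (fun _ : P => (0 : E d)) p v + lieBr G (S.conn x p v) 0
    rw [funDeriv_zero, lieBr_zero_right, add_zero]

/-- The derivative of an equivariant function in a vertical direction. -/
theorem funDeriv_vert (S : YangMills n d M P G) (ξ : S.GaugeAlg) (p : P) (ζ : E d) :
    funDeriv ξ.1.val p (S.Q.vert p ζ) = -lieBr G ζ (ξ.1.val p) := by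
  have h1 : HasMFDerivAt (𝓡 d) 𝓘(ℝ, E d) (fun h : G => Ad h⁻¹ (ξ.1.val p)) 1
      (-lieBrCLM G (ξ.1.val p) : E d →L[ℝ] E d) := hasMFDerivAt_Ad_inv _
  have hact : MDifferentiableAt (𝓡 d) (𝓡 n) (fun h : G => S.Q.act p h) 1 :=
    (S.Q.contMDiff_act.comp (contMDiff_const.prodMk contMDiff_id)).mdifferentiableAt (by simp)
  have hξ : MDifferentiableAt (𝓡 n) 𝓘(ℝ, E d) ξ.1.val (S.Q.act p 1) :=
    ξ.1.mdifferentiableAt S.three_le_l _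
  have h2 := HasMFDerivAt.comp (1 : G) hξ.hasMFDerivAt hact.hasMFDerivAt
  have h3 : ξ.1.val ∘ (fun h : G => S.Q.act p h) = fun h : G => Ad h⁻¹ (ξ.1.val p) :=
    funext fun h => ξ.2 p h
  rw [h3] at h2
  have h4 := h2.mfderiv.symm.trans h1.mfderiv
  have h5 : (funDeriv ξ.1.val (S.Q.act p 1)).comp (S.Q.vert p) = -lieBrCLM G (ξ.1.val p) := h4
  rw [S.Q.act_one] at h5
  have h6 := congrArg (fun T : E d →L[ℝ] E d => T ζ) h5
  rw [← lieBrCLM_apply]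
  exact h6

end Gauge

end YangMills

/-! ### Forms in the charts of `𝒜 × P` -/

theorem tendsto_line {B : Type*} [NormedAddCommGroup B] [NormedSpace ℝ B] (c U : B) :
    Filter.Tendsto (fun t : ℝ => c + t • U) (𝓝 0) (𝓝 c) := by
  have h : ContinuousAt (fun t : ℝ => c + t • U) 0 := by fun_prop
  simpa [ContinuousAt] using h

namespace YangMills

variable {n d : ℕ} {M P G : Type*}
  [TopologicalSpace M] [ChartedSpace (E 3) M]
  [TopologicalSpace P] [ChartedSpace (E n) P] [IsManifold (𝓡 n) ∞ P]
  [TopologicalSpace G] [ChartedSpace (E d) G] [Group G]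

theorem extChartAt_tot (S : YangMills n d M P G) (z w : S.Conf × P) :
    extChartAt S.ITot z w = (extChartAt S.IConf z.1 w.1, extChartAt (𝓡 n) z.2 w.2) := by
  rw [extChartAt_prod]
  rfl

theorem extChartAt_tot_symm (S : YangMills n d M P G) (z : S.Conf × P) (y : S.TConf × E n) :
    (extChartAt S.ITot z).symm y =
      ((extChartAt S.IConf z.1).symm y.1, (extChartAt (𝓡 n) z.2).symm y.2) := by
  rw [extChartAt_prod]
  rfl

/-- The derivative at `y` of the inverse of the chart of `𝒜` centred at `x`. -/
def confSymmDeriv (S : YangMills n d M P G) (x : S.Conf) (y : S.TConf) : S.TConf →L[ℝ] S.TConf :=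
  (mfderiv 𝓘(ℝ, S.TConf) S.IConf (extChartAt S.IConf x).symm y : S.TConf →L[ℝ] S.TConf)

section Lie
variable [LieGroup (𝓡 d) ∞ G]

theorem hasMFDerivAt_confSymm (S : YangMills n d M P G) (x : S.Conf) {y : S.TConf}
    (hy : y.2 ∈ (extChartAt (𝓡 d) x.2).target) :
    HasMFDerivAt 𝓘(ℝ, S.TConf) S.IConf (extChartAt S.IConf x).symm y
      ((ContinuousLinearMap.fst ℝ S.BasicForms (E d)).prod
        ((symmDeriv x.2 y.2).comp (ContinuousLinearMap.snd ℝ S.BasicForms (E d))) :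
        S.TConf →L[ℝ] S.TConf) := by
  have h1 : HasMFDerivAt 𝓘(ℝ, S.TConf) 𝓘(ℝ, S.BasicForms) (fun y : S.TConf => y.1) y
      (ContinuousLinearMap.fst ℝ S.BasicForms (E d)) := hasFDerivAt_fst.hasMFDerivAt
  have h2 : HasMFDerivAt 𝓘(ℝ, S.TConf) 𝓘(ℝ, E d) (fun y : S.TConf => y.2) y
      (ContinuousLinearMap.snd ℝ S.BasicForms (E d)) := hasFDerivAt_snd.hasMFDerivAt
  have h3 : HasMFDerivAt 𝓘(ℝ, E d) (𝓡 d) (extChartAt (𝓡 d) x.2).symm y.2 (symmDeriv x.2 y.2) :=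
    (mdifferentiableAt_extChartAt_symm x.2 hy).hasMFDerivAt
  have h4 := h1.prodMk (HasMFDerivAt.comp y h3 h2)
  have h5 : (extChartAt S.IConf x).symm =
      fun y : S.TConf => (y.1, (extChartAt (𝓡 d) x.2).symm y.2) :=
    funext (S.extChartAt_conf_symm x)
  rw [h5]
  exact h4

theorem confSymmDeriv_apply (S : YangMills n d M P G) (x : S.Conf) {y : S.TConf}
    (hy : y.2 ∈ (extChartAt (𝓡 d) x.2).target) (W : S.TConf) :
    S.confSymmDeriv x y W = (W.1, symmDeriv x.2 y.2 W.2) :=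
  congrArg (fun T : S.TConf →L[ℝ] S.TConf => T W) (S.hasMFDerivAt_confSymm x hy).mfderiv

theorem confSymmDeriv_self (S : YangMills n d M P G) (x : S.Conf) :
    S.confSymmDeriv x (extChartAt S.IConf x x) = ContinuousLinearMap.id ℝ S.TConf := by
  refine ContinuousLinearMap.ext fun W => ?_
  rw [S.confSymmDeriv_apply x (by rw [extChartAt_conf]; exact mem_extChartAt_target _),
    extChartAt_conf, symmDeriv_self]
  rfl

/-- In a chart of `𝒜 × P`, a one-form is evaluated on constant vector fields componentwise. -/
theorem localRep_tot (S : YangMills n d M P G) (α : S.OneForm) (z : S.Conf × P)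
    {y : S.TConf × E n} (hy : y.1.2 ∈ (extChartAt (𝓡 d) z.1.2).target)
    (hy' : y.2 ∈ (extChartAt (𝓡 n) z.2).target) (W : S.TConf × E n) :
    localRep S.ITot α z y W =
      α ((extChartAt S.IConf z.1).symm y.1, (extChartAt (𝓡 n) z.2).symm y.2)
        (S.confSymmDeriv z.1 y.1 W.1, symmDeriv z.2 y.2 W.2) := by
  have h1 : HasMFDerivAt 𝓘(ℝ, S.TConf × E n) 𝓘(ℝ, S.TConf) (fun y : S.TConf × E n => y.1) y
      (ContinuousLinearMap.fst ℝ S.TConf (E n)) := hasFDerivAt_fst.hasMFDerivAt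
  have h2 : HasMFDerivAt 𝓘(ℝ, S.TConf × E n) 𝓘(ℝ, E n) (fun y : S.TConf × E n => y.2) y
      (ContinuousLinearMap.snd ℝ S.TConf (E n)) := hasFDerivAt_snd.hasMFDerivAt
  have h3 : HasMFDerivAt 𝓘(ℝ, S.TConf) S.IConf (extChartAt S.IConf z.1).symm y.1
      (S.confSymmDeriv z.1 y.1) :=
    (S.hasMFDerivAt_confSymm z.1 hy).mdifferentiableAt.hasMFDerivAt
  have h4 : HasMFDerivAt 𝓘(ℝ, E n) (𝓡 n) (extChartAt (𝓡 n) z.2).symm y.2 (symmDeriv z.2 y.2) :=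
    (mdifferentiableAt_extChartAt_symm z.2 hy').hasMFDerivAt
  have h5 := (HasMFDerivAt.comp y h3 h1).prodMk (HasMFDerivAt.comp y h4 h2)
  have h6 : (extChartAt S.ITot z).symm = fun y : S.TConf × E n =>
      ((extChartAt S.IConf z.1).symm y.1, (extChartAt (𝓡 n) z.2).symm y.2) :=
    funext (S.extChartAt_tot_symm z)
  unfold localRep
  rw [h6]
  exact congrArg (fun T : S.TConf × E n →L[ℝ] S.TConf × E n =>
    α ((extChartAt S.IConf z.1).symm y.1, (extChartAt (𝓡 n) z.2).symm y.2) (T W)) h5.mfderiv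

omit [LieGroup (𝓡 d) ∞ G] in
theorem eventually_chart_tot (S : YangMills n d M P G) (z : S.Conf × P) :
    ∀ᶠ y : S.TConf × E n in 𝓝 (extChartAt S.ITot z z),
      y.1.2 ∈ (extChartAt (𝓡 d) z.1.2).target ∧ y.2 ∈ (extChartAt (𝓡 n) z.2).target := by
  rw [extChartAt_tot, extChartAt_conf]
  have h1 : ContinuousAt (fun y : S.TConf × E n => y.1.2)
      (((z.1.1, extChartAt (𝓡 d) z.1.2 z.1.2), extChartAt (𝓡 n) z.2 z.2) : S.TConf × E n) := by
    fun_prop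
  have h2 : ContinuousAt (fun y : S.TConf × E n => y.2)
      (((z.1.1, extChartAt (𝓡 d) z.1.2 z.1.2), extChartAt (𝓡 n) z.2 z.2) : S.TConf × E n) := by
    fun_prop
  exact (h1.eventually ((isOpen_extChartAt_target z.1.2).mem_nhds (mem_extChartAt_target _))).and
    (h2.eventually ((isOpen_extChartAt_target z.2).mem_nhds (mem_extChartAt_target _)))

omit [LieGroup (𝓡 d) ∞ G] in
theorem chartDeriv_congr (S : YangMills n d M P G) {α β : S.OneForm} {z : S.Conf × P}
    {W W' : S.TConf × E n}
    (h : ∀ᶠ y in 𝓝 (extChartAt S.ITot z z), localRep S.ITot α z y W = localRep S.ITot β z y W')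
    (U : S.TConf × E n) : chartDeriv S.ITot α z U W = chartDeriv S.ITot β z U W' :=
  Filter.EventuallyEq.lineDeriv_eq h

/-- Two one-forms which agree on vectors with the components of `W` and `W'` have the same
derivatives there. The maps `T` and `T'` stand for the derivatives of the charts of the two
factors: passing to a chart preserves the components of a vector. -/
theorem chartDeriv_congr_value (S : YangMills n d M P G) {α β : S.OneForm} {W W' : S.TConf × E n}
    (h : ∀ (z' : S.Conf × P) (T : S.TConf →L[ℝ] S.TConf) (T' : E n →L[ℝ] E n),
      α z' (T W.1, T' W.2) = β z' (T W'.1, T' W'.2))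
    (z : S.Conf × P) (U : S.TConf × E n) :
    chartDeriv S.ITot α z U W = chartDeriv S.ITot β z U W' := by
  refine S.chartDeriv_congr ?_ U
  filter_upwards [S.eventually_chart_tot z] with y hy
  rw [S.localRep_tot α z hy.1 hy.2, S.localRep_tot β z hy.1 hy.2]
  exact h _ _ _

theorem chartDeriv_AU_congr (S : YangMills n d M P G) (z : S.Conf × P) (U : S.TConf × E n)
    {W W' : S.TConf × E n} (h : W.2 = W'.2) :
    chartDeriv S.ITot S.AU z U W = chartDeriv S.ITot S.AU z U W' :=
  S.chartDeriv_congr_value (fun z' T T' => by rw [h]; rfl) z U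

theorem chartDeriv_extConn_fst (S : YangMills n d M P G) (η : S.Conf → S.TConf →L[ℝ] S.GaugeAlg)
    (z : S.Conf × P) (U : S.TConf × E n) (Y : S.TConf) :
    chartDeriv S.ITot (S.extConn η) z U (Y, 0) = chartDeriv S.ITot (S.etaForm η) z U (Y, 0) := by
  refine S.chartDeriv_congr_value (fun z' T T' => ?_) z U
  show S.conn z'.1 z'.2 (T' 0) + _ = _
  rw [map_zero, map_zero, zero_add]

theorem chartDeriv_extConn_snd (S : YangMills n d M P G) (η : S.Conf → S.TConf →L[ℝ] S.GaugeAlg)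
    (z : S.Conf × P) (U : S.TConf × E n) (w : E n) :
    chartDeriv S.ITot (S.extConn η) z U (0, w) = chartDeriv S.ITot S.AU z U (0, w) := by
  refine S.chartDeriv_congr_value (fun z' T T' => ?_) z U
  show _ + (η z'.1 (T 0)).1.val z'.2 = _
  rw [map_zero, map_zero]
  exact add_zero _

/-! ### The derivatives of the universal family of connections -/

/-- In a chart, `A^U` is affine in the connection. -/
theorem localRep_AU (S : YangMills n d M P G) (z : S.Conf × P) {y : S.TConf × E n}
    (hy : y.1.2 ∈ (extChartAt (𝓡 d) z.1.2).target)
    (hy' : y.2 ∈ (extChartAt (𝓡 n) z.2).target) (W : S.TConf × E n) :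
    localRep S.ITot S.AU z y W =
      localRep (𝓡 n) (fun q w => S.conn z.1 q w) z.2 y.2 W.2 +
      localRep (𝓡 n) (fun q w => (y.1.1 - z.1.1).1.val q w) z.2 y.2 W.2 := by
  rw [S.localRep_tot _ z hy hy', extChartAt_conf_symm]
  show S.A₀.val _ _ + y.1.1.1.val _ _ = (S.A₀.val _ _ + z.1.1.1.val _ _) +
    (y.1.1.1.val _ _ - z.1.1.1.val _ _)
  rw [add_assoc, add_sub_cancel]
  rfl

/-- The derivative of `A^U` along a line. Only the fixed connection has to be differentiable: its
displacement along the line is `t` times a form, of which only the continuity is used. -/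
theorem hasLineDerivAt_AU (S : YangMills n d M P G) (z : S.Conf × P) (U W : S.TConf × E n) {D : E d}
    (h : HasLineDerivAt ℝ (fun y => localRep (𝓡 n) (fun q w => S.conn z.1 q w) z.2 y W.2) D
      (extChartAt (𝓡 n) z.2 z.2) U.2) :
    HasLineDerivAt ℝ (fun y => localRep S.ITot S.AU z y W) (D + U.1.1.1.val z.2 W.2)
      (extChartAt S.ITot z z) U := by
  have hcont : Filter.Tendsto (fun t : ℝ => localRep (𝓡 n) (fun q w => U.1.1.1.val q w) z.2
      (extChartAt (𝓡 n) z.2 z.2 + t • U.2) W.2) (𝓝 0)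
      (𝓝 (localRep (𝓡 n) (fun q w => U.1.1.1.val q w) z.2 (extChartAt (𝓡 n) z.2 z.2) W.2)) :=
    (U.1.1.1.contDiffAt_localRep z.2 W.2).continuousAt.tendsto.comp (tendsto_line _ U.2)
  have hval : localRep (𝓡 n) (fun q w => U.1.1.1.val q w) z.2 (extChartAt (𝓡 n) z.2 z.2) W.2 =
      U.1.1.1.val z.2 W.2 := by
    show U.1.1.1.val _ (symmDeriv z.2 _ W.2) = _
    rw [symmDeriv_self, extChartAt_to_inv]
    rfl
  have hmul : HasDerivAt (fun t : ℝ => t • localRep (𝓡 n) (fun q w => U.1.1.1.val q w) z.2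
      (extChartAt (𝓡 n) z.2 z.2 + t • U.2) W.2) (U.1.1.1.val z.2 W.2) 0 := by
    rw [hasDerivAt_iff_tendsto_slope_zero]
    rw [hval] at hcont
    refine (hcont.mono_left nhdsWithin_le_nhds).congr' ?_
    filter_upwards [self_mem_nhdsWithin] with t ht
    have ht' : t ≠ 0 := ht
    rw [zero_smul, sub_zero, zero_add, smul_smul, inv_mul_cancel₀ ht', one_smul]
  have h4 := HasDerivAt.add h hmul
  refine h4.congr_of_eventuallyEq ?_
  filter_upwards [(tendsto_line _ U).eventually (S.eventually_chart_tot z)] with t ht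
  rw [S.localRep_AU z ht.1 ht.2]
  have e2 : (extChartAt S.ITot z z + t • U).2 = extChartAt (𝓡 n) z.2 z.2 + t • U.2 := by
    rw [extChartAt_tot]; rfl
  have e1 : (extChartAt S.ITot z z + t • U).1.1 - z.1.1 = t • U.1.1 := by
    rw [extChartAt_tot, extChartAt_conf]
    exact add_sub_cancel_left _ _
  rw [e1, e2]
  rfl

/-- The derivative of `A^U` in the direction `X` of `𝒜` is the form `X`. No regularity of the
connection beyond continuity is needed. -/
theorem chartDeriv_AU_conf (S : YangMills n d M P G) (z : S.Conf × P) (X : S.TConf)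
    (W : S.TConf × E n) : chartDeriv S.ITot S.AU z (X, 0) W = X.1.1.val z.2 W.2 := by
  have h : HasLineDerivAt ℝ (fun y => localRep (𝓡 n) (fun q w => S.conn z.1 q w) z.2 y W.2) 0
      (extChartAt (𝓡 n) z.2 z.2) (0 : E n) := by
    unfold HasLineDerivAt
    simpa using hasDerivAt_const (0 : ℝ) _
  have h1 := (S.hasLineDerivAt_AU z (X, 0) W h).lineDeriv
  rw [zero_add] at h1
  exact h1

omit [LieGroup (𝓡 d) ∞ G] in
theorem connDifferentiableAt_of_three_lt (S : YangMills n d M P G) (hl : 3 < S.l) (x : S.Conf)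
    (p : P) : S.ConnDifferentiableAt x p := by
  intro v
  have hk : ((((S.l - 1) - 2 : ℕ) : ℕ∞) : WithTop ℕ∞) ≠ 0 := by
    have : S.l - 1 - 2 ≠ 0 := by omega
    exact_mod_cast this
  exact ((S.A₀.contDiffAt_localRep p v).differentiableAt hk).add
    ((x.1.1.contDiffAt_localRep p v).differentiableAt hk)

theorem hasLineDerivAt_AU_of_connDifferentiableAt (S : YangMills n d M P G) (z : S.Conf × P)
    (hz : S.ConnDifferentiableAt z.1 z.2) (U W : S.TConf × E n) :
    HasLineDerivAt ℝ (fun y => localRep S.ITot S.AU z y W)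
      (chartDeriv S.ITot S.AU z (U.1, 0) W + chartDeriv S.ITot S.AU z (0, U.2) W)
      (extChartAt S.ITot z z) U := by
  have h := (hz W.2).hasFDerivAt.hasLineDerivAt U.2
  have h1 := S.hasLineDerivAt_AU z U W h
  have h2 := (S.hasLineDerivAt_AU z (0, U.2) W h).lineDeriv
  have h3 : chartDeriv S.ITot S.AU z (0, U.2) W = _ := h2
  rw [h3, chartDeriv_AU_conf]
  have h4 : ((0, U.2) : S.TConf × E n).1.1.1.val z.2 W.2 = 0 := rfl
  rw [h4, add_zero, add_comm]
  exact h1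

end Lie

/-! ### The derivatives of the form `η` -/

/-- The one-form `η` in the chart of `𝒜` centred at `x`. -/
def etaRep (S : YangMills n d M P G) (η : S.Conf → S.TConf →L[ℝ] S.GaugeAlg) (x : S.Conf)
    (y : S.TConf) : S.TConf →L[ℝ] S.GaugeAlg :=
  (η ((extChartAt S.IConf x).symm y)).comp (S.confSymmDeriv x y)

/-- The derivative at `x` of `η` in the chart of `𝒜` centred at `x`. -/
def etaDeriv (S : YangMills n d M P G) (η : S.Conf → S.TConf →L[ℝ] S.GaugeAlg) (x : S.Conf) :
    S.TConf →L[ℝ] S.TConf →L[ℝ] S.GaugeAlg :=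
  fderiv ℝ (S.etaRep η x) (extChartAt S.IConf x x)

/-- Evaluation of the Lie algebra of the gauge group at a point. -/
def gaugeEval (S : YangMills n d M P G) (p : P) : S.GaugeAlg →L[ℝ] E d :=
  (SobolevFun.evalCLM S.C S.l p).comp S.GaugeAlg.subtypeL

theorem gaugeEval_apply (S : YangMills n d M P G) (p : P) (ξ : S.GaugeAlg) :
    S.gaugeEval p ξ = ξ.1.val p := rfl

theorem IsGaugeFixingConnection.hasFDerivAt_etaRep {S : YangMills n d M P G}
    {η : S.Conf → S.TConf →L[ℝ] S.GaugeAlg} (hη : S.IsGaugeFixingConnection η) (x : S.Conf) :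
    HasFDerivAt (S.etaRep η x) (S.etaDeriv η x) (extChartAt S.IConf x x) := by
  have h1 : (extChartAt S.IConf x).target ∈ 𝓝 (extChartAt S.IConf x x) :=
    extChartAt_target_mem_nhds x
  exact (((hη.smooth x).contDiffAt h1).differentiableAt (by simp)).hasFDerivAt

variable [LieGroup (𝓡 d) ∞ G]

theorem etaRep_self (S : YangMills n d M P G) (η : S.Conf → S.TConf →L[ℝ] S.GaugeAlg)
    (x : S.Conf) : S.etaRep η x (extChartAt S.IConf x x) = η x := by
  unfold etaRep
  rw [confSymmDeriv_self, extChartAt_to_inv]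
  rfl

/-- The derivative of `η(W)(p)` along a line in `𝒜 × P`: the class `L²_l` controls the values of a
function uniformly, so that the point of evaluation may move. -/
theorem hasLineDerivAt_etaForm {S : YangMills n d M P G}
    {η : S.Conf → S.TConf →L[ℝ] S.GaugeAlg} (hη : S.IsGaugeFixingConnection η) (z : S.Conf × P)
    (U W : S.TConf × E n) :
    HasLineDerivAt ℝ (fun y => localRep S.ITot (S.etaForm η) z y W)
      ((S.etaDeriv η z.1 U.1 W.1).1.val z.2 + funDeriv (η z.1 W.1).1.val z.2 U.2)
      (extChartAt S.ITot z z) U := by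
  set x := z.1
  set p := z.2
  set q : ℝ → P := fun t => (extChartAt (𝓡 n) p).symm (extChartAt (𝓡 n) p p + t • U.2) with hq
  set Ξ : ℝ → S.GaugeAlg := fun t => S.etaRep η x (extChartAt S.IConf x x + t • U.1) W.1 with hΞ
  have hΞ0 : Ξ 0 = η x W.1 := by simp only [hΞ, zero_smul, add_zero, etaRep_self]
  have hΞd : HasDerivAt Ξ (S.etaDeriv η x U.1 W.1) 0 := by
    have h1 := ((hη.hasFDerivAt_etaRep x).clm_apply (hasFDerivAt_const W.1 _)).hasLineDerivAt U.1
    refine HasDerivAt.congr_deriv h1 ?_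
    simp
  -- the moving point
  have hfix : HasDerivAt (fun t => (η x W.1).1.val (q t)) (funDeriv (η x W.1).1.val p U.2) 0 := by
    have h1 : HasMFDerivAt (𝓡 n) 𝓘(ℝ, E d) (η x W.1).1.val p (funDeriv (η x W.1).1.val p) :=
      ((η x W.1).1.mdifferentiableAt S.three_le_l p).hasMFDerivAt
    have h2 : HasFDerivAt (fun y => (η x W.1).1.val ((extChartAt (𝓡 n) p).symm y))
        (funDeriv (η x W.1).1.val p) (extChartAt (𝓡 n) p p) := by
      have h3 : HasFDerivWithinAt (E := E n) (F := E d)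
        (fun y => (η x W.1).1.val ((extChartAt (𝓡 n) p).symm y))
        (funDeriv (η x W.1).1.val p) (Set.range (𝓡 n)) (extChartAt (𝓡 n) p p) := h1.2
      rwa [ModelWithCorners.Boundaryless.range_eq_univ, hasFDerivWithinAt_univ] at h3
    exact h2.hasLineDerivAt U.2
  -- the remaining difference, of which the derivative is evaluated at a moving point
  have hrem :
      HasDerivAt (fun t => (Ξ t - Ξ 0).1.val (q t)) ((S.etaDeriv η x U.1 W.1).1.val p) 0 := by
    rw [hasDerivAt_iff_tendsto_slope_zero] at hΞd ⊢
    have hqc : Filter.Tendsto q (𝓝[≠] 0) (𝓝 p) := by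
      have h1 := (continuousAt_extChartAt_symm (I := 𝓡 n) p).tendsto
      rw [extChartAt_to_inv] at h1
      exact (h1.comp (tendsto_line _ U.2)).mono_left nhdsWithin_le_nhds
    have hA : Filter.Tendsto (fun t => (S.etaDeriv η x U.1 W.1).1.val (q t)) (𝓝[≠] 0)
        (𝓝 ((S.etaDeriv η x U.1 W.1).1.val p)) :=
      ((S.etaDeriv η x U.1 W.1).1.contMDiff.continuous.tendsto p).comp hqc
    have hB : Filter.Tendsto (fun t : ℝ => (t⁻¹ • (Ξ (0 + t) - Ξ 0) -
        S.etaDeriv η x U.1 W.1).1.val (q t)) (𝓝[≠] 0) (𝓝 0) := by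
      have h1 := (tendsto_sub_nhds_zero_iff.2 hΞd).norm
      rw [norm_zero] at h1
      exact squeeze_zero_norm (fun t => SobolevFun.norm_val_le _ _) h1
    have hC := hB.add hA
    rw [zero_add] at hC
    refine hC.congr fun t => ?_
    show t⁻¹ • ((Ξ (0 + t)).1.val (q t) - (Ξ 0).1.val (q t)) -
      (S.etaDeriv η x U.1 W.1).1.val (q t) + (S.etaDeriv η x U.1 W.1).1.val (q t) =
      t⁻¹ • ((Ξ (0 + t) - Ξ 0).1.val (q (0 + t)) -
        ((Ξ 0).1.val (q 0) - (Ξ 0).1.val (q 0)))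
    rw [sub_add_cancel, sub_self, sub_zero]
    simp only [zero_add]
    rfl
  refine (hrem.add hfix).congr_of_eventuallyEq ?_
  filter_upwards [(tendsto_line _ U).eventually (S.eventually_chart_tot z)] with t ht
  rw [S.localRep_tot _ z ht.1 ht.2, ← hΞ0]
  have e2 : (extChartAt S.ITot z z + t • U).2 = extChartAt (𝓡 n) p p + t • U.2 := by
    rw [extChartAt_tot]; rfl
  have e1 : (extChartAt S.ITot z z + t • U).1 = extChartAt S.IConf x x + t • U.1 := by
    rw [extChartAt_tot]; rfl
  rw [e1, e2]
  show (Ξ t).1.val (q t) = ((Ξ t).1.val (q t) - (Ξ 0).1.val (q t)) + (Ξ 0).1.val (q t)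
  rw [sub_add_cancel]

theorem chartDeriv_etaForm {S : YangMills n d M P G}
    {η : S.Conf → S.TConf →L[ℝ] S.GaugeAlg} (hη : S.IsGaugeFixingConnection η) (z : S.Conf × P)
    (U W : S.TConf × E n) :
    chartDeriv S.ITot (S.etaForm η) z U W =
      (S.etaDeriv η z.1 U.1 W.1).1.val z.2 + funDeriv (η z.1 W.1).1.val z.2 U.2 :=
  (hasLineDerivAt_etaForm hη z U W).lineDeriv

end YangMills

/-! ### Left translations in the charts of the group -/

section Translations

variable {d : ℕ} {G : Type*} [TopologicalSpace G] [ChartedSpace (E d) G] [Group G]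
  [LieGroup (𝓡 d) ∞ G]

theorem lieBr_smul_left (c : ℝ) (v w : E d) : lieBr G (c • v) w = c • lieBr G v w := by
  rw [← lieBrCLM_apply, map_smul, lieBrCLM_apply]

/-- A curve is differentiable if it is so in a chart. -/
theorem hasMFDerivAt_curve_of_chart {h : G} {f : ℝ → G} {y : ℝ → E d} {y' : E d} {b : E d}
    (hy : HasDerivAt y y' 0) (hb : y 0 = b) (ht : b ∈ (extChartAt (𝓡 d) h).target)
    (hf : ∀ᶠ t in 𝓝 0, f t = (extChartAt (𝓡 d) h).symm (y t)) :
    HasMFDerivAt 𝓘(ℝ, ℝ) (𝓡 d) f 0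
      (ContinuousLinearMap.toSpanSingleton ℝ (symmDeriv h b y') : ℝ →L[ℝ] E d) := by
  subst hb
  have h1 : HasMFDerivAt 𝓘(ℝ, E d) (𝓡 d) (extChartAt (𝓡 d) h).symm (y 0) (symmDeriv h (y 0)) :=
    (mdifferentiableAt_extChartAt_symm h ht).hasMFDerivAt
  have h2 : HasMFDerivAt 𝓘(ℝ, ℝ) 𝓘(ℝ, E d) y 0 (ContinuousLinearMap.toSpanSingleton ℝ y') :=
    hy.hasFDerivAt.hasMFDerivAt
  have h3 := (HasMFDerivAt.comp (0 : ℝ) h1 h2).congr_of_eventuallyEq (f₁ := f) hf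
  refine h3.congr_mfderiv ?_
  show (symmDeriv h (y 0)).comp (ContinuousLinearMap.toSpanSingleton ℝ y') =
    (ContinuousLinearMap.toSpanSingleton ℝ (symmDeriv h (y 0) y') : ℝ →L[ℝ] E d)
  ext
  simp

/-- The velocity of the left translate by `k` of the coordinate line through `h` in the
direction `v`. -/
theorem hasMFDerivAt_mul_line {h k : G} (v : E d) (hk : k ∈ (extChartAt (𝓡 d) (1 : G)).source)
    (hkh : k * h ∈ (extChartAt (𝓡 d) h).source)
    (hd : DifferentiableAt ℝ (chartMul h) (extChartAt (𝓡 d) (1 : G) k, extChartAt (𝓡 d) h h)) :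
    HasMFDerivAt 𝓘(ℝ, ℝ) (𝓡 d)
      (fun t : ℝ => k * (extChartAt (𝓡 d) h).symm (extChartAt (𝓡 d) h h + t • v)) 0
      (ContinuousLinearMap.toSpanSingleton ℝ (symmDeriv h (extChartAt (𝓡 d) h (k * h))
        (fderiv ℝ (chartMul h) (extChartAt (𝓡 d) (1 : G) k, extChartAt (𝓡 d) h h) (0, v))) :
        ℝ →L[ℝ] E d) := by
  have hline : HasDerivAt (fun t : ℝ => (extChartAt (𝓡 d) (1 : G) k, extChartAt (𝓡 d) h h + t • v))
      ((0 : E d), v) 0 := by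
    refine (hasDerivAt_const _ _).prodMk ?_
    simpa using ((hasDerivAt_id (0 : ℝ)).smul_const v).const_add (extChartAt (𝓡 d) h h)
  have hd' : HasFDerivAt (chartMul h)
      (fderiv ℝ (chartMul h) (extChartAt (𝓡 d) (1 : G) k, extChartAt (𝓡 d) h h))
      (extChartAt (𝓡 d) (1 : G) k, extChartAt (𝓡 d) h h + (0 : ℝ) • v) := by
    rw [zero_smul, add_zero]
    exact hd.hasFDerivAt
  refine hasMFDerivAt_curve_of_chart
    (HasFDerivAt.comp_hasDerivAt (f := fun t : ℝ => (extChartAt (𝓡 d) (1 : G) k,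
      extChartAt (𝓡 d) h h + t • v)) 0 hd' hline) ?_
    ((extChartAt (𝓡 d) h).map_source hkh) ?_
  · show extChartAt (𝓡 d) h ((extChartAt (𝓡 d) (1 : G)).symm _ * (extChartAt (𝓡 d) h).symm
      (extChartAt (𝓡 d) h h + (0 : ℝ) • v)) = _
    rw [zero_smul, add_zero, extChartAt_to_inv, (extChartAt (𝓡 d) (1 : G)).left_inv hk]
  · have hc : Filter.Tendsto (fun t : ℝ => k * (extChartAt (𝓡 d) h).symm
        (extChartAt (𝓡 d) h h + t • v)) (𝓝 0) (𝓝 (k * h)) := by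
      have h1 := (continuousAt_extChartAt_symm (I := 𝓡 d) h).tendsto
      rw [extChartAt_to_inv] at h1
      have h2 : Continuous (fun z : G => k * z) :=
        (contMDiff_mul_left (I := 𝓡 d) (n := ∞) (a := k)).continuous
      exact (h2.tendsto h).comp (h1.comp (tendsto_line _ v))
    filter_upwards [hc.eventually ((isOpen_extChartAt_source (I := 𝓡 d) h).mem_nhds hkh)] with t ht
    show _ = (extChartAt (𝓡 d) h).symm (extChartAt (𝓡 d) h
      ((extChartAt (𝓡 d) (1 : G)).symm (extChartAt (𝓡 d) (1 : G) k) * (extChartAt (𝓡 d) h).symm _))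
    rw [(extChartAt (𝓡 d) (1 : G)).left_inv hk, (extChartAt (𝓡 d) h).left_inv ht]

/-- The velocity of `s ↦ k_s g`, for a curve `k` through `1` and `g` in the chart at `h`. -/
theorem hasMFDerivAt_curve_mul {h : G} {k : ℝ → G} {κ : E d} {y : E d} (hk : ContinuousAt k 0)
    (hk0 : k 0 = 1) (hκ : HasDerivAt (fun s => extChartAt (𝓡 d) (1 : G) (k s)) κ 0)
    (hy : y ∈ (extChartAt (𝓡 d) h).target)
    (hd : DifferentiableAt ℝ (chartMul h) (extChartAt (𝓡 d) (1 : G) 1, y)) :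
    HasMFDerivAt 𝓘(ℝ, ℝ) (𝓡 d) (fun s : ℝ => k s * (extChartAt (𝓡 d) h).symm y) 0
      (ContinuousLinearMap.toSpanSingleton ℝ (symmDeriv h y
        (fderiv ℝ (chartMul h) (extChartAt (𝓡 d) (1 : G) 1, y) (κ, 0))) : ℝ →L[ℝ] E d) := by
  have hd' : HasFDerivAt (chartMul h) (fderiv ℝ (chartMul h) (extChartAt (𝓡 d) (1 : G) 1, y))
      (extChartAt (𝓡 d) (1 : G) (k 0), y) := by
    rw [hk0]
    exact hd.hasFDerivAt
  refine hasMFDerivAt_curve_of_chart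
    (HasFDerivAt.comp_hasDerivAt (f := fun s : ℝ => (extChartAt (𝓡 d) (1 : G) (k s), y)) 0 hd'
      (hκ.prodMk (hasDerivAt_const 0 y))) ?_ hy ?_
  · show chartMul h (extChartAt (𝓡 d) (1 : G) (k 0), y) = y
    rw [hk0, chartMul_base_left h hy]
  · have hc1 : ∀ᶠ s in 𝓝 (0 : ℝ), k s ∈ (extChartAt (𝓡 d) (1 : G)).source := by
      refine hk.eventually ?_
      rw [hk0]
      exact extChartAt_source_mem_nhds (I := 𝓡 d) (1 : G)
    have hc2 : ∀ᶠ s in 𝓝 (0 : ℝ),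
        k s * (extChartAt (𝓡 d) h).symm y ∈ (extChartAt (𝓡 d) h).source := by
      have h2 : Continuous (fun z : G => z * (extChartAt (𝓡 d) h).symm y) :=
        (contMDiff_mul_right (I := 𝓡 d) (n := ∞) (a := (extChartAt (𝓡 d) h).symm y)).continuous
      refine (h2.continuousAt.comp hk).eventually ?_
      show _ ∈ 𝓝 (k 0 * (extChartAt (𝓡 d) h).symm y)
      rw [hk0, one_mul]
      exact (isOpen_extChartAt_source (I := 𝓡 d) h).mem_nhds ((extChartAt (𝓡 d) h).map_target hy)
    filter_upwards [hc1, hc2] with s hs hs'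
    show _ = (extChartAt (𝓡 d) h).symm (extChartAt (𝓡 d) h
      ((extChartAt (𝓡 d) (1 : G)).symm (extChartAt (𝓡 d) (1 : G) (k s)) *
        (extChartAt (𝓡 d) h).symm y))
    rw [(extChartAt (𝓡 d) (1 : G)).left_inv hs, (extChartAt (𝓡 d) h).left_inv hs']

end Translations

/-! ### The infinitesimal equivariance of `η` -/

/-- The product rule for the value of a one-form on a moving vector at a moving point. -/
theorem hasDerivAt_clm_apply_of_eq {B V : Type*} [NormedAddCommGroup B] [NormedSpace ℝ B]
    [NormedAddCommGroup V] [NormedSpace ℝ V] {T : B → B →L[ℝ] V} {T' : B →L[ℝ] B →L[ℝ] V} {b : B}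
    (hT : HasFDerivAt T T' b) {y W : ℝ → B} {y' W' : B} (hy : HasDerivAt y y' 0) (hy0 : y 0 = b)
    (hW : HasDerivAt W W' 0) :
    HasDerivAt (fun s => T (y s) (W s)) (T' y' (W 0) + T b W') 0 := by
  subst hy0
  exact (HasFDerivAt.comp_hasDerivAt (f := y) 0 hT hy).clm_apply hW

namespace YangMills

variable {n d : ℕ} {M P G : Type*}
  [TopologicalSpace M] [ChartedSpace (E 3) M]
  [TopologicalSpace P] [ChartedSpace (E n) P] [IsManifold (𝓡 n) ∞ P]
  [TopologicalSpace G] [ChartedSpace (E d) G] [Group G]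

theorem hasVelocity_mk {S : YangMills n d M P G} {a : ℝ → S.BasicForms} {f : ℝ → G}
    {a' : S.BasicForms} {f' : E d} (ha : HasDerivAt a a' 0)
    (hf : HasMFDerivAt 𝓘(ℝ, ℝ) (𝓡 d) f 0
      (ContinuousLinearMap.toSpanSingleton ℝ f' : ℝ →L[ℝ] E d)) :
    S.HasVelocity (fun t => (a t, f t)) (a', f') := by
  have h1 : HasMFDerivAt 𝓘(ℝ, ℝ) 𝓘(ℝ, S.BasicForms) a 0
      (ContinuousLinearMap.toSpanSingleton ℝ a') := ha.hasFDerivAt.hasMFDerivAt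
  refine (h1.prodMk hf).congr_mfderiv ?_
  show (ContinuousLinearMap.toSpanSingleton ℝ a').prod
    (ContinuousLinearMap.toSpanSingleton ℝ f' : ℝ →L[ℝ] E d) =
    (ContinuousLinearMap.toSpanSingleton ℝ (a', f') : ℝ →L[ℝ] S.TConf)
  ext <;> simp

theorem HasVelocity.hasMFDerivAt_snd {S : YangMills n d M P G} {c : ℝ → S.Conf} {X : S.TConf}
    (h : S.HasVelocity c X) : HasMFDerivAt 𝓘(ℝ, ℝ) (𝓡 d) (fun s => (c s).2) 0
      (ContinuousLinearMap.toSpanSingleton ℝ X.2 : ℝ →L[ℝ] E d) := by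
  refine (HasMFDerivAt.comp (0 : ℝ) (_root_.hasMFDerivAt_snd (c 0)) h).congr_mfderiv ?_
  show (ContinuousLinearMap.snd ℝ S.BasicForms (E d)).comp
    (ContinuousLinearMap.toSpanSingleton ℝ X : ℝ →L[ℝ] S.TConf) =
    (ContinuousLinearMap.toSpanSingleton ℝ X.2 : ℝ →L[ℝ] E d)
  ext
  simp

variable [LieGroup (𝓡 d) ∞ G]

theorem isGaugeImage_iff {S : YangMills n d M P G} {g : P → G} (hg : S.IsGauge g) (x x' : S.Conf) :
    S.IsGaugeImage g x x' ↔ (∀ p (v : E n), S.conn x' p v =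
      Ad (g p)⁻¹ (S.conn x p v) + manDeriv (fun q => (g p)⁻¹ * g q) p v) ∧
      x'.2 = (g S.u₀)⁻¹ * x.2 := by
  refine ⟨fun h => ⟨fun p v => h.conn_eq hg p v, h.2⟩, fun h => ⟨fun p v => ?_, h.2⟩⟩
  rw [h.1]
  symm
  show S.conn x (S.Q.act p (g p)) (manDeriv (fun q => S.Q.act q (g q)) p v) = _
  rw [S.Q.manDeriv_act (hg.mdifferentiableAt p), map_add, S.conn_equivariant, S.conn_vert]

omit [LieGroup (𝓡 d) ∞ G] in
theorem conn_add (S : YangMills n d M P G) (a b : S.BasicForms) (h h' : G) (p : P) (v : E n) :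
    S.conn (a + b, h) p v = S.conn (a, h') p v + b.1.val p v := by
  show S.A₀.val p v + (a.1.val p v + b.1.val p v) = S.A₀.val p v + a.1.val p v + b.1.val p v
  rw [add_assoc]

omit [LieGroup (𝓡 d) ∞ G] in
/-- The framing component of the orbits of a curve of gauge transformations is the left
multiplication by a differentiable curve in `G`. -/
theorem framing_curve {S : YangMills n d M P G} {g : ℝ → P → G} {K : S.Conf → S.TConf}
    (hg0 : ∀ p, g 0 p = 1)
    (hK : ∀ x, ∃ c : ℝ → S.Conf, (∀ s, S.IsGaugeImage (g s) x (c s)) ∧ S.HasVelocity c (K x)) :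
    ContinuousAt (fun s => (g s S.u₀)⁻¹) 0 ∧
      HasDerivAt (fun s => extChartAt (𝓡 d) (1 : G) (g s S.u₀)⁻¹) (K (0, 1)).2 0 := by
  obtain ⟨c, hc, hcv⟩ := hK (0, 1)
  have hc2 : ∀ s, (c s).2 = (g s S.u₀)⁻¹ := fun s => by rw [(hc s).2, mul_one]
  refine ⟨?_, ?_⟩
  · have h1 := hcv.hasMFDerivAt_snd.continuousAt
    simpa only [hc2] using h1
  · have h1 := hcv.hasDerivAt_snd
    simpa only [hc2, hg0, inv_one] using h1

/-- The identity of the gauge group acts trivially. -/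
theorem IsGaugeImage.eq_of_one {S : YangMills n d M P G} {g : P → G} (hg : S.IsGauge g)
    (hg1 : ∀ p, g p = 1) {x x' : S.Conf} (h : S.IsGaugeImage g x x') : x' = x := by
  refine Prod.ext (S.basicForms_ext fun q v => ?_) (by rw [h.2, hg1, inv_one, one_mul])
  have h1 := h.conn_eq hg q v
  have h2 : (fun r => (g q)⁻¹ * g r) = fun _ => (1 : G) := by
    funext r; rw [hg1, hg1, inv_one, one_mul]
  have h3 : (manDeriv (fun _ : P => (1 : G)) q : E n →L[ℝ] E d) = 0 := mfderiv_const
  rw [h2, h3, hg1, inv_one, Ad_one] at h1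
  have h4 : S.A₀.val q v + x'.1.1.val q v = S.A₀.val q v + x.1.1.val q v + 0 := h1
  rw [add_zero] at h4
  exact add_left_cancel h4

/-- The linear part of the action of a curve of gauge transformations on the space of connections
is differentiable: it is a difference of two orbits. -/
theorem exists_linear_part {S : YangMills n d M P G} {g : ℝ → P → G} {K : S.Conf → S.TConf}
    (hg0 : ∀ p, g 0 p = 1) (hg : ∀ s, S.IsGauge (g s))
    (hK : ∀ x, ∃ c : ℝ → S.Conf, (∀ s, S.IsGaugeImage (g s) x (c s)) ∧ S.HasVelocity c (K x))
    (a b : S.BasicForms) (h : G) : ∃ L : ℝ → S.BasicForms, L 0 = b ∧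
      HasDerivAt L ((K (a + b, h)).1 - (K (a, h)).1) 0 ∧
      ∀ s q (v : E n), (L s).1.val q v = Ad (g s q)⁻¹ (b.1.val q v) := by
  obtain ⟨c, hc, hcv⟩ := hK (a, h)
  obtain ⟨c', hc', hcv'⟩ := hK (a + b, h)
  have hval : ∀ s q (v : E n), ((c' s).1 - (c s).1).1.val q v = Ad (g s q)⁻¹ (b.1.val q v) := by
    intro s q v
    have h1 : ((c' s).1 - (c s).1).1.val q v = S.conn (c' s) q v - S.conn (c s) q v := by
      show (c' s).1.1.val q v - (c s).1.1.val q v =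
        (S.A₀.val q v + (c' s).1.1.val q v) - (S.A₀.val q v + (c s).1.1.val q v)
      abel
    rw [h1, (hc' s).conn_eq (hg s), (hc s).conn_eq (hg s), S.conn_add a b h h, map_add]
    abel
  refine ⟨fun s => (c' s).1 - (c s).1, ?_, hcv'.hasDerivAt_fst.sub hcv.hasDerivAt_fst, hval⟩
  refine S.basicForms_ext fun q v => ?_
  rw [hval, hg0, inv_one, Ad_one]
  rfl

/-- The line through `(a, h)` in the direction `Y` in the chart of `𝒜` centred at `(a, h)`. -/
def coordLine (S : YangMills n d M P G) (a : S.BasicForms) (h : G) (Y : S.TConf) (t : ℝ) : S.Conf :=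
  (a + t • Y.1, (extChartAt (𝓡 d) h).symm (extChartAt (𝓡 d) h h + t • Y.2))

omit [LieGroup (𝓡 d) ∞ G] in
theorem coordLine_zero (S : YangMills n d M P G) (a : S.BasicForms) (h : G) (Y : S.TConf) :
    S.coordLine a h Y 0 = (a, h) := by
  simp only [coordLine, zero_smul, add_zero, extChartAt_to_inv]

theorem hasDerivAt_line {B : Type*} [NormedAddCommGroup B] [NormedSpace ℝ B] (b v : B) :
    HasDerivAt (fun t : ℝ => b + t • v) v 0 := by
  simpa using ((hasDerivAt_id (0 : ℝ)).smul_const v).const_add b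

theorem hasVelocity_coordLine (S : YangMills n d M P G) (a : S.BasicForms) (h : G) (Y : S.TConf) :
    S.HasVelocity (S.coordLine a h Y) Y := by
  have h1 := hasMFDerivAt_curve_of_chart (h := h) (hasDerivAt_line (extChartAt (𝓡 d) h h) Y.2)
    (b := extChartAt (𝓡 d) h h) (by simp) (mem_extChartAt_target h)
    (f := fun t => (extChartAt (𝓡 d) h).symm (extChartAt (𝓡 d) h h + t • Y.2))
    (Filter.Eventually.of_forall fun t => rfl)
  rw [symmDeriv_self] at h1
  exact hasVelocity_mk (hasDerivAt_line a Y.1) h1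

/-- The equivariance of `η` in the chart centred at `(a, h)`. The gauge transformation maps the
coordinate line in the direction `Y` to a curve whose first component is a line in the direction
`L`, and whose second component is a left translate of the coordinate line in `G`. -/
theorem etaRep_equivariant {S : YangMills n d M P G} {η : S.Conf → S.TConf →L[ℝ] S.GaugeAlg}
    (hη : S.IsGaugeFixingConnection η) {g : P → G} (hg : S.IsGauge g) {a b L : S.BasicForms}
    {h k : G} (hk : (g S.u₀)⁻¹ = k) (Y : S.TConf) (him : S.IsGaugeImage g (a, h) (b, k * h))
    (hL : ∀ q (v : E n), L.1.val q v = Ad (g q)⁻¹ (Y.1.1.val q v))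
    (h1 : k ∈ (extChartAt (𝓡 d) (1 : G)).source) (h2 : k * h ∈ (extChartAt (𝓡 d) h).source)
    (h3 : DifferentiableAt ℝ (chartMul h) (extChartAt (𝓡 d) (1 : G) k, extChartAt (𝓡 d) h h))
    (p : P) :
    (S.etaRep η (a, h) (b, extChartAt (𝓡 d) h (k * h))
      (L, fderiv ℝ (chartMul h) (extChartAt (𝓡 d) (1 : G) k, extChartAt (𝓡 d) h h)
        (0, Y.2))).1.val p = Ad (g p)⁻¹ ((η (a, h) Y).1.val p) := by
  have him' : ∀ t, S.IsGaugeImage g (S.coordLine a h Y t)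
      (b + t • L, k * (S.coordLine a h Y t).2) := by
    intro t
    rw [isGaugeImage_iff hg]
    refine ⟨fun q v => ?_, by rw [hk]⟩
    have e1 : S.conn (S.coordLine a h Y t) q v = S.conn (a, h) q v + t • Y.1.1.val q v :=
      S.conn_add a (t • Y.1) _ h q v
    have e2 : S.conn (b + t • L, k * (S.coordLine a h Y t).2) q v =
        S.conn (b, k * h) q v + t • L.1.val q v := S.conn_add b (t • L) _ _ q v
    rw [e1, e2, him.conn_eq hg q v, hL, map_add, map_smul]
    abel
  have hvel := hasVelocity_mk (S := S) (hasDerivAt_line b L) (hasMFDerivAt_mul_line Y.2 h1 h2 h3)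
  have h4 := hη.equivariant g hg _ _ him' _ _ (S.hasVelocity_coordLine a h Y) hvel p
  have h5 : ((b + (0 : ℝ) • L, k * (S.coordLine a h Y 0).2) : S.Conf) = (b, k * h) := by
    rw [coordLine_zero, zero_smul, add_zero]
  rw [h5, coordLine_zero] at h4
  rw [← h4]
  have h6 : (extChartAt S.IConf ((a, h) : S.Conf)).symm (b, extChartAt (𝓡 d) h (k * h)) =
      (b, k * h) := by
    rw [extChartAt_conf_symm, (extChartAt (𝓡 d) h).left_inv h2]
  unfold etaRep
  rw [h6]
  show (η (b, k * h) (S.confSymmDeriv (a, h) _ _)).1.val p = _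
  rw [S.confSymmDeriv_apply (a, h) ((extChartAt (𝓡 d) h).map_source h2)]

/-- The product rule for the value of `η` on a moving vector at a moving point, in the chart
centred at the initial point of the motion. -/
theorem hasDerivAt_etaRep {S : YangMills n d M P G} {η : S.Conf → S.TConf →L[ℝ] S.GaugeAlg}
    (hη : S.IsGaugeFixingConnection η) {a : S.BasicForms} {h : G} {y W : ℝ → S.TConf}
    {y' W' : S.TConf} (hy : HasDerivAt y y' 0) (hy0 : y 0 = (a, extChartAt (𝓡 d) h h))
    (hW : HasDerivAt W W' 0) :
    HasDerivAt (fun s => S.etaRep η (a, h) (y s) (W s))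
      (S.etaDeriv η (a, h) y' (W 0) + η (a, h) W') 0 := by
  have hconf : y 0 = extChartAt S.IConf ((a, h) : S.Conf) (a, h) :=
    hy0.trans (S.extChartAt_conf (a, h) (a, h)).symm
  have h1 := hasDerivAt_clm_apply_of_eq (hη.hasFDerivAt_etaRep (a, h)) hy hconf hW
  rwa [S.etaRep_self η (a, h)] at h1

/-- The derivative of the equivariance of `η` along an orbit of a curve of gauge transformations.
The second term on the left is the value of `η` on the derivative, at the identity, of the image
of `Y` under the differentials of the transformations, in the chart centred at `(a, h)`. -/
theorem etaDeriv_orbit {S : YangMills n d M P G} {η : S.Conf → S.TConf →L[ℝ] S.GaugeAlg}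
    (hη : S.IsGaugeFixingConnection η) {ξ : S.GaugeAlg} {g : ℝ → P → G} {K : S.Conf → S.TConf}
    (hg : ∀ s, S.IsGauge (g s)) (hv : S.HasVelocityAtOne g ξ)
    (hK : ∀ x, ∃ c : ℝ → S.Conf, (∀ s, S.IsGaugeImage (g s) x (c s)) ∧ S.HasVelocity c (K x))
    (a : S.BasicForms) (h : G) (Y : S.TConf) (p : P) :
    (S.etaDeriv η (a, h) (K (a, h)) Y).1.val p + (η (a, h) ((K (a + Y.1, h)).1 - (K (a, h)).1,
      fderiv ℝ (fderiv ℝ (chartMul h)) (extChartAt (𝓡 d) (1 : G) 1, extChartAt (𝓡 d) h h)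
        ((K (0, 1)).2, 0) (0, Y.2))).1.val p =
      -lieBr G (ξ.1.val p) ((η (a, h) Y).1.val p) := by
  obtain ⟨hkc, hκ⟩ := framing_curve hv.1 hK
  obtain ⟨L, hL0, hLd, hLval⟩ := exists_linear_part hv.1 hg hK a Y.1 h
  obtain ⟨c, hc, hcv⟩ := hK (a, h)
  have hk0 : (g 0 S.u₀)⁻¹ = 1 := by rw [hv.1, inv_one]
  -- the framings of the orbits are the left translates by `k`
  generalize hk : (fun s => (g s S.u₀)⁻¹) = k at hkc
  have hks : ∀ s, (g s S.u₀)⁻¹ = k s := fun s => congrFun hk s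
  simp only [hks] at hκ hk0
  have hc2 : ∀ s, (c s).2 = k s * h := fun s => by rw [← hks]; exact (hc s).2
  have hc0 : c 0 = (a, h) := (hc 0).eq_of_one (hg 0) hv.1
  have hek0 : (extChartAt (𝓡 d) (1 : G) (k 0), extChartAt (𝓡 d) h h) =
      (extChartAt (𝓡 d) (1 : G) 1, extChartAt (𝓡 d) h h) := by rw [hk0]
  have hyd : HasDerivAt (fun s => (((c s).1, extChartAt (𝓡 d) h (k s * h)) : S.TConf))
      (K (a, h)) 0 := by
    have h1 := ((S.hasVelocity_iff c _).1 hcv).2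
    simpa only [hc0, hc2] using h1
  have hWd : HasDerivAt (fun s => ((L s, fderiv ℝ (chartMul h)
      (extChartAt (𝓡 d) (1 : G) (k s), extChartAt (𝓡 d) h h) (0, Y.2)) : S.TConf))
      ((K (a + Y.1, h)).1 - (K (a, h)).1,
      fderiv ℝ (fderiv ℝ (chartMul h)) (extChartAt (𝓡 d) (1 : G) 1, extChartAt (𝓡 d) h h)
        ((K (0, 1)).2, 0) (0, Y.2)) 0 := by
    refine hLd.prodMk ?_
    have h1 := (differentiableAt_fderiv_chartMul (d := d) h).hasFDerivAt
    rw [← hek0] at h1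
    have h2 := HasFDerivAt.comp_hasDerivAt
      (f := fun s : ℝ => (extChartAt (𝓡 d) (1 : G) (k s), extChartAt (𝓡 d) h h)) 0 h1
      (hκ.prodMk (hasDerivAt_const 0 (extChartAt (𝓡 d) h h)))
    have h3 := h2.clm_apply (hasDerivAt_const (0 : ℝ) ((0, Y.2) : E d × E d))
    rw [map_zero, add_zero, hek0] at h3
    exact h3
  have hequiv : ∀ᶠ s in 𝓝 (0 : ℝ), (S.etaRep η (a, h)
      ((c s).1, extChartAt (𝓡 d) h (k s * h)) (L s, fderiv ℝ (chartMul h)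
      (extChartAt (𝓡 d) (1 : G) (k s), extChartAt (𝓡 d) h h) (0, Y.2))).1.val p =
      Ad (g s p)⁻¹ ((η (a, h) Y).1.val p) := by
    have ev1 : ∀ᶠ s in 𝓝 (0 : ℝ), k s ∈ (extChartAt (𝓡 d) (1 : G)).source := by
      refine hkc.eventually ?_
      rw [hk0]
      exact extChartAt_source_mem_nhds (I := 𝓡 d) (1 : G)
    have ev2 : ∀ᶠ s in 𝓝 (0 : ℝ), k s * h ∈ (extChartAt (𝓡 d) h).source := by
      have h2 : Continuous (fun z : G => z * h) :=
        (contMDiff_mul_right (I := 𝓡 d) (n := ∞) (a := h)).continuous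
      refine (h2.continuousAt.comp hkc).eventually ?_
      show _ ∈ 𝓝 (k 0 * h)
      rw [hk0, one_mul]
      exact extChartAt_source_mem_nhds (I := 𝓡 d) h
    have ev3 : ∀ᶠ s in 𝓝 (0 : ℝ), DifferentiableAt ℝ (chartMul h)
        (extChartAt (𝓡 d) (1 : G) (k s), extChartAt (𝓡 d) h h) := by
      have h1 := eventually_differentiableAt_chartMul (d := d) h
      rw [← hek0] at h1
      exact (hκ.continuousAt.prodMk continuousAt_const).eventually h1
    filter_upwards [ev1, ev2, ev3] with s h1 h2 h3
    refine etaRep_equivariant hη (hg s) (hks s) Y ?_ (hLval s) h1 h2 h3 p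
    have h4 := hc s
    rwa [show c s = ((c s).1, k s * h) from Prod.ext rfl (hc2 s)] at h4
  have h1 := hasDerivAt_etaRep hη hyd (by rw [hc0, hk0, one_mul]) hWd
  have h2 := (S.gaugeEval p).hasFDerivAt.comp_hasDerivAt 0 h1
  have h3 := (hv.hasDerivAt_Ad_inv p ((η (a, h) Y).1.val p)).congr_of_eventuallyEq hequiv
  have h4 := h2.unique h3
  have hW0 : ((L 0, fderiv ℝ (chartMul h)
      (extChartAt (𝓡 d) (1 : G) (k 0), extChartAt (𝓡 d) h h) (0, Y.2)) : S.TConf) = Y := by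
    rw [hk0, hL0, fderiv_chartMul_base_right]
  rw [hW0, map_add] at h4
  exact h4

/-- The fundamental vector fields along a coordinate line: affine in the direction of the
connections, and right invariant in the direction of the group. -/
theorem fundamental_coordLine {S : YangMills n d M P G} {ξ : S.GaugeAlg} {g : ℝ → P → G}
    {K : S.Conf → S.TConf} (hg0 : ∀ p, g 0 p = 1)
    (hK : ∀ x, ∃ c : ℝ → S.Conf, (∀ s, S.IsGaugeImage (g s) x (c s)) ∧ S.HasVelocity c (K x))
    (hval : ∀ x p (v : E n),
      (K x).1.1.val p v = funDeriv ξ.1.val p v + lieBr G (S.conn x p v) (ξ.1.val p))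
    (a : S.BasicForms) (h : G) (Y : S.TConf) : ∀ᶠ t in 𝓝 (0 : ℝ),
      extChartAt (𝓡 d) h h + t • Y.2 ∈ (extChartAt (𝓡 d) h).target ∧
      K (S.coordLine a h Y t) = ((K (a, h)).1 + t • ((K (a + Y.1, h)).1 - (K (a, h)).1),
        symmDeriv h (extChartAt (𝓡 d) h h + t • Y.2) (fderiv ℝ (chartMul h)
          (extChartAt (𝓡 d) (1 : G) 1, extChartAt (𝓡 d) h h + t • Y.2) ((K (0, 1)).2, 0))) := by
  obtain ⟨hkc, hκ⟩ := framing_curve hg0 hK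
  have ev1 : ∀ᶠ t in 𝓝 (0 : ℝ), extChartAt (𝓡 d) h h + t • Y.2 ∈ (extChartAt (𝓡 d) h).target :=
    (tendsto_line _ Y.2).eventually
      ((isOpen_extChartAt_target h).mem_nhds (mem_extChartAt_target h))
  have ev2 : ∀ᶠ t in 𝓝 (0 : ℝ), DifferentiableAt ℝ (chartMul h)
      (extChartAt (𝓡 d) (1 : G) 1, extChartAt (𝓡 d) h h + t • Y.2) :=
    (tendsto_const_nhds.prodMk_nhds (tendsto_line _ Y.2)).eventually
      (eventually_differentiableAt_chartMul (d := d) h)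
  filter_upwards [ev1, ev2] with t h1 h2
  refine ⟨h1, Prod.ext (S.basicForms_ext fun q v => ?_) ?_⟩
  · show _ = (K (a, h)).1.1.val q v +
      t • ((K (a + Y.1, h)).1.1.val q v - (K (a, h)).1.1.val q v)
    have e1 : S.conn (S.coordLine a h Y t) q v = S.conn (a, h) q v + t • Y.1.1.val q v :=
      S.conn_add a (t • Y.1) _ h q v
    rw [hval, hval, hval, e1, S.conn_add a Y.1 h h, lieBr_add_left, lieBr_add_left,
      lieBr_smul_left, add_sub_add_left_eq_sub, add_sub_cancel_left, add_assoc]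
  · obtain ⟨c, hc, hcv⟩ := hK (S.coordLine a h Y t)
    have h3 := hcv.hasMFDerivAt_snd
    have h4 := hasMFDerivAt_curve_mul (h := h) hkc (by rw [hg0, inv_one]) hκ h1 h2
    have h5 : (fun s => (c s).2) = fun s => (g s S.u₀)⁻¹ *
        (extChartAt (𝓡 d) h).symm (extChartAt (𝓡 d) h h + t • Y.2) := funext fun s => (hc s).2
    rw [h5] at h3
    have h6 := h3.mfderiv.symm.trans h4.mfderiv
    have h7 := congrArg (fun T : ℝ →L[ℝ] E d => T 1) h6
    have h8 : (1 : ℝ) • (K (S.coordLine a h Y t)).2 = (1 : ℝ) • symmDeriv h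
      (extChartAt (𝓡 d) h h + t • Y.2) (fderiv ℝ (chartMul h)
          (extChartAt (𝓡 d) (1 : G) 1, extChartAt (𝓡 d) h h + t • Y.2) ((K (0, 1)).2, 0)) := h7
    rwa [one_smul, one_smul] at h8

/-- The derivative of the identity `η(K) = ξ` along a coordinate line. -/
theorem etaDeriv_coordLine {S : YangMills n d M P G} {η : S.Conf → S.TConf →L[ℝ] S.GaugeAlg}
    (hη : S.IsGaugeFixingConnection η) {ξ : S.GaugeAlg} {g : ℝ → P → G} {K : S.Conf → S.TConf}
    (hg0 : ∀ p, g 0 p = 1)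
    (hK : ∀ x, ∃ c : ℝ → S.Conf, (∀ s, S.IsGaugeImage (g s) x (c s)) ∧ S.HasVelocity c (K x))
    (hval : ∀ x p (v : E n),
      (K x).1.1.val p v = funDeriv ξ.1.val p v + lieBr G (S.conn x p v) (ξ.1.val p))
    (hηK : ∀ x, η x (K x) = ξ) (a : S.BasicForms) (h : G) (Y : S.TConf) :
    S.etaDeriv η (a, h) Y (K (a, h)) + η (a, h) ((K (a + Y.1, h)).1 - (K (a, h)).1,
      fderiv ℝ (fderiv ℝ (chartMul h)) (extChartAt (𝓡 d) (1 : G) 1, extChartAt (𝓡 d) h h)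
        (0, Y.2) ((K (0, 1)).2, 0)) = 0 := by
  have hKγ := fundamental_coordLine hg0 hK hval a h Y
  have hl : HasDerivAt (fun t : ℝ => ((a + t • Y.1, extChartAt (𝓡 d) h h + t • Y.2) : S.TConf))
      Y 0 := (hasDerivAt_line a Y.1).prodMk (hasDerivAt_line _ Y.2)
  have hVd : HasDerivAt (fun t : ℝ => (((K (a, h)).1 + t • ((K (a + Y.1, h)).1 - (K (a, h)).1),
      fderiv ℝ (chartMul h) (extChartAt (𝓡 d) (1 : G) 1, extChartAt (𝓡 d) h h + t • Y.2)
        ((K (0, 1)).2, 0)) : S.TConf)) ((K (a + Y.1, h)).1 - (K (a, h)).1,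
      fderiv ℝ (fderiv ℝ (chartMul h)) (extChartAt (𝓡 d) (1 : G) 1, extChartAt (𝓡 d) h h)
        (0, Y.2) ((K (0, 1)).2, 0)) 0 := by
    refine (hasDerivAt_line _ _).prodMk ?_
    have e0 : (extChartAt (𝓡 d) (1 : G) 1, extChartAt (𝓡 d) h h + (0 : ℝ) • Y.2) =
      (extChartAt (𝓡 d) (1 : G) 1, extChartAt (𝓡 d) h h) := by rw [zero_smul, add_zero]
    have h1 := (differentiableAt_fderiv_chartMul (d := d) h).hasFDerivAt
    rw [← e0] at h1
    have h2 := HasFDerivAt.comp_hasDerivAt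
      (f := fun t : ℝ => (extChartAt (𝓡 d) (1 : G) 1, extChartAt (𝓡 d) h h + t • Y.2)) 0 h1
      ((hasDerivAt_const 0 (extChartAt (𝓡 d) (1 : G) 1)).prodMk (hasDerivAt_line _ Y.2))
    have h3 := h2.clm_apply (hasDerivAt_const (0 : ℝ) (((K (0, 1)).2, 0) : E d × E d))
    rw [map_zero, add_zero, e0] at h3
    exact h3
  have h1 := hasDerivAt_etaRep hη hl (by rw [zero_smul, zero_smul, add_zero, add_zero]) hVd
  have hconst : (fun _ : ℝ => ξ) =ᶠ[𝓝 0] fun t : ℝ => S.etaRep η (a, h)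
      (a + t • Y.1, extChartAt (𝓡 d) h h + t • Y.2)
      ((K (a, h)).1 + t • ((K (a + Y.1, h)).1 - (K (a, h)).1),
      fderiv ℝ (chartMul h) (extChartAt (𝓡 d) (1 : G) 1, extChartAt (𝓡 d) h h + t • Y.2)
        ((K (0, 1)).2, 0)) := by
    filter_upwards [hKγ] with t ht
    rw [← hηK (S.coordLine a h Y t), ht.2]
    unfold etaRep
    rw [extChartAt_conf_symm]
    show _ = η (S.coordLine a h Y t) (S.confSymmDeriv (a, h) _ _)
    rw [S.confSymmDeriv_apply (a, h) ht.1]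
  have h2 := (h1.congr_of_eventuallyEq hconst).unique (hasDerivAt_const 0 ξ)
  have hV0 := hKγ.self_of_nhds.2
  rw [coordLine_zero, zero_smul, zero_smul, add_zero, add_zero, symmDeriv_self] at hV0
  simp only [zero_smul, add_zero] at h2
  have hV0' : (((K (a, h)).1, fderiv ℝ (chartMul h)
      (extChartAt (𝓡 d) (1 : G) 1, extChartAt (𝓡 d) h h) ((K (0, 1)).2, 0)) : S.TConf) =
      K (a, h) := hV0.symm
  rw [hV0'] at h2
  exact h2

/-- The infinitesimal form of the equivariance of `η`: the contraction of `δη` with a vertical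
vector is given by the adjoint action. It is obtained from Cartan's formula
`i_K δη = L_K η - δ(η K)`, where `η K = ξ` is constant and `L_K η = -[ξ, η]` by equivariance. Since
the gauge group acts on the space of connections by affine maps, all derivatives can be computed
along lines. -/
theorem etaDeriv_kappa {S : YangMills n d M P G} {η : S.Conf → S.TConf →L[ℝ] S.GaugeAlg}
    (hη : S.IsGaugeFixingConnection η) (ξ : S.GaugeAlg) (x : S.Conf) (Y : S.TConf) (p : P) :
    (S.etaDeriv η x (S.kappa ξ x) Y).1.val p - (S.etaDeriv η x Y (S.kappa ξ x)).1.val p =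
      -lieBr G (ξ.1.val p) ((η x Y).1.val p) := by
  rcases isFundamental_kappa_or hη ξ with hF | ⟨rfl, h0⟩
  · have hval := hF.val_fst
    obtain ⟨g, hg, hv, hK⟩ := hF
    obtain ⟨a, h⟩ := x
    have eq1 := etaDeriv_orbit hη hg hv hK a h Y p
    have eq2 := congrArg (S.gaugeEval p)
      (etaDeriv_coordLine hη hv.1 hK hval (hη.kappa ξ) a h Y)
    rw [map_add, map_zero, gaugeEval_apply, gaugeEval_apply] at eq2
    rw [fderiv_fderiv_chartMul_symm h] at eq1
    rw [← eq1, eq_neg_of_add_eq_zero_left eq2, sub_neg_eq_add]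
  · rw [h0]
    have e1 : (0 : S.Conf → S.TConf) x = 0 := rfl
    rw [e1, map_zero, map_zero]
    show (0 : E d) - 0 = -lieBr G 0 _
    rw [lieBr_zero_left, sub_zero, neg_zero]

end YangMills

namespace YangMills

variable {n d : ℕ} {M P G : Type*}
  [TopologicalSpace M] [ChartedSpace (E 3) M]
  [TopologicalSpace P] [ChartedSpace (E n) P] [IsManifold (𝓡 n) ∞ P]
  [TopologicalSpace G] [ChartedSpace (E d) G] [Group G]

/-! ### The exterior derivatives of `A^U` and of `η` -/

theorem AU_apply (S : YangMills n d M P G) (x : S.Conf) (p : P) (Z : S.TConf × E n) :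
    S.AU (x, p) Z = S.conn x p Z.2 := rfl

theorem etaForm_apply (S : YangMills n d M P G) (η : S.Conf → S.TConf →L[ℝ] S.GaugeAlg)
    (x : S.Conf) (p : P) (Z : S.TConf × E n) :
    S.etaForm η (x, p) Z = (η x Z.1).1.val p := rfl

theorem extConn_apply (S : YangMills n d M P G) (η : S.Conf → S.TConf →L[ℝ] S.GaugeAlg)
    (x : S.Conf) (p : P) (Z : S.TConf × E n) :
    S.extConn η (x, p) Z = S.conn x p Z.2 + (η x Z.1).1.val p := rfl

theorem eta_zero_val (S : YangMills n d M P G) (η : S.Conf → S.TConf →L[ℝ] S.GaugeAlg)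
    (x : S.Conf) (p : P) : (η x 0).1.val p = 0 := by
  rw [map_zero]; rfl

theorem eta_sub_val (S : YangMills n d M P G) (T : S.TConf →L[ℝ] S.GaugeAlg) (X Y : S.TConf)
    (p : P) : (T (X - Y)).1.val p = (T X).1.val p - (T Y).1.val p := by
  rw [map_sub]; rfl

theorem extConn_conf (S : YangMills n d M P G) (η : S.Conf → S.TConf →L[ℝ] S.GaugeAlg)
    (x : S.Conf) (p : P) (X : S.TConf) : S.extConn η (x, p) (X, 0) = (η x X).1.val p := by
  rw [extConn_apply, map_zero, zero_add]

theorem extConn_tot (S : YangMills n d M P G) (η : S.Conf → S.TConf →L[ℝ] S.GaugeAlg)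
    (x : S.Conf) (p : P) (v : E n) : S.extConn η (x, p) (0, v) = S.conn x p v := by
  rw [extConn_apply, eta_zero_val, add_zero]

theorem brk_AU_etaForm (S : YangMills n d M P G) (η : S.Conf → S.TConf →L[ℝ] S.GaugeAlg)
    (x : S.Conf) (p : P) (Z W : S.TConf × E n) :
    S.brk S.AU (S.etaForm η) (x, p) Z W =
      lieBr G (S.conn x p Z.2) ((η x W.1).1.val p) -
        lieBr G (S.conn x p W.2) ((η x Z.1).1.val p) := rfl

theorem psi_apply (S : YangMills n d M P G) (η : S.Conf → S.TConf →L[ℝ] S.GaugeAlg)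
    (x : S.Conf) (p : P) (Z W : S.TConf × E n) :
    S.psi η (x, p) Z W = S.delta S.AU (x, p) Z W + S.dP (S.etaForm η) (x, p) Z W +
      S.brk S.AU (S.etaForm η) (x, p) Z W := rfl

theorem horProj_kappa {S : YangMills n d M P G} {η : S.Conf → S.TConf →L[ℝ] S.GaugeAlg}
    (hη : S.IsGaugeFixingConnection η) (ξ : S.GaugeAlg) (x : S.Conf) :
    S.horProj η x (S.kappa ξ x) = 0 := by
  unfold horProj vertProj
  rw [hη.kappa, sub_self]

variable [LieGroup (𝓡 d) ∞ G]

theorem delta_AU (S : YangMills n d M P G) (x : S.Conf) (p : P) (Z W : S.TConf × E n) :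
    S.delta S.AU (x, p) Z W = Z.1.1.1.val p W.2 - W.1.1.1.val p Z.2 := by
  unfold delta
  rw [chartDeriv_AU_conf, chartDeriv_AU_conf]

variable {S : YangMills n d M P G} {η : S.Conf → S.TConf →L[ℝ] S.GaugeAlg}

theorem chartDeriv_etaForm_conf (hη : S.IsGaugeFixingConnection η) (x : S.Conf) (p : P)
    (X : S.TConf) (W : S.TConf × E n) :
    chartDeriv S.ITot (S.etaForm η) (x, p) (X, 0) W = (S.etaDeriv η x X W.1).1.val p := by
  rw [chartDeriv_etaForm hη, map_zero, add_zero]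

theorem chartDeriv_etaForm_tot (hη : S.IsGaugeFixingConnection η) (x : S.Conf) (p : P)
    (v : E n) (W : S.TConf × E n) :
    chartDeriv S.ITot (S.etaForm η) (x, p) (0, v) W = funDeriv (η x W.1).1.val p v := by
  rw [chartDeriv_etaForm hη, map_zero]
  exact zero_add _

theorem delta_etaForm (hη : S.IsGaugeFixingConnection η) (x : S.Conf) (p : P)
    (Z W : S.TConf × E n) :
    S.delta (S.etaForm η) (x, p) Z W =
      (S.etaDeriv η x Z.1 W.1).1.val p - (S.etaDeriv η x W.1 Z.1).1.val p := by
  unfold delta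
  rw [chartDeriv_etaForm_conf hη, chartDeriv_etaForm_conf hη]

theorem dP_etaForm (hη : S.IsGaugeFixingConnection η) (x : S.Conf) (p : P)
    (Z W : S.TConf × E n) :
    S.dP (S.etaForm η) (x, p) Z W =
      funDeriv (η x W.1).1.val p Z.2 - funDeriv (η x Z.1).1.val p W.2 := by
  unfold dP
  rw [chartDeriv_etaForm_tot hη, chartDeriv_etaForm_tot hη]

/-! ### The components of the curvature -/

theorem half_brk_self (S : YangMills n d M P G) (α : S.OneForm) (z : S.Conf × P)
    (Z W : S.TConf × E n) :
    ((1 / 2 : ℝ) • S.brk α α) z Z W = lieBr G (α z Z) (α z W) := by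
  show (1 / 2 : ℝ) • (lieBr G (α z Z) (α z W) - lieBr G (α z W) (α z Z)) = _
  rw [lieBr_skew (α z W), sub_neg_eq_add, ← two_smul ℝ, smul_smul]
  norm_num

theorem curv_apply (S : YangMills n d M P G) (η : S.Conf → S.TConf →L[ℝ] S.GaugeAlg)
    (z : S.Conf × P) (Z W : S.TConf × E n) :
    S.curv η z Z W = chartDeriv S.ITot (S.extConn η) z Z W - chartDeriv S.ITot (S.extConn η) z W Z +
      lieBr G (S.extConn η z Z) (S.extConn η z W) := by
  rw [← half_brk_self]
  rfl

theorem phi_apply (S : YangMills n d M P G) (η : S.Conf → S.TConf →L[ℝ] S.GaugeAlg)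
    (x : S.Conf) (p : P) (Z W : S.TConf × E n) :
    S.phi η (x, p) Z W = S.delta (S.etaForm η) (x, p) Z W +
      lieBr G ((η x Z.1).1.val p) ((η x W.1).1.val p) := by
  rw [← etaForm_apply S η x p Z, ← etaForm_apply S η x p W, ← half_brk_self]
  rfl

theorem FU_apply (S : YangMills n d M P G) (x : S.Conf) (p : P) (Z W : S.TConf × E n) :
    S.FU (x, p) Z W = S.dP S.AU (x, p) Z W + lieBr G (S.conn x p Z.2) (S.conn x p W.2) := by
  rw [← AU_apply S x p Z, ← AU_apply S x p W, ← half_brk_self]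
  rfl

theorem part20_curv (hη : S.IsGaugeFixingConnection η) : S.part20 (S.curv η) = S.phi η := by
  funext ⟨x, p⟩ Z W
  rw [phi_apply, delta_etaForm hη]
  unfold part20
  rw [curv_apply, chartDeriv_extConn_fst, chartDeriv_extConn_fst, chartDeriv_etaForm_conf hη,
    chartDeriv_etaForm_conf hη, extConn_conf, extConn_conf]

theorem part11_curv (hη : S.IsGaugeFixingConnection η) : S.part11 (S.curv η) = S.psi η := by
  funext ⟨x, p⟩ Z W
  rw [psi_apply, delta_AU, dP_etaForm hη, brk_AU_etaForm]
  unfold part11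
  rw [curv_apply, curv_apply, chartDeriv_extConn_fst, chartDeriv_extConn_fst,
    chartDeriv_extConn_snd, chartDeriv_extConn_snd, chartDeriv_etaForm_tot hη,
    chartDeriv_etaForm_tot hη, chartDeriv_AU_conf, chartDeriv_AU_conf]
  rw [extConn_conf, extConn_conf, extConn_tot, extConn_tot, lieBr_skew ((η x Z.1).1.val p)]
  abel

theorem part02_curv (S : YangMills n d M P G) (η : S.Conf → S.TConf →L[ℝ] S.GaugeAlg) :
    S.part02 (S.curv η) = S.FU := by
  funext ⟨x, p⟩ Z W
  rw [FU_apply]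
  unfold part02 dP
  rw [curv_apply, chartDeriv_extConn_snd, chartDeriv_extConn_snd, extConn_tot, extConn_tot]
  have hZ : chartDeriv S.ITot S.AU (x, p) (0, W.2) (0, Z.2) =
      chartDeriv S.ITot S.AU (x, p) (0, W.2) Z := S.chartDeriv_AU_congr _ _ rfl
  have hW : chartDeriv S.ITot S.AU (x, p) (0, Z.2) (0, W.2) =
      chartDeriv S.ITot S.AU (x, p) (0, Z.2) W := S.chartDeriv_AU_congr _ _ rfl
  rw [hZ, hW]

/-- Where `A` is differentiable, the derivative of `A^U + η` is the sum of its parts in the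
directions of `𝒜` and `P`. For derivatives along lines this is not automatic. -/
theorem chartDeriv_extConn (hη : S.IsGaugeFixingConnection η) {x : S.Conf} {p : P}
    (hx : S.ConnDifferentiableAt x p) (U W : S.TConf × E n) :
    chartDeriv S.ITot (S.extConn η) (x, p) U W =
      U.1.1.1.val p W.2 + chartDeriv S.ITot S.AU (x, p) (0, U.2) W +
        ((S.etaDeriv η x U.1 W.1).1.val p + funDeriv (η x W.1).1.val p U.2) := by
  have h := HasDerivAt.add (S.hasLineDerivAt_AU_of_connDifferentiableAt (x, p) hx U W)
    (hasLineDerivAt_etaForm hη (x, p) U W)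
  rw [chartDeriv_AU_conf] at h
  exact HasLineDerivAt.lineDeriv h

theorem curv_eq (hη : S.IsGaugeFixingConnection η) {x : S.Conf} {p : P}
    (hx : S.ConnDifferentiableAt x p) :
    S.curv η (x, p) = S.phi η (x, p) + S.psi η (x, p) + S.FU (x, p) := by
  funext Z W
  show _ = S.phi η (x, p) Z W + S.psi η (x, p) Z W + S.FU (x, p) Z W
  rw [curv_apply, chartDeriv_extConn hη hx, chartDeriv_extConn hη hx, phi_apply, psi_apply,
    FU_apply, delta_etaForm hη, delta_AU, dP_etaForm hη, brk_AU_etaForm, extConn_apply,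
    extConn_apply, lieBr_add_left, lieBr_add_right, lieBr_add_right,
    lieBr_skew ((η x Z.1).1.val p) (S.conn x p W.2)]
  unfold dP
  abel

/-! ### The splitting into vertical and horizontal parts -/

/-- The derivative of an equivariant function in the vertical directions of `P` is a bracket, and
this is what the projection `π_A` removes from `dη`. -/
theorem covEta_eq (hη : S.IsGaugeFixingConnection η) :
    S.covEta η = S.dP (S.etaForm η) + S.brk S.AU (S.etaForm η) := by
  funext ⟨x, p⟩ Z W
  show _ = S.dP (S.etaForm η) (x, p) Z W + S.brk S.AU (S.etaForm η) (x, p) Z W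
  unfold covEta piA
  rw [dP_etaForm hη, dP_etaForm hη, brk_AU_etaForm, map_sub, map_sub]
  dsimp only
  rw [funDeriv_vert, funDeriv_vert]
  abel

theorem deltaV_AU (hη : S.IsGaugeFixingConnection η) : S.deltaV η S.AU = -S.covEta η := by
  rw [covEta_eq hη]
  funext ⟨x, p⟩ Z W
  show _ = -(S.dP (S.etaForm η) (x, p) Z W + S.brk S.AU (S.etaForm η) (x, p) Z W)
  unfold deltaV vertProj
  rw [delta_AU, dP_etaForm hη, brk_AU_etaForm]
  dsimp only
  rw [kappa_val_fst hη, kappa_val_fst hη]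
  abel

theorem delta_AU_split (S : YangMills n d M P G) (η : S.Conf → S.TConf →L[ℝ] S.GaugeAlg) :
    S.delta S.AU = S.deltaV η S.AU + S.deltaH η S.AU := by
  funext ⟨x, p⟩ Z W
  show _ = S.deltaV η S.AU (x, p) Z W + S.deltaH η S.AU (x, p) Z W
  unfold deltaV deltaH horProj
  rw [delta_AU, delta_AU, delta_AU]
  show _ = _ + ((Z.1.1.1.val p W.2 - (S.vertProj η x Z.1).1.1.val p W.2) -
    (W.1.1.1.val p Z.2 - (S.vertProj η x W.1).1.1.val p Z.2))
  abel

theorem deltaH_AU (hη : S.IsGaugeFixingConnection η) : S.deltaH η S.AU = S.psi η := by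
  have h := S.delta_AU_split η
  rw [deltaV_AU hη, covEta_eq hη] at h
  unfold psi
  rw [h]
  abel

theorem psi_kappa (hη : S.IsGaugeFixingConnection η) (x : S.Conf) (p : P) (ξ : S.GaugeAlg)
    (W : S.TConf × E n) : S.psi η (x, p) (S.kappa ξ x, 0) W = 0 := by
  rw [← deltaH_AU hη]
  unfold deltaH
  rw [delta_AU]
  dsimp only
  rw [horProj_kappa hη, map_zero, sub_zero]
  rfl

theorem deltaV_etaForm_apply (hη : S.IsGaugeFixingConnection η) (x : S.Conf) (p : P)
    (Z W : S.TConf × E n) :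
    S.deltaV η (S.etaForm η) (x, p) Z W =
      -lieBr G ((η x Z.1).1.val p) ((η x W.1).1.val p) := by
  unfold deltaV vertProj
  rw [delta_etaForm hη]
  dsimp only
  rw [etaDeriv_kappa hη, hη.kappa]

theorem deltaV_etaForm (hη : S.IsGaugeFixingConnection η) :
    S.deltaV η (S.etaForm η) = -((1 / 2 : ℝ) • S.brk (S.etaForm η) (S.etaForm η)) := by
  funext ⟨x, p⟩ Z W
  rw [deltaV_etaForm_apply hη]
  exact congrArg Neg.neg (S.half_brk_self (S.etaForm η) (x, p) Z W).symm

theorem deltaH_etaForm (hη : S.IsGaugeFixingConnection η) :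
    S.deltaH η (S.etaForm η) = S.phi η := by
  funext ⟨x, p⟩ Z W
  rw [phi_apply]
  unfold deltaH horProj vertProj
  rw [delta_etaForm hη, delta_etaForm hη]
  dsimp only
  -- `δη` is expanded bilinearly on `X - κ(η(X))` and `Y - κ(η(Y))`; three of the four terms contain a
  -- vertical vector and are brackets
  have hZ := etaDeriv_kappa hη (η x Z.1) x W.1 p
  have hW := etaDeriv_kappa hη (η x W.1) x Z.1 p
  have hZW := etaDeriv_kappa hη (η x Z.1) x (S.kappa (η x W.1) x) p
  rw [hη.kappa] at hZW
  rw [eta_sub_val, eta_sub_val, map_sub, map_sub]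
  show ((S.etaDeriv η x Z.1 W.1).1.val p - (S.etaDeriv η x (S.kappa (η x Z.1) x) W.1).1.val p) -
    ((S.etaDeriv η x Z.1 (S.kappa (η x W.1) x)).1.val p -
      (S.etaDeriv η x (S.kappa (η x Z.1) x) (S.kappa (η x W.1) x)).1.val p) -
    (((S.etaDeriv η x W.1 Z.1).1.val p - (S.etaDeriv η x (S.kappa (η x W.1) x) Z.1).1.val p) -
    ((S.etaDeriv η x W.1 (S.kappa (η x Z.1) x)).1.val p -
      (S.etaDeriv η x (S.kappa (η x W.1) x) (S.kappa (η x Z.1) x)).1.val p)) = _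
  rw [lieBr_skew] at hW
  rw [neg_neg] at hW
  rw [sub_eq_iff_eq_add] at hZ hW hZW
  rw [hZ, hW, hZW]
  abel

theorem delta_etaForm_split (hη : S.IsGaugeFixingConnection η) :
    S.delta (S.etaForm η) = S.deltaV η (S.etaForm η) + S.deltaH η (S.etaForm η) := by
  rw [deltaV_etaForm hη, deltaH_etaForm hη]
  unfold phi
  abel

end YangMills

end

theorem mainTheorem1 {n d : ℕ} {M P G : Type*}
    [TopologicalSpace M] [ChartedSpace (E 3) M] [IsManifold (𝓡 3) ∞ M] [T2Space M] [CompactSpace M]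
    [TopologicalSpace P] [ChartedSpace (E n) P] [IsManifold (𝓡 n) ∞ P]
    [TopologicalSpace G] [ChartedSpace (E d) G] [Group G] [LieGroup (𝓡 d) ∞ G]
    [T2Space G] [CompactSpace G]
    (S : YangMills n d M P G) (η : S.Conf → S.TConf →L[ℝ] S.GaugeAlg)
    (hη : S.IsGaugeFixingConnection η) :
    -- the components of the curvature
    S.part20 (S.curv η) = S.phi η ∧
    S.part11 (S.curv η) = S.psi η ∧
    S.part02 (S.curv η) = S.FU ∧
    -- (if `l = 3` the connection is only continuous; it is differentiable at almost every point)
    (∀ (x : S.Conf) (p : P), (3 < S.l ∨ S.ConnDifferentiableAt x p) →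
      S.curv η (x, p) = S.phi η (x, p) + S.psi η (x, p) + S.FU (x, p)) ∧
    -- the `(1, 1)` component vanishes on the vertical vectors of `𝒜`, i.e. the values of `kappa`
    (∀ (x : S.Conf) (p : P) (ξ : S.GaugeAlg) (W : S.TConf × E n),
      S.psi η (x, p) (S.kappa ξ x, 0) W = 0) ∧
    -- the splitting of the `(1, 1)` component
    S.covEta η = S.dP (S.etaForm η) + S.brk S.AU (S.etaForm η) ∧
    S.delta S.AU = S.deltaV η S.AU + S.deltaH η S.AU ∧
    S.deltaV η S.AU = - S.covEta η ∧
    S.deltaH η S.AU = S.psi η ∧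
    -- the splitting of the `(2, 0)` component
    S.delta (S.etaForm η) = S.deltaV η (S.etaForm η) + S.deltaH η (S.etaForm η) ∧
    S.deltaV η (S.etaForm η) = - ((1 / 2 : ℝ) • S.brk (S.etaForm η) (S.etaForm η)) ∧
    S.deltaH η (S.etaForm η) = S.phi η :=
  ⟨YangMills.part20_curv hη, YangMills.part11_curv hη, S.part02_curv η,
    fun x p h => YangMills.curv_eq hη
      (h.elim (fun hl => S.connDifferentiableAt_of_three_lt hl x p) id),
    YangMills.psi_kappa hη, YangMills.covEta_eq hη, S.delta_AU_split η, YangMills.deltaV_AU hη,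
    YangMills.deltaH_AU hη, YangMills.delta_etaForm_split hη, YangMills.deltaV_etaForm hη,
    YangMills.deltaH_etaForm hη⟩
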